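/- Let $(M,\omega,s)$ be a symplectic symmetric space: $M$ is a connected (finite-dimensional, Hausdorff, second countable) $C^\infty$ manifold, $\omega$ is a symplectic form on $M$, and $s:M\times M\to M$, $s(x,y)=s_x(y)$, is a $C^\infty$ map such that (i) each $s_x$ is an involutive symplectic diffeomorphism of $(M,\omega)$; (ii) $x$ is an isolated fixed point of $s_x$; (iii) $s_xs_ys_x=s_{s_x(y)}$ for all $x,y\in M$. A ($C^\infty$) affine connection $\nabla$ on $M$ is called admissible if $\nabla\omega=0$ and every $s_x$ belongs to the group $\mathrm{Aff}(M,\nabla)$ of affine transformations of $(M,\nabla)$. Let $\mathrm{Symp}(M,\omega)$ be the group of symplectic diffeomorphisms and let $\mathrm{Aut}(M,\omega,s)$ be the group of those $\varphi\in\mathrm{Symp}(M,\omega)$ with $\varphi s_x=s_{\varphi(x)}\varphi$ for all $x\in M$. Then: 1. There is one and only one admissible connection $\nabla$ on $M$. 2. For all $C^\infty$ vector fields $X,Y,Z$ and all $x\in M$, $$\omega_x(\nabla_XY,Z)=\tfrac12\,X_x\cdot\omega\bigl(Y+s_{x*}Y,\,Z\bigr).$$ 3. $\nabla$ is torsion-free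 and (geodesically) complete. 4. $\mathrm{Aut}(M,\omega,s)=\mathrm{Aff}(M,\nabla)\cap\mathrm{Symp}(M,\omega)$, and $\mathrm{Aut}(M,\omega,s)$, with the compact-open topology, is a Lie transformation group of $M$: it carries a $C^\infty$ structure compatible with this topology for which it is a finite-dimensional Lie group and its action $\mathrm{Aut}(M,\omega,s)\times M\to M$ is $C^\infty$. -/

import Mathlib

open scoped Manifold ContDiff Topology
open Bundle

noncomputable section

namespace SymplecticSymmetric

/-! ### Vector fields and diffeomorphisms -/

/-- Vector fields on `M`, without any regularity. -/
abbrev VField (E M : Type*) [NormedAddCommGroup E] [NormedSpace ℝ E]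
    [TopologicalSpace M] [ChartedSpace E M] : Type _ :=
  (x : M) → TangentSpace 𝓘(ℝ, E) x

/-- Smooth diffeomorphisms of `M` onto itself. -/
abbrev Diffeo (E M : Type*) [NormedAddCommGroup E] [NormedSpace ℝ E]
    [TopologicalSpace M] [ChartedSpace E M] : Type _ :=
  M ≃ₘ⟮𝓘(ℝ, E), 𝓘(ℝ, E)⟯ M

section Basic

variable {E : Type*} [NormedAddCommGroup E] [NormedSpace ℝ E]
  {M : Type*} [TopologicalSpace M] [ChartedSpace E M]

/-- `Y` is a `C^∞` vector field. -/
def IsSmoothField [IsManifold 𝓘(ℝ, E) ∞ M] (Y : VField E M) : Prop :=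
  ContMDiff 𝓘(ℝ, E) 𝓘(ℝ, E).tangent ∞ (fun x ↦ (⟨x, Y x⟩ : TangentBundle 𝓘(ℝ, E) M))

/-- `v · f`: the derivative at `x` of the function `f` along the tangent vector `v` at `x`. -/
def dirDeriv (f : M → ℝ) (x : M) (v : TangentSpace 𝓘(ℝ, E) x) : ℝ :=
  mvfderiv 𝓘(ℝ, E) f x v

/-- The differential `φ_{*x} : T_x M → T_{φ(x)} M`. -/
def diff (φ : Diffeo E M) (x : M) :
    TangentSpace 𝓘(ℝ, E) x →L[ℝ] TangentSpace 𝓘(ℝ, E) (φ x) :=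
  mfderiv 𝓘(ℝ, E) 𝓘(ℝ, E) φ x

/-- The push-forward `φ_* Y` of a vector field by a diffeomorphism, i.e. its pull-back by `φ⁻¹`:
`(φ_* Y)_y = (d(φ⁻¹)_y)⁻¹ Y_{φ⁻¹(y)}`. -/
def pushforward (φ : Diffeo E M) (Y : VField E M) : VField E M :=
  VectorField.mpullback 𝓘(ℝ, E) 𝓘(ℝ, E) φ.symm Y

/-- The group structure on diffeomorphisms: `φ * ψ = φ ∘ ψ`. -/
instance instGroupDiffeo : Group (Diffeo E M) where
  mul φ ψ := ψ.trans φ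
  one := Diffeomorph.refl 𝓘(ℝ, E) M ∞
  inv φ := φ.symm
  mul_assoc _ _ _ := Diffeomorph.ext fun _ ↦ rfl
  one_mul _ := Diffeomorph.ext fun _ ↦ rfl
  mul_one _ := Diffeomorph.ext fun _ ↦ rfl
  inv_mul_cancel φ := Diffeomorph.ext fun x ↦ φ.symm_apply_apply x

/-- The compact-open topology on the group of diffeomorphisms. -/
instance instTopologicalSpaceDiffeo : TopologicalSpace (Diffeo E M) :=
  TopologicalSpace.induced (fun φ ↦ (⟨φ, φ.continuous⟩ : C(M, M))) inferInstance

lemma mul_apply (φ ψ : Diffeo E M) (x : M) : (φ * ψ) x = φ (ψ x) := rfl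

lemma inv_apply_self (φ : Diffeo E M) (x : M) : φ⁻¹ (φ x) = x := φ.symm_apply_apply x

lemma apply_inv_self (φ : Diffeo E M) (x : M) : φ (φ⁻¹ x) = x := φ.apply_symm_apply x

lemma diff_one (x : M) (v : TangentSpace 𝓘(ℝ, E) x) : diff (1 : Diffeo E M) x v = v := by
  change mfderiv 𝓘(ℝ, E) 𝓘(ℝ, E) id x v = v
  rw [mfderiv_id]; rfl

lemma diff_mul (φ ψ : Diffeo E M) (x : M) (v : TangentSpace 𝓘(ℝ, E) x) :
    diff (φ * ψ) x v = diff φ (ψ x) (diff ψ x v) := by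
  have h := mfderiv_comp (I := 𝓘(ℝ, E)) (I' := 𝓘(ℝ, E)) (I'' := 𝓘(ℝ, E)) x
    (φ.mdifferentiable (by simp) (ψ x)) (ψ.mdifferentiable (by simp) x)
  change mfderiv 𝓘(ℝ, E) 𝓘(ℝ, E) (φ ∘ ψ) x v = _
  rw [h]; rfl

lemma isInvertible_mfderiv (φ : Diffeo E M) (x : M) :
    (mfderiv 𝓘(ℝ, E) 𝓘(ℝ, E) φ x).IsInvertible :=
  ⟨φ.mfderivToContinuousLinearEquiv (by simp) x,
    φ.mfderivToContinuousLinearEquiv_coe (x := x) (by simp)⟩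

lemma diff_diff_inv (φ : Diffeo E M) (x : M) (u : TangentSpace 𝓘(ℝ, E) x) :
    diff φ (φ⁻¹ x) (diff φ⁻¹ x u) = u := by
  have h := diff_mul φ φ⁻¹ x u
  rw [mul_inv_cancel, diff_one] at h
  exact h.symm

lemma diff_inv_diff (φ : Diffeo E M) (x : M) (u : TangentSpace 𝓘(ℝ, E) (φ⁻¹ x)) :
    diff φ⁻¹ x (diff φ (φ⁻¹ x) u) = u := by
  have h := diff_mul φ⁻¹ φ (φ⁻¹ x) u
  rw [inv_mul_cancel, diff_one, apply_inv_self] at h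
  exact h.symm

lemma pushforward_one (Y : VField E M) : pushforward 1 Y = Y :=
  VectorField.mpullback_id

lemma pushforward_mul (φ ψ : Diffeo E M) (Y : VField E M) :
    pushforward (φ * ψ) Y = pushforward φ (pushforward ψ Y) := by
  ext x
  have h := VectorField.mpullbackWithin_comp_of_left (I := 𝓘(ℝ, E)) (I' := 𝓘(ℝ, E))
    (I'' := 𝓘(ℝ, E)) (g := ψ.symm) (f := φ.symm) (V := Y) (s := Set.univ) (t := Set.univ) (x₀ := x)
    (φ.symm.mdifferentiable (by simp) x).mdifferentiableWithinAt (Set.mapsTo_univ _ _)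
    (uniqueMDiffWithinAt_univ _) (by
      rw [mfderivWithin_univ]; exact isInvertible_mfderiv ψ.symm _)
  simp only [VectorField.mpullbackWithin_univ] at h
  exact h

/-- Characterization of the push-forward: `(φ_* Y)_{φ(x)} = φ_{*x} Y_x`. -/
lemma pushforward_apply (φ : Diffeo E M) (Y : VField E M) (x : M) :
    pushforward φ Y (φ x) = diff φ x (Y x) := by
  have h1 : pushforward φ Y (φ x) = (diff φ⁻¹ (φ x)).inverse (Y (φ⁻¹ (φ x))) := rfl
  have hinv : (diff φ⁻¹ (φ x)).IsInvertible := isInvertible_mfderiv φ⁻¹ (φ x)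
  obtain ⟨e, he⟩ := hinv
  rw [h1, ← he, ContinuousLinearMap.inverse_equiv]
  change e.symm (Y (φ⁻¹ (φ x))) = _
  rw [ContinuousLinearEquiv.symm_apply_eq]
  have h3 : diff φ⁻¹ (φ x) (diff φ x (Y x)) = Y (φ⁻¹ (φ x)) := by
    have h := diff_mul φ⁻¹ φ x (Y x)
    rw [inv_mul_cancel, diff_one] at h
    rw [← h, inv_apply_self]
  have h4 : e (diff φ x (Y x)) = diff φ⁻¹ (φ x) (diff φ x (Y x)) := by rw [← he]; rfl
  rw [h4, h3]

lemma IsSmoothField.pushforward [CompleteSpace E] [IsManifold 𝓘(ℝ, E) ∞ M] {Y : VField E M}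
    (hY : IsSmoothField Y) (φ : Diffeo E M) : IsSmoothField (pushforward φ Y) :=
  ContMDiff.mpullback_vectorField (n := ∞) (m := ∞) hY φ.symm.contMDiff
    (fun x ↦ isInvertible_mfderiv φ.symm x) (by simp)

end Basic

/-! ### Symplectic forms -/

/-- A symplectic form on `M`: a smooth, alternating, nondegenerate and closed 2-form.
Closedness is `dΩ(X, Y, Z) = 0` for smooth vector fields, by the invariant formula for `dΩ`. -/
structure SymplecticForm (E M : Type*) [NormedAddCommGroup E] [NormedSpace ℝ E]
    [TopologicalSpace M] [ChartedSpace E M] [IsManifold 𝓘(ℝ, E) ∞ M] where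
  /-- the bilinear form on each tangent space -/
  form : (x : M) → TangentSpace 𝓘(ℝ, E) x →L[ℝ] TangentSpace 𝓘(ℝ, E) x →L[ℝ] ℝ
  smooth : ContMDiff 𝓘(ℝ, E) (𝓘(ℝ, E).prod 𝓘(ℝ, E →L[ℝ] E →L[ℝ] ℝ)) ∞
    (fun x ↦ TotalSpace.mk' (E →L[ℝ] E →L[ℝ] ℝ)
      (E := fun x : M ↦ TangentSpace 𝓘(ℝ, E) x →L[ℝ] TangentSpace 𝓘(ℝ, E) x →L[ℝ] ℝ) x (form x))
  alternating : ∀ x v, form x v v = 0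
  nondegenerate : ∀ x v, (∀ w, form x v w = 0) → v = 0
  closed : ∀ X Y Z : VField E M, IsSmoothField X → IsSmoothField Y → IsSmoothField Z → ∀ x : M,
    dirDeriv (fun y ↦ form y (Y y) (Z y)) x (X x)
      + dirDeriv (fun y ↦ form y (Z y) (X y)) x (Y x)
      + dirDeriv (fun y ↦ form y (X y) (Y y)) x (Z x)
      - form x (VectorField.mlieBracket 𝓘(ℝ, E) X Y x) (Z x)
      - form x (VectorField.mlieBracket 𝓘(ℝ, E) Y Z x) (X x)
      - form x (VectorField.mlieBracket 𝓘(ℝ, E) Z X x) (Y x) = 0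

section Main

variable {E : Type*} [NormedAddCommGroup E] [NormedSpace ℝ E]
  {M : Type*} [TopologicalSpace M] [ChartedSpace E M] [IsManifold 𝓘(ℝ, E) ∞ M]

/-- `φ^* Ω = Ω`. -/
def PreservesForm (Ω : SymplecticForm E M) (φ : Diffeo E M) : Prop :=
  ∀ (x : M) (v w : TangentSpace 𝓘(ℝ, E) x),
    Ω.form (φ x) (diff φ x v) (diff φ x w) = Ω.form x v w

/-- `Symp(M, Ω)`, the group of symplectic diffeomorphisms. -/
def symp (Ω : SymplecticForm E M) : Subgroup (Diffeo E M) where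
  carrier := {φ | PreservesForm Ω φ}
  one_mem' x v w := by
    rw [diff_one, diff_one]; rfl
  mul_mem' {φ ψ} hφ hψ x v w := by
    rw [diff_mul, diff_mul]
    exact (hφ (ψ x) _ _).trans (hψ x v w)
  inv_mem' {φ} hφ x v w := by
    have h := hφ (φ⁻¹ x) (diff φ⁻¹ x v) (diff φ⁻¹ x w)
    rw [← h, diff_diff_inv, diff_diff_inv, apply_inv_self]

/-! ### Affine connections -/

/-- Covariant derivatives on the tangent bundle of `M`; `∇_X Y` at `x` is `cov Y x (X x)`, and it is
meaningful for `Y` differentiable at `x`. -/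
abbrev AffineConnection (E M : Type*) [NormedAddCommGroup E] [NormedSpace ℝ E]
    [TopologicalSpace M] [ChartedSpace E M] [IsManifold 𝓘(ℝ, E) ∞ M] : Type _ :=
  CovariantDerivative 𝓘(ℝ, E) E (fun x : M ↦ TangentSpace 𝓘(ℝ, E) x)

/-- `∇Ω = 0`, i.e. `X · Ω(Y, Z) = Ω(∇_X Y, Z) + Ω(Y, ∇_X Z)`. -/
def IsParallel (cov : AffineConnection E M) (Ω : SymplecticForm E M) : Prop :=
  ∀ Y Z : VField E M, IsSmoothField Y → IsSmoothField Z →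
    ∀ (x : M) (v : TangentSpace 𝓘(ℝ, E) x),
      dirDeriv (fun y ↦ Ω.form y (Y y) (Z y)) x v
        = Ω.form x (cov Y x v) (Z x) + Ω.form x (Y x) (cov Z x v)

/-- `φ` is an affine transformation: `φ_*(∇_X Y) = ∇_{φ_* X} (φ_* Y)`. -/
def IsAffineTransformation (cov : AffineConnection E M) (φ : Diffeo E M) : Prop :=
  ∀ Y : VField E M, IsSmoothField Y → ∀ (x : M) (v : TangentSpace 𝓘(ℝ, E) x),
    diff φ x (cov Y x v) = cov (pushforward φ Y) (φ x) (diff φ x v)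

/-- `Aff(M, ∇)`, the group of affine transformations. -/
def aff [CompleteSpace E] (cov : AffineConnection E M) : Subgroup (Diffeo E M) where
  carrier := {φ | IsAffineTransformation cov φ}
  one_mem' Y _ x v := by
    rw [diff_one, diff_one, pushforward_one]; rfl
  mul_mem' {φ ψ} hφ hψ Y hY x v := by
    rw [diff_mul, diff_mul, hψ Y hY, hφ _ (hY.pushforward ψ), pushforward_mul]
    rfl
  inv_mem' {φ} hφ Y hY x v := by
    have h := hφ _ (hY.pushforward φ⁻¹) (φ⁻¹ x) (diff φ⁻¹ x v)
    rw [← pushforward_mul, mul_inv_cancel, pushforward_one, diff_diff_inv, apply_inv_self] at h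
    rw [← h]
    exact diff_inv_diff φ x _

/-- The velocity `γ'(t)`. -/
def velocity (γ : ℝ → M) (t : ℝ) : TangentSpace 𝓘(ℝ, E) (γ t) :=
  mfderiv 𝓘(ℝ, ℝ) 𝓘(ℝ, E) γ t (1 : ℝ)

/-- The covariant derivative `∇_{γ'} γ'` at time `t` of the velocity of a curve. In the local frame
`e_i` of `TM` around `γ(t)` given by a trivialization, write `γ' = ∑ uⁱ e_i(γ)`; then
`∇_{γ'} γ' = ∑ (uⁱ)' e_i + ∑ uⁱ ∇_{γ'} e_i`. -/
def acceleration (cov : AffineConnection E M) (γ : ℝ → M) (t : ℝ) :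
    TangentSpace 𝓘(ℝ, E) (γ t) :=
  let e := trivializationAt E (fun x : M ↦ TangentSpace 𝓘(ℝ, E) x) (γ t)
  let u : ℝ → E := fun τ ↦ (e ⟨γ τ, velocity γ τ⟩).2
  e.symm (γ t) (deriv u t) + cov (fun y ↦ e.symm y (u t)) (γ t) (velocity γ t)

/-- `γ` restricted to the open set `J` of times is a geodesic. -/
def IsGeodesicOn (cov : AffineConnection E M) (γ : ℝ → M) (J : Set ℝ) : Prop :=
  ContMDiffOn 𝓘(ℝ, ℝ) 𝓘(ℝ, E) ∞ γ J ∧ ∀ t ∈ J, acceleration cov γ t = 0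

/-- The connection is (geodesically) complete: through every tangent vector there is a geodesic
defined on `ℝ`, and every geodesic defined on an open interval extends to a geodesic defined on
`ℝ`. -/
def IsComplete (cov : AffineConnection E M) : Prop :=
  (∀ (x : M) (v : TangentSpace 𝓘(ℝ, E) x), ∃ γ : ℝ → M, IsGeodesicOn cov γ Set.univ ∧
    (⟨γ 0, velocity γ 0⟩ : TangentBundle 𝓘(ℝ, E) M) = ⟨x, v⟩) ∧
  ∀ (J : Set ℝ) (γ : ℝ → M), IsOpen J → J.OrdConnected → IsGeodesicOn cov γ J →
    ∃ γ' : ℝ → M, IsGeodesicOn cov γ' Set.univ ∧ Set.EqOn γ γ' J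

/-! ### Lie transformation groups -/

/-- The group `G` of diffeomorphisms of `M`, with the compact-open topology, is a
(finite-dimensional) Lie transformation group of `M`: it carries a smooth structure for which it is
a Lie group and the evaluation action `G × M → M` is smooth. -/
def IsLieTransformationGroup (G : Subgroup (Diffeo E M)) : Prop :=
  ∃ (k : ℕ) (_ : ChartedSpace (EuclideanSpace ℝ (Fin k)) G),
    LieGroup 𝓘(ℝ, EuclideanSpace ℝ (Fin k)) ∞ G ∧
    ContMDiff (𝓘(ℝ, EuclideanSpace ℝ (Fin k)).prod 𝓘(ℝ, E)) 𝓘(ℝ, E) ∞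
      (fun p : G × M ↦ (p.1 : Diffeo E M) p.2)

end Main

/-! ### Symplectic symmetric spaces -/

/-- The structure of a symplectic symmetric space on a manifold `M`: a symplectic form `Ω`
and a smooth map `s : M × M → M`, `s(x, y) = s_x(y)`, such that each `s_x` is involutive and
symplectic with `x` as an isolated fixed point, and `s_x s_y s_x = s_{s_x(y)}`.
(Connectedness of `M` is a separate hypothesis.) -/
structure SymplecticSymmetricSpace (E M : Type*) [NormedAddCommGroup E] [NormedSpace ℝ E]
    [TopologicalSpace M] [ChartedSpace E M] [IsManifold 𝓘(ℝ, E) ∞ M] where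
  Ω : SymplecticForm E M
  s : M → M → M
  smooth : ContMDiff (𝓘(ℝ, E).prod 𝓘(ℝ, E)) 𝓘(ℝ, E) ∞ (fun p : M × M ↦ s p.1 p.2)
  involutive : ∀ x y, s x (s x y) = y
  symplectic : ∀ (x y : M) (v w : TangentSpace 𝓘(ℝ, E) y),
    Ω.form (s x y) (mfderiv 𝓘(ℝ, E) 𝓘(ℝ, E) (s x) y v) (mfderiv 𝓘(ℝ, E) 𝓘(ℝ, E) (s x) y w)
      = Ω.form y v w
  fixed : ∀ x, s x x = x
  isolated : ∀ x, ∀ᶠ y in 𝓝[≠] x, s x y ≠ y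
  conj : ∀ x y z, s x (s y (s x z)) = s (s x y) z

namespace SymplecticSymmetricSpace

variable {E : Type*} [NormedAddCommGroup E] [NormedSpace ℝ E]
  {M : Type*} [TopologicalSpace M] [ChartedSpace E M] [IsManifold 𝓘(ℝ, E) ∞ M]

lemma contMDiff_s (S : SymplecticSymmetricSpace E M) (x : M) :
    ContMDiff 𝓘(ℝ, E) 𝓘(ℝ, E) ∞ (S.s x) :=
  S.smooth.comp (contMDiff_const.prodMk contMDiff_id)

/-- The symmetry `s_x` as a diffeomorphism of `M`. -/
def symmetry (S : SymplecticSymmetricSpace E M) (x : M) : Diffeo E M where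
  toFun := S.s x
  invFun := S.s x
  left_inv := S.involutive x
  right_inv := S.involutive x
  contMDiff_toFun := S.contMDiff_s x
  contMDiff_invFun := S.contMDiff_s x

/-- `Aut(M, Ω, s)`: the symplectic diffeomorphisms `φ` with `φ s_x = s_{φ(x)} φ` for all `x`. -/
def aut (S : SymplecticSymmetricSpace E M) : Subgroup (Diffeo E M) where
  carrier := {φ | φ ∈ symp S.Ω ∧ ∀ x, φ * S.symmetry x = S.symmetry (φ x) * φ}
  one_mem' := ⟨one_mem _, fun _ ↦ rfl⟩
  mul_mem' {φ ψ} hφ hψ := ⟨mul_mem hφ.1 hψ.1, fun x ↦ by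
    rw [mul_assoc, hψ.2 x, ← mul_assoc, hφ.2, mul_assoc]; rfl⟩
  inv_mem' {φ} hφ := ⟨inv_mem hφ.1, fun x ↦ by
    have h := hφ.2 (φ⁻¹ x)
    rw [apply_inv_self] at h
    rw [inv_mul_eq_iff_eq_mul, ← mul_assoc, h, mul_inv_cancel_right]⟩

/-- An affine connection (of class `C^∞`) is admissible if `∇Ω = 0` and all symmetries are affine
transformations. -/
structure IsAdmissible [CompleteSpace E] (S : SymplecticSymmetricSpace E M)
    (cov : AffineConnection E M) : Prop where
  smooth : CovariantDerivative.ContMDiffCovariantDerivative cov ∞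
  parallel : IsParallel cov S.Ω
  affine : ∀ x, S.symmetry x ∈ aff cov

end SymplecticSymmetricSpace

end SymplecticSymmetric

end

open SymplecticSymmetric

/-! Everything comes from the 1-jet of the symmetries at their centres. Near an isolated fixed point
an involution is conjugate to its differential, so that differential has no eigenvalue `1` and
equals `-1` (`fderiv_eq_neg_id_of_isolated`). In a chart, `f(p, z) = s_p(z)` therefore has partial
derivatives `2` and `-1` at `(p, p)` (`hasFDerivAt_localSymm`).

Connection. Let `Γ_p` be `-1/2` times the second derivative of `f(p, ·)` at `p`. A smooth
homomorphism, i.e. a map with `φ ∘ s_p = s_{φ(p)} ∘ φ`, can be differentiated twice in this identity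
at `p`; the result is the transformation law of Christoffel symbols (`fderiv_fderiv_localRep`). For
`φ = id` it says that the `Γ` of different charts define one connection, torsion-free because second
derivatives are symmetric. For general `φ` it says that the connection is invariant, in particular
under every `s_x`. Uniqueness and `∇ω = 0` are parity arguments. The difference of two invariant
connections is a tensor with three indices, and `s_x` acts by `-1` on `T_x M`, so it vanishes
(`covAt_eq_of_symmetry_mem_aff`). The field `Y + s_{x*}Y` vanishes at `x` and has covariant
derivative `2∇Y` there, so differentiating its pairing with `Z` gives the explicit formula;
expanding the pairing of `Y + s_{x*}Y` with `Z + s_{x*}Z`, which vanishes to second order at `x`,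
gives parallelism (`dirDeriv_apply_eq`).

Completeness. By uniqueness for the geodesic equation `s_{γ(r)}` reverses `γ` about time `r`
(`s_geodesic`). A product of two such symmetries shifts time along `γ`, and its powers extend a
geodesic to all of `ℝ`.

Affine transformations. In charts the 1-jet of an affine map solves a total differential equation
with locally Lipschitz right-hand side, so on a connected manifold it is determined by its value at
one point (`eq_of_mem_aff`). If `φ` is affine, `φ s_x` and `s_{φ(x)} φ` have the same 1-jet at `x`,
hence coincide.

Lie group. The map `x ↦ s_x(o)` fixes `o` with differential `2`. Koenigs' limit `2ⁿPⁿ`, with `P` its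
local inverse, conjugates it to multiplication by `2`, and all smooth homomorphisms fixing `o`
become linear in the resulting chart (`nonempty_normalChart`). The linear parts of the automorphisms
fixing `o` form a group closed among invertible operators (`mem_isotropy_of_tendsto`), hence
parametrized near `1` by the exponential of a subspace (`exists_log`). Every automorphism near `1`
is a transvection moving `o` times one fixing `o`, which gives a chart at `1`; left translations
give the others. Local statements spread over `M` because a nonempty open set stable under `(u, m) ↦
s_u(m)` is everything (`eq_univ_of_isOpen_of_stable`). -/

namespace SymplecticSymmetric

/-! ### Inverse function theorem on open sets -/

section InverseFunction

variable {F G : Type*} [NormedAddCommGroup F] [NormedSpace ℝ F] [CompleteSpace F]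
  [NormedAddCommGroup G] [NormedSpace ℝ G]

/-- The inverse function theorem for maps which are smooth on an open set. -/
theorem exists_openPartialHomeomorph_of_hasFDerivAt {f : F → G} {U : Set F} (hU : IsOpen U) {a : F}
    (ha : a ∈ U) (hf : ContDiffOn ℝ ∞ f U) {f' : F ≃L[ℝ] G}
    (h : HasFDerivAt f (f' : F →L[ℝ] G) a) :
    ∃ e : OpenPartialHomeomorph F G, (e : F → G) = f ∧ a ∈ e.source ∧ e.source ⊆ U ∧
      ContDiffOn ℝ ∞ e.symm e.target := by
  have hc : ContDiffAt ℝ ∞ f a := hf.contDiffAt (hU.mem_nhds ha)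
  have hn : (∞ : WithTop ℕ∞) ≠ 0 := by simp
  have hfd : ContinuousOn (fderiv ℝ f) U := hf.continuousOn_fderiv_of_isOpen hU (by simp)
  -- Invertible operators form an open set. Restricting to the points where the derivative is
  -- invertible makes the inverse smooth on the whole target, not only at the image of `a`.
  have hV : IsOpen (U ∩ fderiv ℝ f ⁻¹' Set.range ((↑) : (F ≃L[ℝ] G) → F →L[ℝ] G)) :=
    hfd.isOpen_inter_preimage hU ContinuousLinearEquiv.isOpen
  let e0 := hc.toOpenPartialHomeomorph f h hn
  let e := e0.restrOpen _ hV
  have he : (e : F → G) = f := rfl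
  refine ⟨e, he, ?_, fun x hx ↦ ?_, fun y hy ↦ ?_⟩
  · exact ⟨hc.mem_toOpenPartialHomeomorph_source h hn, ha, f', h.fderiv.symm⟩
  · exact hx.2.1
  · have hx : e.symm y ∈ e.source := e.map_target hy
    obtain ⟨g, hg⟩ := hx.2.2
    have hfx : ContDiffAt ℝ ∞ f (e.symm y) := hf.contDiffAt (hU.mem_nhds hx.2.1)
    refine (e.contDiffAt_symm hy (f₀' := g) ?_ hfx).contDiffWithinAt
    rw [hg]
    exact (hfx.differentiableAt (by simp)).hasFDerivAt

end InverseFunction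

/-! ### Involutions at isolated fixed points -/

section Involution

variable {F : Type*} [NormedAddCommGroup F] [NormedSpace ℝ F] [CompleteSpace F]

/-- The differential of an involution at an isolated fixed point is `-1`. -/
theorem fderiv_eq_neg_id_of_isolated {f : F → F} {p : F} (hf : ContDiffAt ℝ ∞ f p) (hp : f p = p)
    (hinv : ∀ᶠ z in 𝓝 p, f (f z) = z) (hiso : ∀ᶠ z in 𝓝[≠] p, f z ≠ z) :
    fderiv ℝ f p = -ContinuousLinearMap.id ℝ F := by
  set A := fderiv ℝ f p with hA
  have hfA : HasStrictFDerivAt f A p := hf.hasStrictFDerivAt (by simp)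
  have hAA : A.comp A = ContinuousLinearMap.id ℝ F := by
    have h1 : HasFDerivAt (fun z ↦ f (f z)) (A.comp A) p := by
      have : HasFDerivAt f A (f p) := by rw [hp]; exact hfA.hasFDerivAt
      exact this.comp p hfA.hasFDerivAt
    have h2 : HasFDerivAt (fun z ↦ f (f z)) (ContinuousLinearMap.id ℝ F) p :=
      (hasFDerivAt_id p).congr_of_eventuallyEq hinv
    exact h1.unique h2
  have hAA' : ∀ w, A (A w) = w := fun w ↦ by
    simpa using congrArg (fun T : F →L[ℝ] F ↦ T w) hAA
  -- Averaging over the two-element group: `Φ ∘ f = A ∘ Φ` because `A² = 1`, and `Φ` has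
  -- differential `1 + A² = 2`, so it is a local coordinate in which `f` is linear.
  let Φ : F → F := fun z ↦ (z - p) + A (f z - p)
  have hΦ : HasStrictFDerivAt Φ
      ((ContinuousLinearEquiv.smulLeft (Units.mk0 (2 : ℝ) two_ne_zero) : F ≃L[ℝ] F) : F →L[ℝ] F)
      p := by
    have h1 : HasStrictFDerivAt Φ (ContinuousLinearMap.id ℝ F + A.comp A) p :=
      ((hasStrictFDerivAt_id p).sub_const p).add (A.hasStrictFDerivAt.comp p (hfA.sub_const p))
    convert h1 using 1
    rw [hAA]
    ext w
    simp [Units.smul_def, two_smul]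
  let e := hΦ.toOpenPartialHomeomorph Φ
  have hpe : p ∈ e.source := hΦ.mem_toOpenPartialHomeomorph_source
  have heΦ : ∀ z, e z = Φ z := fun z ↦ rfl
  have hΦp : Φ p = 0 := by simp [Φ, hp]
  have h0t : (0 : F) ∈ e.target := by rw [← hΦp]; exact e.map_source hpe
  have he0 : e.symm 0 = p := by rw [← hΦp, ← heΦ, e.left_inv hpe]
  have hcont : ContinuousAt e.symm 0 := e.continuousAt_symm h0t
  -- A vector fixed by `A` would give the curve `Φ⁻¹(t v)` of fixed points of `f` accumulating at
  -- `p`.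
  have key : ∀ v : F, A v = v → v = 0 := by
    intro v hv
    by_contra hv0
    have htend : Filter.Tendsto (fun t : ℝ ↦ e.symm (t • v)) (𝓝 0) (𝓝 p) := by
      have h1 : Filter.Tendsto (fun t : ℝ ↦ t • v) (𝓝 0) (𝓝 0) :=
        Continuous.tendsto' (by fun_prop) _ _ (by simp)
      have h2 := hcont.tendsto.comp h1
      rwa [he0] at h2
    have htv : ∀ᶠ t : ℝ in 𝓝 0, t • v ∈ e.target := by
      have h1 : Filter.Tendsto (fun t : ℝ ↦ t • v) (𝓝 0) (𝓝 0) :=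
        Continuous.tendsto' (by fun_prop) _ _ (by simp)
      exact h1 (e.open_target.mem_nhds h0t)
    have hfc : Filter.Tendsto (fun t : ℝ ↦ f (e.symm (t • v))) (𝓝 0) (𝓝 p) := by
      have := hf.continuousAt.tendsto
      rw [hp] at this
      exact this.comp htend
    have h1 := htend.eventually hinv
    have h2 := hfc.eventually (e.open_source.mem_nhds hpe)
    have h3 := htend.eventually (eventually_nhdsWithin_iff.1 hiso)
    have h4 := ((h1.and h2).and (h3.and htv)).filter_mono (nhdsWithin_le_nhds (s := {0}ᶜ))
    obtain ⟨t, ⟨⟨h1, h2⟩, h3, h4⟩, ht0⟩ := (h4.and self_mem_nhdsWithin).exists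
    have ht0 : t ≠ 0 := ht0
    set z := e.symm (t • v) with hz
    have hzs : z ∈ e.source := e.map_target h4
    have hΦz : Φ z = t • v := by rw [← heΦ, hz, e.right_inv h4]
    have hΦf : Φ (f z) = A (Φ z) := by
      simp only [Φ, h1, map_add, hAA']
      abel
    have : f z = z := by
      apply e.injOn h2 hzs
      rw [heΦ, heΦ, hΦf, hΦz, map_smul, hv]
    refine h3 ?_ this
    intro hzp
    have hzp : z = p := hzp
    rw [hzp, hΦp] at hΦz
    exact smul_ne_zero ht0 hv0 hΦz.symm
  ext w
  -- `w + A w` always lies in the eigenspace of `1`, which is zero.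
  have h1 : A (w + A w) = w + A w := by rw [map_add, hAA', add_comm]
  have h2 := key _ h1
  simpa using eq_neg_of_add_eq_zero_right h2

end Involution

end SymplecticSymmetric

namespace SymplecticSymmetric

/-! ### Operator-valued smooth maps in finite dimension -/

section FiniteDimensional

variable {F G : Type*} [NormedAddCommGroup F] [NormedSpace ℝ F] [FiniteDimensional ℝ F]
  [NormedAddCommGroup G] [NormedSpace ℝ G]

/-- The coordinates in a basis of a finite-dimensional space, as continuous linear forms. -/
noncomputable def coordCLM (F : Type*) [NormedAddCommGroup F] [NormedSpace ℝ F]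
    [FiniteDimensional ℝ F] (i : Fin (Module.finrank ℝ F)) : F →L[ℝ] ℝ :=
  LinearMap.toContinuousLinearMap ((Module.finBasis ℝ F).coord i)

theorem clm_eq_sum_smulRight (L : F →L[ℝ] G) :
    L = ∑ i, (coordCLM F i).smulRight (L (Module.finBasis ℝ F i)) := by
  ext v
  conv_lhs => rw [← (Module.finBasis ℝ F).sum_repr v, map_sum]
  simp [coordCLM]

/-- In finite dimension an operator is a fixed linear expression in its values on a basis, so
regularity may be tested one vector at a time. -/
theorem contDiffAt_clm_of_apply {D : Type*} [NormedAddCommGroup D] [NormedSpace ℝ D]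
    {n : WithTop ℕ∞} {f : D → F →L[ℝ] G} {x : D}
    (h : ∀ v, ContDiffAt ℝ n (fun y ↦ f y v) x) : ContDiffAt ℝ n f x := by
  have : f = fun y ↦ ∑ i, (coordCLM F i).smulRight (f y (Module.finBasis ℝ F i)) :=
    funext fun y ↦ clm_eq_sum_smulRight (f y)
  rw [this]
  refine ContDiffAt.sum fun i _ ↦ ?_
  exact (ContinuousLinearMap.smulRightL ℝ F G (coordCLM F i)).contDiff.contDiffAt.comp x (h _)

end FiniteDimensional

/-! ### Koenigs linearization of contracting germs -/

section Koenigs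

open Filter Metric

/-- Serves both for the sequence `2ⁿPⁿ` and for its derivatives; the limit is irrelevant off `s` and
is set to `0` there. -/
theorem exists_tendstoUniformlyOn_of_geometric {X F : Type*} [NormedAddCommGroup F]
    [CompleteSpace F] {f : ℕ → X → F} {s : Set X} {C q : ℝ} (hq : q < 1) (hq0 : 0 ≤ q)
    (h : ∀ n, ∀ x ∈ s, ‖f (n + 1) x - f n x‖ ≤ C * q ^ n) :
    ∃ g : X → F, TendstoUniformlyOn f g atTop s := by
  have h' : ∀ x ∈ s, ∀ n, dist (f n x) (f (n + 1) x) ≤ C * q ^ n := fun x hx n ↦ by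
    rw [dist_comm, dist_eq_norm]; exact h n x hx
  have hg : ∀ x, ∃ y, x ∈ s → Tendsto (fun n ↦ f n x) atTop (𝓝 y) := by
    intro x
    by_cases hx : x ∈ s
    · obtain ⟨y, hy⟩ := cauchySeq_tendsto_of_complete (cauchySeq_of_le_geometric q C hq (h' x hx))
      exact ⟨y, fun _ ↦ hy⟩
    · exact ⟨0, fun h ↦ absurd h hx⟩
  choose g hg using hg
  refine ⟨g, Metric.tendstoUniformlyOn_iff.2 fun ε hε ↦ ?_⟩
  have ht : Tendsto (fun n : ℕ ↦ C * q ^ n / (1 - q)) atTop (𝓝 0) := by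
    have := ((tendsto_pow_atTop_nhds_zero_of_lt_one hq0 hq).const_mul C).div_const (1 - q)
    simpa using this
  filter_upwards [ht.eventually (gt_mem_nhds hε)] with n hn x hx
  rw [dist_comm]
  exact (dist_le_of_le_geometric_of_tendsto q C hq (h' x hx) (hg x hx) n).trans_lt hn

universe u

variable {F : Type u} [NormedAddCommGroup F] [NormedSpace ℝ F]

/-- `2⁻¹`-contracting germs: smooth maps fixing `0`, with differential `2⁻¹` there. -/
structure IsHalfContraction (P : F → F) (U : Set F) : Prop where
  isOpen : IsOpen U
  zero_mem : (0 : F) ∈ U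
  contDiffOn : ContDiffOn ℝ ∞ P U
  map_zero : P 0 = 0
  hasFDerivAt : HasFDerivAt P ((2⁻¹ : ℝ) • ContinuousLinearMap.id ℝ F) 0

/-- The approximations `2ⁿ Pⁿ` of the Koenigs linearization. -/
noncomputable def koenigsSeq (P : F → F) (n : ℕ) (y : F) : F := (2 : ℝ) ^ n • P^[n] y

/-- The Koenigs linearization `lim 2ⁿ Pⁿ`. -/
noncomputable def koenigs (P : F → F) (y : F) : F := limUnder atTop (fun n ↦ koenigsSeq P n y)

variable {P : F → F} {U : Set F}

/-- The quadratic remainder comes from the derivative being Lipschitz near `0`. Convergence of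
`2ⁿPⁿ` needs a contraction factor `q` with `2q² < 1`; the value `3/5` qualifies, since `2 (3/5)² =
18/25`. -/
theorem IsHalfContraction.exists_bound (hP : IsHalfContraction P U) :
    ∃ r C : ℝ, 0 < r ∧ 0 ≤ C ∧ ball 0 r ⊆ U ∧ (∀ y ∈ ball (0 : F) r, ‖P y‖ ≤ (3 / 5) * ‖y‖) ∧
      ∀ y ∈ ball (0 : F) r, ‖P y - (2⁻¹ : ℝ) • y‖ ≤ C * ‖y‖ ^ 2 := by
  have h0 : U ∈ 𝓝 (0 : F) := hP.isOpen.mem_nhds hP.zero_mem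
  have hc : ContDiffAt ℝ ∞ P 0 := hP.contDiffOn.contDiffAt h0
  obtain ⟨K, t, ht, hK⟩ := ((hc.fderiv_right (m := ∞) (by simp)).of_le (by simp)).exists_lipschitzOnWith
  obtain ⟨r, hr, hrt⟩ := Metric.mem_nhds_iff.1 (inter_mem ht h0)
  have hfd : fderiv ℝ P 0 = (2⁻¹ : ℝ) • ContinuousLinearMap.id ℝ F := hP.hasFDerivAt.fderiv
  have hquad : ∀ y ∈ ball (0 : F) r, ‖P y - (2⁻¹ : ℝ) • y‖ ≤ K * ‖y‖ ^ 2 := by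
    intro y hy
    have hsub : closedBall (0 : F) ‖y‖ ⊆ ball 0 r :=
      closedBall_subset_ball (by simpa using hy)
    have := (convex_closedBall (0 : F) ‖y‖).norm_image_sub_le_of_norm_hasFDerivWithin_le'
      (f := P) (f' := fun z ↦ fderiv ℝ P z) (φ := (2⁻¹ : ℝ) • ContinuousLinearMap.id ℝ F)
      (C := K * ‖y‖) (x := 0) (y := y) (fun z hz ↦ ?_) (fun z hz ↦ ?_) (by simp) (by simp)
    · simpa [hP.map_zero, pow_two, mul_assoc] using this
    · exact ((hP.contDiffOn.contDiffAt (hP.isOpen.mem_nhds (hrt (hsub hz)).2)).differentiableAt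
        (by simp)).hasFDerivAt.hasFDerivWithinAt
    · rw [← hfd, ← dist_eq_norm]
      refine (hK.dist_le_mul z (hrt (hsub hz)).1 0 (hrt (mem_ball_self hr)).1).trans ?_
      gcongr
      simpa using hz
  -- This radius forces `K‖y‖ ≤ 1/10`, and `1/2 + 1/10 = 3/5`.
  refine ⟨min r (1 / (10 * (K + 1))), K, by positivity, K.2,
    fun y hy ↦ (hrt (ball_subset_ball (min_le_left _ _) hy)).2, fun y hy ↦ ?_,
    fun y hy ↦ hquad y (ball_subset_ball (min_le_left _ _) hy)⟩
  have h1 := hquad y (ball_subset_ball (min_le_left _ _) hy)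
  have h2 : ‖y‖ < 1 / (10 * (K + 1)) := by
    have := ball_subset_ball (min_le_right _ _) hy
    simpa using this
  have h3 : (K : ℝ) * ‖y‖ ≤ 1 / 10 := by
    have hK1 : (0 : ℝ) < 10 * (K + 1) := by positivity
    rw [lt_div_iff₀ hK1] at h2
    nlinarith [norm_nonneg y, K.2]
  have h4 : ‖P y‖ ≤ ‖P y - (2⁻¹ : ℝ) • y‖ + ‖(2⁻¹ : ℝ) • y‖ := by
    simpa using norm_add_le (P y - (2⁻¹ : ℝ) • y) ((2⁻¹ : ℝ) • y)
  rw [norm_smul] at h4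
  norm_num at h4
  nlinarith [norm_nonneg y]

omit [NormedSpace ℝ F] in
theorem IsHalfContraction.iterate_bound {r : ℝ} (h : ∀ y ∈ ball (0 : F) r, ‖P y‖ ≤ (3 / 5) * ‖y‖)
    (n : ℕ) {y : F} (hy : y ∈ ball (0 : F) r) :
    P^[n] y ∈ ball (0 : F) r ∧ ‖P^[n] y‖ ≤ (3 / 5) ^ n * ‖y‖ := by
  induction n with
  | zero => simpa using hy
  | succ n ih =>
    rw [Function.iterate_succ_apply']
    have h1 := h _ ih.1
    have h2 : ‖P^[n] y‖ < r := by simpa using ih.1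
    refine ⟨?_, ?_⟩
    · rw [mem_ball_zero_iff]
      linarith [norm_nonneg (P^[n] y)]
    · rw [pow_succ']
      calc _ ≤ _ := h1
        _ ≤ 3 / 5 * ((3 / 5) ^ n * ‖y‖) := by gcongr; exact ih.2
        _ = _ := by ring

/-- The difference is `2ⁿ⁺¹ (P - 1/2)` evaluated at `Pⁿ y`. The remainder is quadratic in `‖Pⁿ y‖ ≤
(3/5)ⁿ‖y‖`, which beats the factor `2ⁿ`. -/
theorem IsHalfContraction.koenigsSeq_bound {r C : ℝ}
    (h : ∀ y ∈ ball (0 : F) r, ‖P y‖ ≤ (3 / 5) * ‖y‖) (hC : 0 ≤ C)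
    (h' : ∀ y ∈ ball (0 : F) r, ‖P y - (2⁻¹ : ℝ) • y‖ ≤ C * ‖y‖ ^ 2) (n : ℕ) {y : F}
    (hy : y ∈ ball (0 : F) r) :
    ‖koenigsSeq P (n + 1) y - koenigsSeq P n y‖ ≤ 2 * C * ‖y‖ ^ 2 * (18 / 25) ^ n := by
  obtain ⟨h1, h2⟩ := iterate_bound h n hy
  have e : koenigsSeq P (n + 1) y - koenigsSeq P n y
      = (2 : ℝ) ^ (n + 1) • (P (P^[n] y) - (2⁻¹ : ℝ) • P^[n] y) := by
    simp only [koenigsSeq, Function.iterate_succ_apply', smul_sub, smul_smul]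
    congr 2
    rw [pow_succ]; ring
  rw [e, norm_smul, norm_pow, Real.norm_ofNat]
  calc (2 : ℝ) ^ (n + 1) * ‖P (P^[n] y) - (2⁻¹ : ℝ) • P^[n] y‖
      ≤ 2 ^ (n + 1) * (C * ((3 / 5) ^ n * ‖y‖) ^ 2) := by
        gcongr
        exact (h' _ h1).trans (by gcongr)
    _ = 2 * C * ‖y‖ ^ 2 * (2 * (3 / 5) ^ 2) ^ n := by
        rw [mul_pow, mul_pow (2 : ℝ), ← pow_mul, ← pow_mul, pow_succ, mul_comm n 2]; ring
    _ = _ := by norm_num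

theorem IsHalfContraction.koenigsSeq_bound_radius {r C : ℝ}
    (h : ∀ y ∈ ball (0 : F) r, ‖P y‖ ≤ (3 / 5) * ‖y‖) (hC : 0 ≤ C)
    (h' : ∀ y ∈ ball (0 : F) r, ‖P y - (2⁻¹ : ℝ) • y‖ ≤ C * ‖y‖ ^ 2) (n : ℕ) {y : F}
    (hy : y ∈ ball (0 : F) r) :
    ‖koenigsSeq P (n + 1) y - koenigsSeq P n y‖ ≤ 2 * C * r ^ 2 * (18 / 25) ^ n := by
  have hyr : ‖y‖ < r := by simpa using hy
  refine (koenigsSeq_bound h hC h' n hy).trans ?_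
  gcongr

theorem IsHalfContraction.contDiffOn_iterate {r : ℝ} (hP : IsHalfContraction P U)
    (hr : ball 0 r ⊆ U) (h : ∀ y ∈ ball (0 : F) r, ‖P y‖ ≤ (3 / 5) * ‖y‖) (n : ℕ) :
    ContDiffOn ℝ ∞ (P^[n]) (ball 0 r) := by
  induction n with
  | zero => exact contDiffOn_id
  | succ n ih =>
    rw [Function.iterate_succ']
    exact hP.contDiffOn.comp ih fun y hy ↦ hr (iterate_bound h n hy).1

theorem IsHalfContraction.koenigs_tendsto [CompleteSpace F] {r C : ℝ}
    (h : ∀ y ∈ ball (0 : F) r, ‖P y‖ ≤ (3 / 5) * ‖y‖) (hC : 0 ≤ C)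
    (h' : ∀ y ∈ ball (0 : F) r, ‖P y - (2⁻¹ : ℝ) • y‖ ≤ C * ‖y‖ ^ 2) :
    TendstoUniformlyOn (koenigsSeq P) (koenigs P) atTop (ball 0 r) := by
  obtain ⟨g, hg⟩ := exists_tendstoUniformlyOn_of_geometric (f := koenigsSeq P) (s := ball 0 r)
    (q := 18 / 25) (by norm_num) (by norm_num) (fun n x hx ↦ koenigsSeq_bound_radius h hC h' n hx)
  exact hg.congr_right fun y hy ↦ (hg.tendsto_at hy).limUnder_eq.symm

/-- The tangent map of `P`. -/
noncomputable def tangentMapOf (P : F → F) (p : F × F) : F × F := (P p.1, fderiv ℝ P p.1 p.2)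

/-- The class of half contractions is stable under the tangent functor, whose iterates are the
derivatives of the iterates. This lets regularity of the limit be gained one order at a time. -/
theorem IsHalfContraction.tangent (hP : IsHalfContraction P U) :
    IsHalfContraction (tangentMapOf P) (U ×ˢ Set.univ) where
  isOpen := hP.isOpen.prod isOpen_univ
  zero_mem := ⟨hP.zero_mem, trivial⟩
  contDiffOn := by
    refine (hP.contDiffOn.comp contDiffOn_fst fun p hp ↦ hp.1).prodMk ?_
    have h1 : ContDiffOn ℝ ∞ (fderiv ℝ P) U := hP.contDiffOn.fderiv_of_isOpen hP.isOpen (by simp)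
    exact (h1.comp contDiffOn_fst fun p hp ↦ hp.1).clm_apply contDiffOn_snd
  map_zero := by simp [tangentMapOf, hP.map_zero]
  hasFDerivAt := by
    have h0 : U ∈ 𝓝 (0 : F) := hP.isOpen.mem_nhds hP.zero_mem
    have hc : ContDiffAt ℝ ∞ P 0 := hP.contDiffOn.contDiffAt h0
    have h1 : HasFDerivAt (fderiv ℝ P) (fderiv ℝ (fderiv ℝ P) 0) (0 : F) :=
      ((hc.fderiv_right (m := ∞) (by simp)).differentiableAt (by simp)).hasFDerivAt
    have h2 : HasFDerivAt (fun p : F × F ↦ P p.1)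
        (((2⁻¹ : ℝ) • ContinuousLinearMap.id ℝ F).comp (ContinuousLinearMap.fst ℝ F F))
        (0 : F × F) :=
      HasFDerivAt.comp (g := P) (0 : F × F) hP.hasFDerivAt hasFDerivAt_fst
    have h3 : HasFDerivAt (fun p : F × F ↦ fderiv ℝ P p.1)
        ((fderiv ℝ (fderiv ℝ P) 0).comp (ContinuousLinearMap.fst ℝ F F)) (0 : F × F) :=
      HasFDerivAt.comp (g := fderiv ℝ P) (0 : F × F) h1 hasFDerivAt_fst
    have h4 := h2.prodMk (h3.clm_apply hasFDerivAt_snd)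
    have h5 : HasFDerivAt (tangentMapOf P) _ 0 := h4
    refine h5.congr_fderiv ?_
    ext p <;> simp [hP.hasFDerivAt.fderiv]

theorem IsHalfContraction.tangent_iterate {r : ℝ} (hP : IsHalfContraction P U)
    (hr : ball 0 r ⊆ U) (h : ∀ y ∈ ball (0 : F) r, ‖P y‖ ≤ (3 / 5) * ‖y‖) (n : ℕ) {y : F}
    (hy : y ∈ ball (0 : F) r) (w : F) :
    (tangentMapOf P)^[n] (y, w) = (P^[n] y, fderiv ℝ (P^[n]) y w) := by
  induction n with
  | zero => simp
  | succ n ih =>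
    rw [Function.iterate_succ_apply', ih, Function.iterate_succ_apply', tangentMapOf,
      Function.iterate_succ', fderiv_comp]
    · rfl
    · exact (hP.contDiffOn.contDiffAt (hP.isOpen.mem_nhds
        (hr (iterate_bound h n hy).1))).differentiableAt (by simp)
    · exact ((hP.contDiffOn_iterate hr h n).contDiffAt (isOpen_ball.mem_nhds hy)).differentiableAt
        (by simp)

/-- The derivative of `koenigs P` is the second component of `koenigs (tangentMapOf P)`, so class
`C^k` for the tangent map gives class `C^(k+1)` for `P`. -/
theorem IsHalfContraction.contDiffAt_koenigs [FiniteDimensional ℝ F] (hP : IsHalfContraction P U)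
    (k : ℕ) : ContDiffAt ℝ k (koenigs P) 0 := by
  -- The induction on `k` passes from `F` to `F × F`, so the space must vary with the hypothesis;
  -- both lie in one universe.
  have aux : ∀ (k : ℕ) (F : Type u) [NormedAddCommGroup F] [NormedSpace ℝ F]
      [FiniteDimensional ℝ F] (P : F → F) (U : Set F), IsHalfContraction P U →
      ContDiffAt ℝ k (koenigs P) 0 := by
    clear * -
    intro k
    induction k with
    | zero =>
      intro F _ _ _ P U hP
      have : CompleteSpace F := FiniteDimensional.complete ℝ F
      obtain ⟨r, C, hr, hC, hrU, h1, h2⟩ := hP.exists_bound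
      have ht := koenigs_tendsto h1 hC h2
      have hc : ContinuousOn (koenigs P) (ball 0 r) := by
        refine ht.continuousOn (Eventually.of_forall fun n ↦ ?_).frequently
        exact ((hP.contDiffOn_iterate hrU h1 n).continuousOn).const_smul _
      exact (contDiffOn_zero.2 hc).contDiffAt (ball_mem_nhds _ hr)
    | succ k ih =>
      intro F _ _ _ P U hP
      have : CompleteSpace F := FiniteDimensional.complete ℝ F
      obtain ⟨r, C, hr, hC, hrU, h1, h2⟩ := hP.exists_bound
      have ht := koenigs_tendsto h1 hC h2
      obtain ⟨ρ, C', hρ, hC', -, h1', h2'⟩ := hP.tangent.exists_bound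
      have ht' := koenigs_tendsto h1' hC' h2'
      set ε := min r ρ with hε
      have hε0 : 0 < ε := lt_min hr hρ
      have hseq : ∀ n, ∀ y ∈ ball (0 : F) ε,
          HasFDerivAt (koenigsSeq P n) ((2 : ℝ) ^ n • fderiv ℝ (P^[n]) y) y := by
        intro n y hy
        have hy' := ball_subset_ball (min_le_left r ρ) hy
        exact (((hP.contDiffOn_iterate hrU h1 n).contDiffAt
          (isOpen_ball.mem_nhds hy')).differentiableAt (by simp)).hasFDerivAt.const_smul _
      have htan : ∀ n, ∀ y ∈ ball (0 : F) ε, ∀ w,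
          ((2 : ℝ) ^ n • fderiv ℝ (P^[n]) y) w = (koenigsSeq (tangentMapOf P) n (y, w)).2 := by
        intro n y hy w
        rw [koenigsSeq, hP.tangent_iterate hrU h1 n (ball_subset_ball (min_le_left r ρ) hy)]
        rfl
      obtain ⟨g, hg⟩ := exists_tendstoUniformlyOn_of_geometric
        (f := fun n y ↦ (2 : ℝ) ^ n • fderiv ℝ (P^[n]) y) (s := ball (0 : F) ε) (q := 18 / 25)
        (C := 2 * C' * ρ ^ 2 / (ε / 2))
        (by norm_num) (by norm_num) (fun n y hy ↦ by
          -- The estimates for the tangent map hold only for `(y, w)` in a small ball. Linearity in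
          -- `w` turns a bound on the shell `ε/2 ≤ ‖w‖ < ε` into an operator norm bound, whence the
          -- division by `ε/2`.
          refine ContinuousLinearMap.opNorm_le_of_shell hε0
            (by positivity) (c := (2 : ℝ)) (by norm_num) fun w hw1 hw2 ↦ ?_
          have hyw : (y, w) ∈ ball (0 : F × F) ρ := by
            rw [mem_ball_zero_iff, Prod.norm_def]
            have : ‖y‖ < ε := by simpa using hy
            exact max_lt (this.trans_le (min_le_right _ _)) (hw2.trans_le (min_le_right _ _))
          have hb := koenigsSeq_bound_radius h1' hC' h2' n hyw
          rw [sub_apply, htan _ _ hy, htan _ _ hy, ← Prod.snd_sub]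
          refine ((norm_snd_le _).trans hb).trans ?_
          have hw1 : ε / 2 ≤ ‖w‖ := by simpa using hw1
          calc 2 * C' * ρ ^ 2 * (18 / 25) ^ n
              = 2 * C' * ρ ^ 2 / (ε / 2) * (18 / 25) ^ n * (ε / 2) := by
                field_simp
            _ ≤ _ := by gcongr)
      have hder : ∀ y ∈ ball (0 : F) ε, HasFDerivAt (koenigs P) (g y) y := fun y hy ↦
        hasFDerivAt_of_tendstoUniformlyOn isOpen_ball hg hseq
          (fun x hx ↦ ht.tendsto_at (ball_subset_ball (min_le_left r ρ) hx)) hy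
      have hgw : ∀ y ∈ ball (0 : F) ε, ∀ w ∈ ball (0 : F) ε,
          g y w = (koenigs (tangentMapOf P) (y, w)).2 := by
        intro y hy w hw
        have hyw : (y, w) ∈ ball (0 : F × F) ρ := by
          rw [mem_ball_zero_iff, Prod.norm_def]
          have h3 : ‖y‖ < ε := by simpa using hy
          have h4 : ‖w‖ < ε := by simpa using hw
          exact max_lt (h3.trans_le (min_le_right _ _)) (h4.trans_le (min_le_right _ _))
        have e1 : Tendsto (fun n ↦ ((2 : ℝ) ^ n • fderiv ℝ (P^[n]) y) w) atTop (𝓝 (g y w)) :=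
          ((ContinuousLinearMap.apply ℝ F w).continuous.tendsto _).comp (hg.tendsto_at hy)
        have e2 := (continuous_snd.tendsto _).comp (ht'.tendsto_at hyw)
        refine tendsto_nhds_unique e1 (e2.congr fun n ↦ ?_)
        exact (htan n y hy w).symm
      refine (contDiffAt_succ_iff_hasFDerivAt (n := (k : ℕ))).2
        ⟨g, ⟨ball 0 ε, ball_mem_nhds _ hε0, hder⟩, ?_⟩
      refine contDiffAt_clm_of_apply fun w ↦ ?_
      obtain ⟨δ, hδ, hsm⟩ := Metric.eventually_nhds_iff_ball.1
        ((ih (F × F) (tangentMapOf P) _ hP.tangent).eventually (by simp))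
      -- The induction hypothesis gives regularity only near `(0, 0)`; an arbitrary `w` is first
      -- scaled into that neighbourhood, and linearity undoes the scaling.
      obtain ⟨c, hc0, hcw'⟩ : ∃ c : ℝ, c ≠ 0 ∧ c • w ∈ ball (0 : F) (min ε δ) := by
        have hm : 0 < min ε δ := lt_min hε0 hδ
        refine ⟨min ε δ / (2 * (‖w‖ + 1)), by positivity, ?_⟩
        rw [mem_ball_zero_iff, norm_smul, Real.norm_of_nonneg (by positivity), div_mul_eq_mul_div,
          div_lt_iff₀ (by positivity)]
        nlinarith [norm_nonneg w]
      have hcw := ball_subset_ball (min_le_left ε δ) hcw'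
      have hz : ContDiffAt ℝ k (fun y ↦ c⁻¹ • (koenigs (tangentMapOf P) (y, c • w)).2) 0 := by
        have h3 : ((0 : F), c • w) ∈ ball (0 : F × F) δ := by
          have : ‖c • w‖ < min ε δ := by simpa using hcw'
          rw [mem_ball_zero_iff, Prod.norm_def]
          exact max_lt (by simpa using hδ) (this.trans_le (min_le_right _ _))
        exact ((contDiffAt_snd.comp _ (hsm _ h3)).comp (0 : F)
          (contDiffAt_id.prodMk contDiffAt_const)).const_smul c⁻¹
      refine hz.congr_of_eventuallyEq ?_
      filter_upwards [ball_mem_nhds (0 : F) hε0] with y hy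
      rw [← hgw y hy _ hcw, map_smul, inv_smul_smul₀ hc0]
  exact aux k F P U hP

/-- A shift of the index by `k` in the limit. It is the functional equation of the linearization and
needs convergence only at the image point. -/
theorem koenigs_iterate {y z : F} (h : Tendsto (fun n ↦ koenigsSeq P n z) atTop (𝓝 y)) (k : ℕ)
    {x : F} (hx : P^[k] x = z) : koenigs P x = (2 : ℝ) ^ k • y := by
  refine Tendsto.limUnder_eq ?_
  rw [← tendsto_add_atTop_iff_nat k]
  refine (h.const_smul ((2 : ℝ) ^ k)).congr fun n ↦ ?_
  rw [koenigsSeq, koenigsSeq, Function.iterate_add_apply, hx, smul_smul, pow_add, mul_comm]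

/-- Koenigs linearization: a half contraction is smoothly conjugate to `2⁻¹`, and the conjugation
linearizes all germs which commute with it. -/
theorem IsHalfContraction.exists_linearization [FiniteDimensional ℝ F]
    (hP : IsHalfContraction P U) :
    ∃ r : ℝ, 0 < r ∧ ball 0 r ⊆ U ∧ (∀ y ∈ ball (0 : F) r, ‖P y‖ ≤ ‖y‖) ∧
      ContDiffOn ℝ ∞ (koenigs P) (ball 0 r) ∧ koenigs P 0 = 0 ∧
      HasFDerivAt (koenigs P) (ContinuousLinearMap.id ℝ F) 0 ∧
      (∀ y ∈ ball (0 : F) r, koenigs P (P y) = (2⁻¹ : ℝ) • koenigs P y) ∧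
      ∀ (f : F → F) (A : F →L[ℝ] F), f 0 = 0 → HasFDerivAt f A 0 →
        (∀ᶠ y in 𝓝 0, f (P y) = P (f y)) → ∀ᶠ y in 𝓝 0, koenigs P (f y) = A (koenigs P y) := by
  have : CompleteSpace F := FiniteDimensional.complete ℝ F
  obtain ⟨r, C, hr, hC, hrU, h1, h2⟩ := hP.exists_bound
  have ht := koenigs_tendsto h1 hC h2
  have hlim : ∀ y ∈ ball (0 : F) r, Tendsto (fun n ↦ P^[n] y) atTop (𝓝 0) := by
    intro y hy
    have h3 : Tendsto (fun n : ℕ ↦ (3 / 5 : ℝ) ^ n * ‖y‖) atTop (𝓝 0) := by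
      simpa using (tendsto_pow_atTop_nhds_zero_of_lt_one (r := (3 / 5 : ℝ)) (by norm_num)
        (by norm_num)).mul_const ‖y‖
    exact squeeze_zero_norm (fun n ↦ (iterate_bound h1 n hy).2) h3
  have hk0 : koenigs P 0 = 0 := by
    have h3 : ∀ n, P^[n] 0 = 0 := fun n ↦ Function.iterate_fixed hP.map_zero n
    refine Tendsto.limUnder_eq (tendsto_const_nhds.congr fun n ↦ ?_)
    rw [koenigsSeq, h3, smul_zero]
  have hfun : ∀ n, ∀ y ∈ ball (0 : F) r, koenigs P y = (2 : ℝ) ^ n • koenigs P (P^[n] y) :=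
    fun n y hy ↦ koenigs_iterate (ht.tendsto_at (iterate_bound h1 n hy).1) n rfl
  refine ⟨r, hr, hrU, fun y hy ↦ (h1 y hy).trans (by linarith [norm_nonneg y]), ?_, hk0, ?_, ?_, ?_⟩
  -- The neighbourhood of `0` where `koenigs P` is known to be `C^k` may shrink with `k`. The
  -- equation `koenigs P = 2ⁿ koenigs P ∘ Pⁿ` carries the regularity to the fixed ball, since `Pⁿ y
  -- → 0`.
  · rw [contDiffOn_infty]
    intro k y hy
    have h3 := ((hP.contDiffAt_koenigs k).eventually (by simp))
    obtain ⟨n, hn⟩ := ((hlim y hy).eventually h3).exists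
    have h4 : ContDiffAt ℝ k (fun z ↦ (2 : ℝ) ^ n • koenigs P (P^[n] z)) y :=
      (hn.comp y (((hP.contDiffOn_iterate hrU h1 n).contDiffAt
        (isOpen_ball.mem_nhds hy)).of_le (mod_cast le_top))).const_smul _
    refine (h4.congr_of_eventuallyEq ?_).contDiffWithinAt
    filter_upwards [isOpen_ball.mem_nhds hy] with z hz using hfun n z hz
  · have hb : ∀ y ∈ ball (0 : F) r, ‖koenigs P y - y‖ ≤ 2 * C / (1 - 18 / 25) * ‖y‖ ^ 2 := by
      intro y hy
      -- Comparing the limit with its term of index `0`, the identity, leaves an error quadratic in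
      -- `‖y‖`; hence differential `1` at `0`.
      have h3 := dist_le_of_le_geometric_of_tendsto (18 / 25 : ℝ) (2 * C * ‖y‖ ^ 2) (by norm_num)
        (fun n ↦ by
          rw [dist_comm, dist_eq_norm]; exact koenigsSeq_bound h1 hC h2 n hy) (ht.tendsto_at hy) 0
      rw [dist_comm, dist_eq_norm] at h3
      convert h3 using 1
      · simp [koenigsSeq]
      · rw [pow_zero, mul_one]; ring
    have h4 : HasFDerivAt (fun y ↦ koenigs P y - y) (0 : F →L[ℝ] F) 0 := by
      refine Asymptotics.IsBigO.hasFDerivAt (n := 2) (Asymptotics.IsBigO.of_bound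
        (2 * C / (1 - 18 / 25)) ?_) (by norm_num)
      filter_upwards [ball_mem_nhds (0 : F) hr] with y hy
      simpa using hb y hy
    simpa using h4.fun_add (hasFDerivAt_id (𝕜 := ℝ) (0 : F))
  · intro y hy
    have := hfun 1 y hy
    rw [this]
    simp
  · intro f A hf0 hfA hcomm
    obtain ⟨δ, hδ, hcomm⟩ := Metric.eventually_nhds_iff_ball.1 hcomm
    have hfc : Tendsto f (𝓝 0) (𝓝 0) := by
      have := hfA.continuousAt.tendsto
      rwa [hf0] at this
    have hm : 0 < min r δ := lt_min hr hδ
    filter_upwards [ball_mem_nhds (0 : F) hm, hfc (ball_mem_nhds (0 : F) hr)] with y hy hfy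
    have h1' : ∀ z ∈ ball (0 : F) (min r δ), ‖P z‖ ≤ 3 / 5 * ‖z‖ :=
      fun z hz ↦ h1 z (ball_subset_ball (min_le_left _ _) hz)
    have hfP : ∀ n, f (P^[n] y) = P^[n] (f y) := by
      intro n
      induction n with
      | zero => rfl
      | succ n ih =>
        rw [Function.iterate_succ_apply', Function.iterate_succ_apply', ← ih]
        exact hcomm _ (ball_subset_ball (min_le_right _ _) (iterate_bound h1' n hy).1)
    have hyr := ball_subset_ball (min_le_left r δ) hy
    have hc : Tendsto (fun n : ℕ ↦ ‖(2 : ℝ) ^ n‖) atTop atTop := by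
      simpa using tendsto_pow_atTop_atTop_of_one_lt (r := (2 : ℝ)) (by norm_num)
    have h3 := hfA.hasFDerivWithinAt (s := Set.univ)
    -- Since `f` commutes with `P`, `2ⁿPⁿ f(y) = 2ⁿ f(Pⁿ y)`. As `Pⁿ y → 0` and `2ⁿPⁿ y` converges,
    -- the definition of the derivative of `f` at `0` gives the limit `A (koenigs P y)`.
    have h4 := HasFDerivWithinAt.lim h3 (l := atTop) (c := fun n : ℕ ↦ (2 : ℝ) ^ n)
      (d := fun n ↦ P^[n] y) (v := koenigs P y) (by simpa using hlim y hyr) (by simp)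
      (ht.tendsto_at hyr)
    refine tendsto_nhds_unique (ht.tendsto_at hfy) (h4.congr fun n ↦ ?_)
    rw [zero_add, hf0, sub_zero, hfP]
    rfl

end Koenigs

end SymplecticSymmetric

/-! ### Linearization of doubling germs -/

namespace SymplecticSymmetric

open Filter Metric

/-- The germ of a doubling map is smoothly linearizable, and the linearization linearizes all germs
commuting with the doubling map. -/
theorem exists_doubling_linearization {F : Type*} [NormedAddCommGroup F] [NormedSpace ℝ F]
    [FiniteDimensional ℝ F] {Q : F → F} {U : Set F} (hU : IsOpen U) (h0 : (0 : F) ∈ U)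
    (hQ : ContDiffOn ℝ ∞ Q U) (hQ0 : Q 0 = 0)
    (hQ' : HasFDerivAt Q ((2 : ℝ) • ContinuousLinearMap.id ℝ F) 0) :
    ∃ (e : OpenPartialHomeomorph F F) (r : ℝ), 0 < r ∧ (0 : F) ∈ e.source ∧ e 0 = 0 ∧
      e.source ⊆ U ∧ e.target = ball 0 r ∧ ContDiffOn ℝ ∞ e e.source ∧
      ContDiffOn ℝ ∞ e.symm e.target ∧
      (∀ v ∈ ball (0 : F) r, e.symm v ∈ U ∧ Q (e.symm ((2⁻¹ : ℝ) • v)) = e.symm v) ∧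
      ∀ (f : F → F) (A : F →L[ℝ] F), f 0 = 0 → HasFDerivAt f A 0 →
        (∀ᶠ y in 𝓝 0, f (Q y) = Q (f y)) → ∀ᶠ v in 𝓝 0, f (e.symm v) = e.symm (A v) := by
  have : CompleteSpace F := FiniteDimensional.complete ℝ F
  let D : F ≃L[ℝ] F := ContinuousLinearEquiv.smulLeft (Units.mk0 (2 : ℝ) two_ne_zero)
  have hD : (D : F →L[ℝ] F) = (2 : ℝ) • ContinuousLinearMap.id ℝ F := by ext; rfl
  have hDs : (D.symm : F →L[ℝ] F) = (2⁻¹ : ℝ) • ContinuousLinearMap.id ℝ F := by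
    ext v
    change D.symm v = (2⁻¹ : ℝ) • v
    rw [ContinuousLinearEquiv.symm_apply_eq]
    change v = (2 : ℝ) • (2⁻¹ : ℝ) • v
    rw [smul_inv_smul₀ two_ne_zero]
  -- The local inverse of a doubling germ is a half contraction, to which Koenigs' construction
  -- applies.
  obtain ⟨q, hqQ, hq0, hqU, hqs⟩ := exists_openPartialHomeomorph_of_hasFDerivAt hU h0 hQ
    (f' := D) (by rw [hD]; exact hQ')
  have hq0' : q 0 = 0 := by rw [hqQ, hQ0]
  have h0t : (0 : F) ∈ q.target := by rw [← hq0']; exact q.map_source hq0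
  have hqs0 : q.symm 0 = 0 := by rw [← hq0', q.left_inv hq0, hq0']
  set P : F → F := (q.symm : F → F) with hPdef
  have hP : IsHalfContraction P q.target :=
    { isOpen := q.open_target
      zero_mem := h0t
      contDiffOn := hqs
      map_zero := hqs0
      hasFDerivAt := by
        rw [← hDs]
        refine q.hasFDerivAt_symm h0t ?_
        rw [hqQ, hD, show q.symm 0 = 0 from hqs0]
        exact hQ' }
  obtain ⟨r, hr, hrU, hPr, hks, hk0, hkd, hkP, hlin⟩ := hP.exists_linearization
  obtain ⟨e0, he0, h0e, he0r, he0s⟩ := exists_openPartialHomeomorph_of_hasFDerivAt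
    (isOpen_ball (x := (0 : F)) (ε := r)) (mem_ball_self hr) hks
    (f' := ContinuousLinearEquiv.refl ℝ F) (by simpa using hkd)
  have he0k : ∀ y, e0 y = koenigs P y := fun y ↦ by rw [he0]
  obtain ⟨r2, hr2, hr2e⟩ := Metric.mem_nhds_iff.1 (e0.open_source.mem_nhds h0e)
  let e1 := e0.restrOpen (ball 0 r2) isOpen_ball
  have he1s : e1.source = ball 0 r2 := Set.inter_eq_right.2 hr2e
  have h0e1 : (0 : F) ∈ e1.source := by rw [he1s]; exact mem_ball_self hr2
  have he10 : e1 0 = 0 := (he0k 0).trans hk0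
  have h0t1 : (0 : F) ∈ e1.target := by rw [← he10]; exact e1.map_source h0e1
  obtain ⟨ρ, hρ, hρe⟩ := Metric.mem_nhds_iff.1 (e1.open_target.mem_nhds h0t1)
  -- The source becomes a ball intersected with the preimage of a ball. `P` preserves both
  -- conditions, as it does not increase the norm and acts as `1/2` after linearization.
  let e := (e1.symm.restrOpen (ball 0 ρ) isOpen_ball).symm
  have het : e.target = ball 0 ρ := Set.inter_eq_right.2 hρe
  have hek : ∀ y, e y = koenigs P y := he0k
  have hes : e.source = ball 0 r2 ∩ koenigs P ⁻¹' ball 0 ρ := by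
    ext y
    constructor
    · intro hy
      have h1 : y ∈ e1.source := by
        have := e1.map_target (hρe (het ▸ e.map_source hy))
        rwa [show e1.symm (e y) = y from e.left_inv hy] at this
      refine ⟨he1s ▸ h1, ?_⟩
      rw [Set.mem_preimage, ← hek, ← het]
      exact e.map_source hy
    · rintro ⟨h1, h2⟩
      have h1 : y ∈ e1.source := he1s ▸ h1
      have h3 : e1 y ∈ ball (0 : F) ρ := by rw [show e1 y = koenigs P y from he0k y]; exact h2
      have h4 := e.map_target (x := e1 y) (by rw [het]; exact h3)
      rwa [show e.symm (e1 y) = y from e1.left_inv h1] at h4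
  have h0es : (0 : F) ∈ e.source := by
    rw [hes]; exact ⟨mem_ball_self hr2, by simpa [hk0] using hρ⟩
  have hes0 : e.symm 0 = 0 := by
    have h := e.left_inv h0es
    rwa [show e 0 = 0 from (hek 0).trans hk0] at h
  have hsub : e.source ⊆ ball 0 r := fun y hy ↦
    he0r (hr2e (by rw [hes] at hy; exact hy.1))
  have hr2r : ∀ y ∈ ball (0 : F) r2, y ∈ ball (0 : F) r := fun y hy ↦ he0r (hr2e hy)
  -- the linearization intertwines the half contraction with the homothety
  have hPe : ∀ v ∈ ball (0 : F) ρ, P (e.symm v) = e.symm ((2⁻¹ : ℝ) • v) := by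
    intro v hv
    have hv' : v ∈ e.target := het ▸ hv
    have hz := e.map_target hv'
    have hz2 : e.symm v ∈ ball (0 : F) r2 := by rw [hes] at hz; exact hz.1
    have h1 : koenigs P (P (e.symm v)) = (2⁻¹ : ℝ) • v := by
      rw [hkP _ (hsub hz), ← hek, e.right_inv hv']
    have h2 : P (e.symm v) ∈ e.source := by
      rw [hes]
      refine ⟨?_, ?_⟩
      · rw [mem_ball_zero_iff] at hz2 ⊢
        exact (hPr _ (hsub hz)).trans_lt hz2
      · rw [Set.mem_preimage, h1, mem_ball_zero_iff, norm_smul]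
        have : ‖v‖ < ρ := by simpa using hv
        norm_num
        linarith [norm_nonneg v]
    rw [← h1, ← hek, e.left_inv h2]
  have hPQ : ∀ y ∈ q.target, Q (P y) = y := fun y hy ↦ by
    rw [← hqQ]; exact q.right_inv hy
  -- shrink so that the source is contained in `U`
  have hPU : ∀ v ∈ ball (0 : F) ρ, e.symm ((2⁻¹ : ℝ) • v) ∈ U := fun v hv ↦ by
    rw [← hPe v hv]
    exact hqU (q.map_target (hrU (hsub (e.map_target (het ▸ hv)))))
  have hball : ∀ v ∈ ball (0 : F) (ρ / 2), v ∈ ball (0 : F) ρ ∧ (2 : ℝ) • v ∈ ball (0 : F) ρ := by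
    intro v hv
    rw [mem_ball_zero_iff] at hv
    rw [mem_ball_zero_iff, mem_ball_zero_iff, norm_smul]
    norm_num
    constructor <;> linarith
  -- For `v` in the target only `e.symm (v/2)` is known to lie in `U`, being a value of `P`. Halving
  -- the radius makes every point of the target such a half.
  let e' := (e.symm.restrOpen (ball 0 (ρ / 2)) isOpen_ball).symm
  have he't : e'.target = ball 0 (ρ / 2) :=
    Set.inter_eq_right.2 fun v hv ↦ show v ∈ e.target from het ▸ (hball v hv).1
  have he's : e'.source ⊆ e.source := fun y hy ↦ by
    have h1 := e'.map_source hy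
    have h2 := e.map_target (x := e' y) (by rw [het]; exact (hball _ (he't ▸ h1)).1)
    rwa [show e.symm (e' y) = y from e'.left_inv hy] at h2
  have hsU : ∀ v ∈ ball (0 : F) (ρ / 2), e.symm v ∈ U := fun v hv ↦ by
    have := hPU _ (hball v hv).2
    rwa [inv_smul_smul₀ two_ne_zero] at this
  have h0e' : (0 : F) ∈ e'.source := by
    have := e'.map_target (x := 0) (by rw [he't]; exact mem_ball_self (by positivity))
    rwa [show e'.symm 0 = 0 from hes0] at this
  refine ⟨e', ρ / 2, by positivity, h0e', (hek 0).trans hk0, fun y hy ↦ ?_, he't, ?_, ?_,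
    fun v hv ↦ ⟨hsU v hv, ?_⟩, ?_⟩
  · have h1 := e'.map_source hy
    have h2 := hsU (e' y) (he't ▸ h1)
    rwa [show e.symm (e' y) = y from e'.left_inv hy] at h2
  · exact (hks.mono (he's.trans hsub)).congr fun y _ ↦ hek y
  · refine he0s.mono fun v hv ↦ ?_
    have h1 := hρe (hball v (he't ▸ hv)).1
    exact h1.1
  · change Q (e.symm ((2⁻¹ : ℝ) • v)) = e.symm v
    have hv' := (hball v hv).1
    rw [← hPe v hv', hPQ _ (hrU (hsub (e.map_target (het ▸ hv'))))]
  · intro f A hf0 hfA hcomm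
    have hfc : Tendsto f (𝓝 0) (𝓝 0) := by
      have := hfA.continuousAt.tendsto
      rwa [hf0] at this
    have hPc : Tendsto P (𝓝 0) (𝓝 0) := by
      have := hP.hasFDerivAt.continuousAt.tendsto
      rwa [hP.map_zero] at this
    -- Commuting with `Q` near `0` amounts to commuting with its local inverse, provided `f (P y)`
    -- stays where `q` is injective.
    have hcomm' : ∀ᶠ y in 𝓝 0, f (P y) = P (f y) := by
      filter_upwards [hPc.eventually hcomm, q.open_target.mem_nhds h0t,
        (hfc.comp hPc) (q.open_source.mem_nhds hq0)] with y h1 h2 h3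
      have h4 : q.symm (q (f (P y))) = f (P y) := q.left_inv h3
      rw [hPQ y h2] at h1
      rw [h1, ← hqQ]
      exact h4.symm
    have h1 := hlin f A hf0 hfA hcomm'
    have hec : Tendsto e.symm (𝓝 0) (𝓝 0) := by
      have h2 := e.continuousAt_symm (x := 0) (by rw [het]; exact mem_ball_self hρ)
      have := h2.tendsto
      rwa [hes0] at this
    filter_upwards [hec.eventually h1, (hfc.comp hec) (e.open_source.mem_nhds h0es),
      ball_mem_nhds (0 : F) hρ] with v h2 h3 h4
    change f (e.symm v) = e.symm (A v)
    rw [← hek, ← hek, e.right_inv (het ▸ h4)] at h2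
    rw [← h2]
    exact (e.left_inv h3).symm

end SymplecticSymmetric

namespace SymplecticSymmetric

/-! ### Closed subgroup theorem in a finite-dimensional algebra -/

section ClosedSubgroup

open Filter Metric NormedSpace

variable {𝔸 : Type*} [NormedRing 𝔸] [NormedAlgebra ℝ 𝔸] [FiniteDimensional ℝ 𝔸]

theorem expR_add_of_commute {x y : 𝔸} (h : Commute x y) : exp (x + y) = exp x * exp y := by
  let _ : NormedAlgebra ℚ 𝔸 := NormedAlgebra.restrictScalars ℚ ℝ 𝔸
  have : CompleteSpace 𝔸 := FiniteDimensional.complete ℝ 𝔸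
  exact exp_add_of_commute h

theorem expR_neg_mul (x : 𝔸) : exp (-x) * exp x = 1 := by
  rw [← expR_add_of_commute (Commute.neg_left (Commute.refl x)), neg_add_cancel, exp_zero]

theorem expR_mul_neg (x : 𝔸) : exp x * exp (-x) = 1 := by
  rw [← expR_add_of_commute (Commute.neg_right (Commute.refl x)), add_neg_cancel, exp_zero]

theorem contDiff_expR : ContDiff ℝ ∞ (exp : 𝔸 → 𝔸) := by
  have : CompleteSpace 𝔸 := FiniteDimensional.complete ℝ 𝔸
  exact contDiff_iff_contDiffAt.2 fun x ↦ (exp_analytic (𝕂 := ℝ) x).contDiffAt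

/-- A subset of a Banach algebra which behaves near the values of the exponential map as a closed
subgroup of the group of units. -/
structure IsExpClosedSubgroup (K : Set 𝔸) : Prop where
  one_mem : (1 : 𝔸) ∈ K
  mul_mem : ∀ {a b}, a ∈ K → b ∈ K → a * b ∈ K
  exp_neg_mem : ∀ {X : 𝔸}, exp X ∈ K → exp (-X) ∈ K
  exp_mem_of_mem_closure : ∀ {X : 𝔸}, exp X ∈ closure K → exp X ∈ K

namespace IsExpClosedSubgroup

variable {K : Set 𝔸}

theorem exp_nsmul_mem (hK : IsExpClosedSubgroup K) {X : 𝔸} (h : exp X ∈ K) (n : ℕ) :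
    exp ((n : ℝ) • X) ∈ K := by
  induction n with
  | zero => simpa using hK.one_mem
  | succ n ih =>
    rw [Nat.cast_succ, add_smul, one_smul,
      expR_add_of_commute ((Commute.refl X).smul_left _)]
    exact hK.mul_mem ih h

theorem exp_zsmul_mem (hK : IsExpClosedSubgroup K) {X : 𝔸} (h : exp X ∈ K) (m : ℤ) :
    exp ((m : ℝ) • X) ∈ K := by
  obtain ⟨n, rfl | rfl⟩ := m.eq_nat_or_neg
  · simpa using hK.exp_nsmul_mem h n
  · simpa using hK.exp_nsmul_mem (hK.exp_neg_mem h) n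

/-- Replacing `t c n` by its integer part changes `t c n x n` by at most `‖x n‖ → 0`. The
exponentials of integer multiples of `x n` lie in `K`, and closedness concludes. -/
theorem exp_mem_of_tendsto (hK : IsExpClosedSubgroup K) {x : ℕ → 𝔸} {c : ℕ → ℝ} {X : 𝔸}
    (hx : Tendsto x atTop (𝓝 0)) (hxK : ∀ᶠ n in atTop, exp (x n) ∈ K)
    (hc : Tendsto (fun n ↦ c n • x n) atTop (𝓝 X)) (t : ℝ) : exp (t • X) ∈ K := by
  have h1 : Tendsto (fun n ↦ ((⌊t * c n⌋ : ℤ) : ℝ) • x n) atTop (𝓝 (t • X)) := by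
    have h2 : Tendsto (fun n ↦ Int.fract (t * c n) • x n) atTop (𝓝 0) := by
      refine squeeze_zero_norm (fun n ↦ ?_) (tendsto_zero_iff_norm_tendsto_zero.1 hx)
      rw [norm_smul, Real.norm_of_nonneg (Int.fract_nonneg _)]
      exact mul_le_of_le_one_left (norm_nonneg _) (Int.fract_lt_one _).le
    have h3 := (hc.const_smul t).sub h2
    rw [sub_zero] at h3
    refine h3.congr fun n ↦ ?_
    rw [smul_smul, ← sub_smul, Int.self_sub_fract]
  have h4 := (contDiff_expR (𝔸 := 𝔸)).continuous.tendsto (t • X) |>.comp h1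
  refine hK.exp_mem_of_mem_closure (mem_closure_of_tendsto h4 ?_)
  filter_upwards [hxK] with n hn using hK.exp_zsmul_mem hn _

/-- The Lie algebra of a closed subgroup. -/
def lieSubmodule (hK : IsExpClosedSubgroup K) : Submodule ℝ 𝔸 where
  carrier := {X | ∀ t : ℝ, exp (t • X) ∈ K}
  zero_mem' t := by simpa using hK.one_mem
  smul_mem' c X hX t := by
    rw [smul_smul]; exact hX _
  add_mem' {X Y} hX hY := by
    have : CompleteSpace 𝔸 := FiniteDimensional.complete ℝ 𝔸
    obtain ⟨e, he, h0, -, hes⟩ := exists_openPartialHomeomorph_of_hasFDerivAt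
      (f := (exp : 𝔸 → 𝔸)) isOpen_univ (Set.mem_univ 0) contDiff_expR.contDiffOn
      (f' := ContinuousLinearEquiv.refl ℝ 𝔸)
      ((hasStrictFDerivAt_exp_zero (𝕂 := ℝ) (𝔸 := 𝔸)).hasFDerivAt)
    have he0 : e 0 = 1 := by rw [he, exp_zero]
    have h1t : (1 : 𝔸) ∈ e.target := he0 ▸ e.map_source h0
    have hes1 : e.symm 1 = 0 := by rw [← he0, e.left_inv h0]
    -- The logarithm of `exp(sX) exp(sY)` has derivative `X + Y` at `s = 0`. At `s = 1/(n+1)`,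
    -- rescaled by `n+1`, it is a sequence as in `exp_mem_of_tendsto`.
    let g : ℝ → 𝔸 := fun s ↦ exp (s • X) * exp (s • Y)
    have hg0 : g 0 = 1 := by simp [g]
    have hg : HasDerivAt g (X + Y) 0 := by
      have : HasDerivAt g _ 0 := (hasDerivAt_exp_smul_const (𝕂 := ℝ) X (0 : ℝ)).mul
        (hasDerivAt_exp_smul_const (𝕂 := ℝ) Y (0 : ℝ))
      simpa using this
    have hz : HasDerivAt (fun s ↦ e.symm (g s)) (X + Y) 0 := by
      have h2 : HasFDerivAt e.symm
          ((ContinuousLinearEquiv.refl ℝ 𝔸).symm : 𝔸 →L[ℝ] 𝔸) (g 0) := by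
        rw [hg0]
        refine e.hasFDerivAt_symm h1t ?_
        rw [he, hes1]
        exact (hasStrictFDerivAt_exp_zero (𝕂 := ℝ) (𝔸 := 𝔸)).hasFDerivAt
      exact h2.comp_hasDerivAt (0 : ℝ) hg
    have hs : Tendsto (fun n : ℕ ↦ (1 : ℝ) / (n + 1)) atTop (𝓝 0) :=
      tendsto_one_div_add_atTop_nhds_zero_nat
    refine hK.exp_mem_of_tendsto (x := fun n : ℕ ↦ e.symm (g (1 / (n + 1))))
      (c := fun n : ℕ ↦ (n + 1 : ℝ)) ?_ ?_ ?_
    · have := hz.continuousAt.tendsto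
      simp only [hg0, hes1] at this
      exact this.comp hs
    · have h3 : Tendsto (fun n : ℕ ↦ g (1 / (n + 1))) atTop (𝓝 1) := by
        have := hg.continuousAt.tendsto
        rw [hg0] at this
        exact this.comp hs
      filter_upwards [h3 (e.open_target.mem_nhds h1t)] with n hn
      have h4 : e (e.symm (g (1 / (n + 1)))) = g (1 / (n + 1)) := e.right_inv hn
      rw [he] at h4
      rw [h4]
      exact hK.mul_mem (hX _) (hY _)
    · have h5 := (hasDerivAt_iff_tendsto_slope_zero.1 hz)
      have h6 : Tendsto (fun n : ℕ ↦ (1 : ℝ) / (n + 1)) atTop (𝓝[≠] 0) :=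
        tendsto_nhdsWithin_iff.2 ⟨hs, Eventually.of_forall fun n ↦ by
          have : (0 : ℝ) < 1 / (n + 1) := by positivity
          exact this.ne'⟩
      refine (h5.comp h6).congr fun n ↦ ?_
      simp [hg0, hes1]

theorem exp_mem (hK : IsExpClosedSubgroup K) {X : 𝔸} (hX : X ∈ hK.lieSubmodule) : exp X ∈ K := by
  simpa using hX 1

/-- The closed subgroup theorem: near `1`, a closed subgroup is the image under the exponential map
of its Lie algebra, and there is a smooth logarithm. -/
theorem exists_log (hK : IsExpClosedSubgroup K) :
    ∃ (L : 𝔸 → hK.lieSubmodule) (W : Set 𝔸) (B : Set hK.lieSubmodule),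
      IsOpen W ∧ (1 : 𝔸) ∈ W ∧ IsOpen B ∧ 0 ∈ B ∧ ContDiffOn ℝ ∞ L W ∧ L 1 = 0 ∧
      (∀ A ∈ W, A ∈ K → exp (L A : 𝔸) = A ∧ L A ∈ B) ∧
      ∀ X ∈ B, exp (X : 𝔸) ∈ W ∧ L (exp (X : 𝔸)) = X := by
  have : CompleteSpace 𝔸 := FiniteDimensional.complete ℝ 𝔸
  set k := hK.lieSubmodule with hk
  obtain ⟨m, hm⟩ := k.exists_isCompl
  -- With `m` a linear complement of the Lie algebra, `Θ` has invertible differential at `0`; its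
  -- inverse supplies coordinates at `1`, the first of which will be the logarithm.
  let Θ : k × m → 𝔸 := fun p ↦ exp (p.1 : 𝔸) * exp (p.2 : 𝔸)
  have hexp0 : HasFDerivAt (exp : 𝔸 → 𝔸) (1 : 𝔸 →L[ℝ] 𝔸) 0 :=
    (hasStrictFDerivAt_exp_zero (𝕂 := ℝ) (𝔸 := 𝔸)).hasFDerivAt
  have hΘ : ContDiff ℝ ∞ Θ :=
    (contDiff_expR.comp (k.subtypeL.contDiff.comp contDiff_fst)).mul
      (contDiff_expR.comp (m.subtypeL.contDiff.comp contDiff_snd))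
  let T : (k × m) ≃L[ℝ] 𝔸 := (k.prodEquivOfIsCompl m hm).toContinuousLinearEquiv
  have hΘ' : HasFDerivAt Θ (T : k × m →L[ℝ] 𝔸) 0 := by
    have h1 : HasFDerivAt (fun p : k × m ↦ exp (p.1 : 𝔸))
        ((1 : 𝔸 →L[ℝ] 𝔸).comp (k.subtypeL.comp (ContinuousLinearMap.fst ℝ k m))) 0 :=
      HasFDerivAt.comp (g := (exp : 𝔸 → 𝔸)) (0 : k × m) (by simpa using hexp0)
        (k.subtypeL.comp (ContinuousLinearMap.fst ℝ k m)).hasFDerivAt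
    have h2 : HasFDerivAt (fun p : k × m ↦ exp (p.2 : 𝔸))
        ((1 : 𝔸 →L[ℝ] 𝔸).comp (m.subtypeL.comp (ContinuousLinearMap.snd ℝ k m))) 0 :=
      HasFDerivAt.comp (g := (exp : 𝔸 → 𝔸)) (0 : k × m) (by simpa using hexp0)
        (m.subtypeL.comp (ContinuousLinearMap.snd ℝ k m)).hasFDerivAt
    have h3 : HasFDerivAt Θ _ 0 := h1.mul' h2
    refine h3.congr_fderiv ?_
    ext p <;> simp [T]
  obtain ⟨e, he, h0, -, hes⟩ := exists_openPartialHomeomorph_of_hasFDerivAt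
    isOpen_univ (Set.mem_univ 0) hΘ.contDiffOn hΘ'
  have he0 : e 0 = 1 := by rw [he]; simp [Θ]
  have h1t : (1 : 𝔸) ∈ e.target := he0 ▸ e.map_source h0
  have hes1 : e.symm 1 = 0 := by rw [← he0, e.left_inv h0]
  -- Otherwise elements of `K` tending to `1` would have nonzero components in `m`. Their
  -- exponentials lie in `K` as well, and a limit of their directions is a unit vector of `m`
  -- generating a one-parameter group in `K`, so it lies in `k ⊓ m = 0`.
  have key : ∀ᶠ A in 𝓝 (1 : 𝔸), A ∈ K → (e.symm A).2 = 0 := by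
    by_contra hcon
    rw [not_eventually] at hcon
    have hcon' := hcon.and_eventually (e.open_target.mem_nhds h1t)
    obtain ⟨a, ha, haK⟩ := exists_seq_forall_of_frequently hcon'
    have haK1 : ∀ n, a n ∈ K := fun n ↦ by
      have := (haK n).1; push Not at this; exact this.1
    have hy0 : ∀ n, (e.symm (a n)).2 ≠ 0 := fun n ↦ by
      have := (haK n).1; push Not at this; exact this.2
    have hlim : Tendsto (fun n ↦ e.symm (a n)) atTop (𝓝 0) := by
      have := (e.continuousAt_symm h1t).tendsto
      rw [hes1] at this
      exact this.comp ha
    have hyK : ∀ n, exp ((e.symm (a n)).2 : 𝔸) ∈ K := by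
      intro n
      have h2 : e (e.symm (a n)) = a n := e.right_inv (haK n).2
      rw [he] at h2
      have h3 : exp ((e.symm (a n)).2 : 𝔸) = exp (-((e.symm (a n)).1 : 𝔸)) * a n := by
        have h4 : exp ((e.symm (a n)).1 : 𝔸) * exp ((e.symm (a n)).2 : 𝔸) = a n := h2
        generalize e.symm (a n) = p at h4 ⊢
        rw [← h4, ← mul_assoc, expR_neg_mul, one_mul]
      rw [h3]
      exact hK.mul_mem (hK.exp_neg_mem (hK.exp_mem (e.symm (a n)).1.2)) (haK1 n)
    let u : ℕ → m := fun n ↦ ‖(e.symm (a n)).2‖⁻¹ • (e.symm (a n)).2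
    have hu : ∀ n, u n ∈ sphere (0 : m) 1 := fun n ↦ by
      have : ‖(e.symm (a n)).2‖ ≠ 0 := norm_ne_zero_iff.2 (hy0 n)
      rw [mem_sphere_zero_iff_norm, norm_smul, norm_inv, norm_norm, inv_mul_cancel₀ this]
    obtain ⟨Y, hY, φ, hφ, hφu⟩ := (isCompact_sphere (0 : m) 1).tendsto_subseq hu
    have hYk : (Y : 𝔸) ∈ k := by
      intro t
      refine hK.exp_mem_of_tendsto (x := fun n ↦ ((e.symm (a (φ n))).2 : 𝔸))
        (c := fun n ↦ ‖(e.symm (a (φ n))).2‖⁻¹) ?_ (Eventually.of_forall fun n ↦ hyK _) ?_ t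
      · have h2 : Continuous fun p : k × m ↦ (p.2 : 𝔸) := by fun_prop
        have := (h2.tendsto 0).comp (hlim.comp hφ.tendsto_atTop)
        simpa [Function.comp_def] using this
      · exact (continuous_subtype_val.tendsto Y).comp hφu
    have hY0 : (Y : 𝔸) = 0 := by
      have := hm.disjoint.le_bot (show (Y : 𝔸) ∈ k ⊓ m from ⟨hYk, Y.2⟩)
      simpa using this
    have : ‖Y‖ = 1 := by simpa using hY
    rw [Submodule.coe_norm, hY0, norm_zero] at this
    exact zero_ne_one this
  obtain ⟨W1, hW1, hW1o, h1W1⟩ := _root_.mem_nhds_iff.1 key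
  set W := e.target ∩ W1
  have hWo : IsOpen W := e.open_target.inter hW1o
  refine ⟨fun A ↦ (e.symm A).1, W,
    {X | (X, (0 : m)) ∈ e.source ∧ exp (X : 𝔸) ∈ W}, hWo, ⟨h1t, h1W1⟩, ?_, ?_, ?_, ?_, ?_, ?_⟩
  · refine IsOpen.inter (e.open_source.preimage (by fun_prop)) (hWo.preimage ?_)
    exact contDiff_expR.continuous.comp continuous_subtype_val
  · refine ⟨h0, ?_⟩
    rw [ZeroMemClass.coe_zero, exp_zero]
    exact ⟨h1t, h1W1⟩
  · exact contDiff_fst.comp_contDiffOn (hes.mono Set.inter_subset_left)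
  · simp [hes1]
  · intro A hA hAK
    have h2 := hW1 hA.2 hAK
    have h3 : e (e.symm A) = A := e.right_inv hA.1
    have h4 : e.symm A = ((e.symm A).1, (0 : m)) := Prod.ext rfl h2
    have h5 : exp ((e.symm A).1 : 𝔸) = A := by
      rw [he] at h3
      simp only [Θ, h2] at h3
      simpa using h3
    refine ⟨h5, ?_, ?_⟩
    · rw [← h4]; exact e.map_target hA.1
    · rw [h5]; exact hA
  · rintro X ⟨hX, hXW⟩
    refine ⟨hXW, ?_⟩
    have h2 : e (X, (0 : m)) = exp (X : 𝔸) := by rw [he]; simp [Θ]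
    have h3 := e.left_inv hX
    rw [h2] at h3
    exact congrArg Prod.fst h3

end IsExpClosedSubgroup

end ClosedSubgroup

end SymplecticSymmetric

/-! ### Local form of the symmetries, midpoints and transitivity -/

namespace SymplecticSymmetric

namespace SymplecticSymmetricSpace

open Filter Metric

variable {E : Type*} [NormedAddCommGroup E] [NormedSpace ℝ E] [CompleteSpace E]
  {M : Type*} [TopologicalSpace M] [ChartedSpace E M] [IsManifold 𝓘(ℝ, E) ∞ M]
  (S : SymplecticSymmetricSpace E M)

/-- The map `(x, y) ↦ s_x(y)` in the preferred chart at `o`. -/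
noncomputable def localSymm (o : M) (p : E × E) : E :=
  chartAt E o (S.s ((chartAt E o).symm p.1) ((chartAt E o).symm p.2))

/-- The domain of the local expression of `(x, y) ↦ s_x(y)` in the preferred chart at `o`. -/
def localDom (o : M) : Set (E × E) :=
  ((chartAt E o).target ×ˢ (chartAt E o).target) ∩
    (fun p ↦ S.s ((chartAt E o).symm p.1) ((chartAt E o).symm p.2)) ⁻¹' (chartAt E o).source

omit [CompleteSpace E] in
theorem contMDiffOn_s_symm (o : M) : ContMDiffOn 𝓘(ℝ, E × E) 𝓘(ℝ, E) ∞
    (fun p : E × E ↦ S.s ((chartAt E o).symm p.1) ((chartAt E o).symm p.2))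
    ((chartAt E o).target ×ˢ (chartAt E o).target) := by
  have h := contMDiffOn_chart_symm (I := 𝓘(ℝ, E)) (n := ∞) (x := o)
  have h1 : ContMDiffOn 𝓘(ℝ, E × E) 𝓘(ℝ, E) ∞ (fun p : E × E ↦ (chartAt E o).symm p.1)
      ((chartAt E o).target ×ˢ (chartAt E o).target) :=
    h.comp contDiff_fst.contMDiff.contMDiffOn fun p hp ↦ hp.1
  have h2 : ContMDiffOn 𝓘(ℝ, E × E) 𝓘(ℝ, E) ∞ (fun p : E × E ↦ (chartAt E o).symm p.2)
      ((chartAt E o).target ×ˢ (chartAt E o).target) :=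
    h.comp contDiff_snd.contMDiff.contMDiffOn fun p hp ↦ hp.2
  exact S.smooth.comp_contMDiffOn (h1.prodMk h2)

omit [CompleteSpace E] in
theorem isOpen_localDom (o : M) : IsOpen (S.localDom o) :=
  (S.contMDiffOn_s_symm o).continuousOn.isOpen_inter_preimage
    ((chartAt E o).open_target.prod (chartAt E o).open_target) (chartAt E o).open_source

omit [CompleteSpace E] in
theorem contDiffOn_localSymm (o : M) : ContDiffOn ℝ ∞ (S.localSymm o) (S.localDom o) := by
  rw [← contMDiffOn_iff_contDiffOn]
  exact (contMDiffOn_chart (I := 𝓘(ℝ, E)) (n := ∞) (x := o)).comp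
    ((S.contMDiffOn_s_symm o).mono Set.inter_subset_left) fun p hp ↦ hp.2

omit [CompleteSpace E] in
theorem mem_localDom_self (o : M) {y : M} (hy : y ∈ (chartAt E o).source) :
    (chartAt E o y, chartAt E o y) ∈ S.localDom o := by
  refine ⟨⟨(chartAt E o).map_source hy, (chartAt E o).map_source hy⟩, ?_⟩
  simp [(chartAt E o).left_inv hy, S.fixed, hy]

omit [CompleteSpace E] in
theorem localSymm_self (o : M) {z : E} (hz : z ∈ (chartAt E o).target) :
    S.localSymm o (z, z) = z := by
  simp [localSymm, S.fixed, (chartAt E o).right_inv hz]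

/-- The involution theorem is applied to `s_y` in a chart centred at another point `o`, since
differentiating along the diagonal requires all nearby `y` in one chart. -/
theorem fderiv_localSymm_right (o : M) {y : M} (hy : y ∈ (chartAt E o).source) :
    fderiv ℝ (fun z ↦ S.localSymm o (chartAt E o y, z)) (chartAt E o y)
      = -ContinuousLinearMap.id ℝ E := by
  set κ := chartAt E o
  have hmem := S.mem_localDom_self o hy
  have hyt : κ y ∈ κ.target := κ.map_source hy
  have hcont : ContinuousAt (fun z ↦ (κ y, z)) (κ y) := by fun_prop
  have hdom : ∀ᶠ z in 𝓝 (κ y), (κ y, z) ∈ S.localDom o :=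
    hcont ((S.isOpen_localDom o).mem_nhds hmem)
  apply fderiv_eq_neg_id_of_isolated
  · exact ((S.contDiffOn_localSymm o).contDiffAt ((S.isOpen_localDom o).mem_nhds hmem)).comp _
      (contDiffAt_const.prodMk contDiffAt_id)
  · exact S.localSymm_self o hyt
  · filter_upwards [hdom] with z hz
    have h1 : S.s (κ.symm (κ y)) (κ.symm z) ∈ κ.source := hz.2
    simp only [localSymm]
    rw [κ.left_inv h1, S.involutive, κ.right_inv hz.1.2]
  · have h1 : Tendsto κ.symm (𝓝[≠] (κ y)) (𝓝[≠] y) := by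
      have h2 := (κ.continuousAt_symm hyt).tendsto
      rw [κ.left_inv hy] at h2
      refine tendsto_nhdsWithin_iff.2 ⟨h2.mono_left nhdsWithin_le_nhds, ?_⟩
      filter_upwards [self_mem_nhdsWithin, nhdsWithin_le_nhds (κ.open_target.mem_nhds hyt)]
        with z hz hzt h
      have h : κ.symm z = y := h
      exact hz (show z = κ y by rw [← h, κ.right_inv hzt])
    filter_upwards [h1.eventually (S.isolated y), nhdsWithin_le_nhds hdom] with z hz hzd h
    apply hz
    have h3 : S.s y (κ.symm z) ∈ κ.source := by
      have := hzd.2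
      change S.s (κ.symm (κ y)) (κ.symm z) ∈ κ.source at this
      rwa [κ.left_inv hy] at this
    simp only [localSymm] at h
    change κ (S.s (κ.symm (κ y)) (κ.symm z)) = z at h
    rw [κ.left_inv hy] at h
    calc S.s y (κ.symm z) = κ.symm (κ (S.s y (κ.symm z))) := (κ.left_inv h3).symm
      _ = κ.symm z := by rw [h]

/-- On the diagonal `s_z(z) = z`, so the two partial derivatives add up to `1`; the second is `-1`,
hence the first is `2`. -/
theorem hasFDerivAt_localSymm (o : M) {y : M} (hy : y ∈ (chartAt E o).source) :
    HasFDerivAt (S.localSymm o)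
      ((2 : ℝ) • ContinuousLinearMap.fst ℝ E E - ContinuousLinearMap.snd ℝ E E)
      (chartAt E o y, chartAt E o y) := by
  set κ := chartAt E o
  have hmem := S.mem_localDom_self o hy
  have hyt : κ y ∈ κ.target := κ.map_source hy
  have hd : HasFDerivAt (S.localSymm o) (fderiv ℝ (S.localSymm o) (κ y, κ y)) (κ y, κ y) :=
    (((S.contDiffOn_localSymm o).contDiffAt
      ((S.isOpen_localDom o).mem_nhds hmem)).differentiableAt (by simp)).hasFDerivAt
  set T := fderiv ℝ (S.localSymm o) (κ y, κ y)
  have h1 : ∀ b, T (0, b) = -b := by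
    intro b
    have h2 : HasFDerivAt (fun z ↦ S.localSymm o (κ y, z)) _ (κ y) :=
      HasFDerivAt.comp (g := S.localSymm o) (κ y) hd (hasFDerivAt_prodMk_right (κ y) (κ y))
    have h3 := h2.fderiv
    rw [S.fderiv_localSymm_right o hy] at h3
    simpa using (congrArg (fun L : E →L[ℝ] E ↦ L b) h3).symm
  have h4 : ∀ a, T (a, a) = a := by
    intro a
    have h2 : HasFDerivAt (fun z ↦ S.localSymm o (z, z)) _ (κ y) :=
      HasFDerivAt.comp (g := S.localSymm o) (κ y) hd ((hasFDerivAt_id _).prodMk (hasFDerivAt_id _))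
    have h3 : HasFDerivAt (fun z ↦ S.localSymm o (z, z)) (ContinuousLinearMap.id ℝ E) (κ y) :=
      (hasFDerivAt_id _).congr_of_eventuallyEq (by
        filter_upwards [κ.open_target.mem_nhds hyt] with z hz using S.localSymm_self o hz)
    simpa using congrArg (fun L : E →L[ℝ] E ↦ L a) (h2.unique h3)
  refine hd.congr_fderiv ?_
  ext p
  · have h5 : T (p, 0) = T (p, p) - T (0, p) := by rw [← map_sub]; simp
    simp [h5, h1, h4, two_smul]
  · simp [h1]

theorem mfderiv_symm_self (x : M) (v : E) :
    (mfderiv 𝓘(ℝ, E) 𝓘(ℝ, E) (S.s x) x : E →L[ℝ] E) v = -v := by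
  have hmem := S.mem_localDom_self x (mem_chart_source E x)
  have hd : HasFDerivAt (fun z ↦ S.localSymm x (chartAt E x x, z)) (-ContinuousLinearMap.id ℝ E)
      (chartAt E x x) := by
    rw [← S.fderiv_localSymm_right x (mem_chart_source E x)]
    have h1 : ContDiffAt ℝ ∞ (fun z ↦ S.localSymm x (chartAt E x x, z)) (chartAt E x x) :=
      ((S.contDiffOn_localSymm x).contDiffAt ((S.isOpen_localDom x).mem_nhds hmem)).comp _
        (contDiffAt_const.prodMk contDiffAt_id)
    exact (h1.differentiableAt (by simp)).hasFDerivAt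
  have h : HasMFDerivAt 𝓘(ℝ, E) 𝓘(ℝ, E) (S.s x) x (-ContinuousLinearMap.id ℝ E : E →L[ℝ] E) := by
    refine ⟨(S.contMDiff_s x).continuous.continuousAt, ?_⟩
    simp only [writtenInExtChartAt, S.fixed, mfld_simps]
    refine hd.hasFDerivWithinAt.congr_of_eventuallyEq (Eventually.of_forall fun z ↦ ?_) ?_ <;>
    simp [localSymm]
  have h2 := h.mfderiv
  exact congrArg (fun L : E →L[ℝ] E ↦ L v) h2

/-- Existence of midpoints near the diagonal, with a contraction estimate. -/
theorem exists_midpoint (o : M) : ∃ (P : E × E → E) (r : ℝ), 0 < r ∧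
    (ball (chartAt E o o) r ⊆ (chartAt E o).target) ∧
    (∀ y ∈ ball (chartAt E o o) r, ∀ w ∈ ball (chartAt E o o) r,
      P (y, w) ∈ (chartAt E o).target ∧
      S.s ((chartAt E o).symm (P (y, w))) ((chartAt E o).symm y) = (chartAt E o).symm w) ∧
    ∀ y ∈ ball (chartAt E o o) r, ∀ w ∈ ball (chartAt E o o) r,
      ‖P (y, w) - y‖ ≤ (3 / 4) * ‖w - y‖ := by
  set κ := chartAt E o
  set p := κ o
  have ho := mem_chart_source E o
  have hpt : p ∈ κ.target := κ.map_source ho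
  -- The midpoint of `y` and `w` is the `m` with `s_m(y) = w`. It is the second component of the
  -- inverse of `(y, m) ↦ (y, s_m(y))`, whose differential `(a, b) ↦ (a, 2b - a)` is invertible.
  let g : E × E → E × E := fun q ↦ (q.1, S.localSymm o (q.2, q.1))
  let U : Set (E × E) := Prod.swap ⁻¹' S.localDom o
  have hU : IsOpen U := (S.isOpen_localDom o).preimage continuous_swap
  have hpU : (p, p) ∈ U := S.mem_localDom_self o ho
  have hg : ContDiffOn ℝ ∞ g U :=
    contDiffOn_fst.prodMk ((S.contDiffOn_localSymm o).comp
      (contDiff_snd.prodMk contDiff_fst).contDiffOn fun q hq ↦ hq)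
  let T : (E × E) ≃L[ℝ] (E × E) := ContinuousLinearEquiv.equivOfInverse
    ((ContinuousLinearMap.fst ℝ E E).prod
      ((2 : ℝ) • ContinuousLinearMap.snd ℝ E E - ContinuousLinearMap.fst ℝ E E))
    ((ContinuousLinearMap.fst ℝ E E).prod
      ((2⁻¹ : ℝ) • (ContinuousLinearMap.snd ℝ E E + ContinuousLinearMap.fst ℝ E E)))
    (fun q ↦ by ext <;> simp [smul_sub]) (fun q ↦ by ext <;> simp)
  have hgT : HasFDerivAt g (T : E × E →L[ℝ] E × E) (p, p) := by
    have h1 : HasFDerivAt (fun q : E × E ↦ S.localSymm o (q.2, q.1)) _ (p, p) :=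
      HasFDerivAt.comp (g := S.localSymm o) (p, p) (S.hasFDerivAt_localSymm o ho)
        (hasFDerivAt_snd.prodMk hasFDerivAt_fst)
    have h2 : HasFDerivAt g _ (p, p) := hasFDerivAt_fst.prodMk h1
    refine h2.congr_fderiv ?_
    ext q <;> simp [T]
  obtain ⟨e, he, hpe, heU, hes⟩ := exists_openPartialHomeomorph_of_hasFDerivAt hU hpU hg hgT
  have hgp : e (p, p) = (p, p) := by
    rw [he]; exact Prod.ext rfl (S.localSymm_self o hpt)
  have hpet : (p, p) ∈ e.target := hgp ▸ e.map_source hpe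
  have hesp : e.symm (p, p) = (p, p) := by
    have := e.left_inv hpe; rwa [hgp] at this
  have hstrict : HasStrictFDerivAt e.symm (T.symm : E × E →L[ℝ] E × E) (p, p) := by
    have h1 : ContDiffAt ℝ ∞ e.symm (p, p) := hes.contDiffAt (e.open_target.mem_nhds hpet)
    refine h1.hasStrictFDerivAt' ?_ (by simp)
    refine e.hasFDerivAt_symm hpet ?_
    rw [he, hesp]; exact hgT
  -- To first order the midpoint displacement is half of `w - y`. Strict differentiability bounds
  -- the error by a quarter of `‖w - y‖`, so the factor is `3/4`.
  have hsm : ∀ᶠ qq : (E × E) × (E × E) in 𝓝 ((p, p), (p, p)),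
      ‖e.symm qq.1 - e.symm qq.2 - T.symm (qq.1 - qq.2)‖ ≤ (1 / 4) * ‖qq.1 - qq.2‖ :=
    hstrict.isLittleO.bound (by norm_num)
  obtain ⟨r0, hr0, hsm⟩ := Metric.eventually_nhds_iff_ball.1 hsm
  obtain ⟨r1, hr1, hr1t⟩ := Metric.mem_nhds_iff.1 (e.open_target.mem_nhds hpet)
  have hdiag : ContinuousAt (fun y : E ↦ (y, y)) p := by fun_prop
  obtain ⟨r2, hr2, hr2t⟩ := Metric.mem_nhds_iff.1
    (inter_mem (κ.open_target.mem_nhds hpt) (hdiag (e.open_source.mem_nhds hpe)))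
  have hpair : ∀ y ∈ ball p r1, ∀ w ∈ ball p r1, (y, w) ∈ e.target := fun y hy w hw ↦
    hr1t (by rw [← ball_prod_same]; exact ⟨hy, hw⟩)
  -- the first component of the inverse is the first projection
  have hfst : ∀ q ∈ e.target, (e.symm q).1 = q.1 := by
    intro q hq
    have h1 : g (e.symm q) = q := (congrFun he _).symm.trans (e.right_inv hq)
    have h2 := congrArg Prod.fst h1
    exact h2
  have hsnd : ∀ q ∈ e.target, S.localSymm o ((e.symm q).2, (e.symm q).1) = q.2 := by
    intro q hq
    have h1 : g (e.symm q) = q := (congrFun he _).symm.trans (e.right_inv hq)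
    have h2 := congrArg Prod.snd h1
    exact h2
  refine ⟨fun q ↦ (e.symm q).2, min r0 (min r1 r2), by positivity, fun y hy ↦
    (hr2t (ball_subset_ball ((min_le_right _ _).trans (min_le_right _ _)) hy)).1,
    fun y hy w hw ↦ ?_, fun y hy w hw ↦ ?_⟩
  · have hsub : ball p (min r0 (min r1 r2)) ⊆ ball p r1 :=
      ball_subset_ball ((min_le_right _ _).trans (min_le_left _ _))
    have hsub2 : ball p (min r0 (min r1 r2)) ⊆ ball p r2 :=
      ball_subset_ball ((min_le_right _ _).trans (min_le_right _ _))
    have hq := hpair y (hsub hy) w (hsub hw)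
    have hU' := heU (e.map_target hq)
    refine ⟨hU'.1.1, ?_⟩
    have h1 := hsnd _ hq
    rw [hfst _ hq] at h1
    have h2 : S.s (κ.symm (e.symm (y, w)).2) (κ.symm y) ∈ κ.source := by
      have := hU'.2
      simpa [hfst _ hq] using this
    calc S.s (κ.symm (e.symm (y, w)).2) (κ.symm y)
        = κ.symm (κ (S.s (κ.symm (e.symm (y, w)).2) (κ.symm y))) := (κ.left_inv h2).symm
      _ = κ.symm w := congrArg κ.symm h1
  · have hyt := hr2t (ball_subset_ball ((min_le_right _ _).trans (min_le_right _ _)) hy)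
    have hyy : e.symm (y, y) = (y, y) := by
      have h1 : e (y, y) = (y, y) := (congrFun he _).trans
        (Prod.ext rfl (S.localSymm_self o hyt.1))
      have h2 := e.left_inv hyt.2
      rwa [h1] at h2
    have h1 := hsm ((y, w), (y, y)) (by
      have h0 := fun z (hz : z ∈ ball p (min r0 (min r1 r2))) ↦
        ball_subset_ball (min_le_left _ _) hz
      rw [← ball_prod_same, ← ball_prod_same]
      exact ⟨⟨h0 y hy, h0 w hw⟩, h0 y hy, h0 y hy⟩)
    have h2 := (norm_snd_le _).trans h1
    have h3 : T.symm ((y, w) - (y, y)) = (0, (2⁻¹ : ℝ) • (w - y)) := by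
      change ((ContinuousLinearMap.fst ℝ E E).prod
      ((2⁻¹ : ℝ) • (ContinuousLinearMap.snd ℝ E E + ContinuousLinearMap.fst ℝ E E)))
        ((y, w) - (y, y)) = _
      simp
    rw [hyy, h3] at h2
    have h4 : ‖(y, w) - (y, y)‖ = ‖w - y‖ := by
      rw [Prod.mk_sub_mk, sub_self, Prod.norm_def]; simp
    rw [h4] at h2
    have h5 : ‖(e.symm (y, w)).2 - y‖ ≤
        ‖(e.symm (y, w)).2 - y - (2⁻¹ : ℝ) • (w - y)‖ + ‖(2⁻¹ : ℝ) • (w - y)‖ := by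
      simpa using norm_add_le ((e.symm (y, w)).2 - y - (2⁻¹ : ℝ) • (w - y)) ((2⁻¹ : ℝ) • (w - y))
    rw [norm_smul] at h5
    norm_num at h5 h2
    linarith

/-- Take the midpoint of `o` and `y`. Consequently the orbits of the group generated by the
symmetries are open. -/
theorem eventually_exists_symm_eq (o : M) : ∀ᶠ y in 𝓝 o, ∃ w, S.s w o = y := by
  obtain ⟨P, r, hr, -, h, -⟩ := S.exists_midpoint o
  have ho := mem_chart_source E o
  filter_upwards [(chartAt E o).open_source.mem_nhds ho,
    ((chartAt E o).continuousAt ho) (ball_mem_nhds _ hr)] with y hy hy'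
  have := (h _ (mem_ball_self hr) _ hy').2
  rw [(chartAt E o).left_inv ho, (chartAt E o).left_inv hy] at this
  exact ⟨_, this⟩

/-- The group generated by the symmetries is transitive. -/
theorem symm_induction [ConnectedSpace M] {C : M → Prop} {o : M} (ho : C o)
    (h : ∀ u m, C m → C (S.s u m)) (m : M) : C m := by
  have hclopen : IsClopen {m | C m} := by
    constructor
    · rw [← isOpen_compl_iff, isOpen_iff_mem_nhds]
      intro m hm
      filter_upwards [S.eventually_exists_symm_eq m] with y hy hyC
      obtain ⟨w, rfl⟩ := hy
      have := h w _ hyC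
      rw [S.involutive] at this
      exact hm this
    · rw [isOpen_iff_mem_nhds]
      intro m hm
      filter_upwards [S.eventually_exists_symm_eq m] with y hy
      obtain ⟨w, rfl⟩ := hy
      exact h w m hm
  have := hclopen.eq_univ ⟨o, ho⟩
  exact (Set.eq_univ_iff_forall.1 this m :)

/-- A nonempty open subset which is stable under `(x, y) ↦ s_x(y)` is everything. -/
theorem eq_univ_of_isOpen_of_stable [ConnectedSpace M] {C : Set M} (hC : IsOpen C)
    (hne : C.Nonempty) (h : ∀ u ∈ C, ∀ m ∈ C, S.s u m ∈ C) : C = Set.univ := by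
  refine IsClopen.eq_univ ⟨isClosed_of_closure_subset fun m hm ↦ ?_, hC⟩ hne
  obtain ⟨P, r, hr, hrt, hP, hPc⟩ := S.exists_midpoint m
  set κ := chartAt E m with hκ
  have hms : m ∈ κ.source := mem_chart_source E m
  have hnhds : κ.source ∩ κ ⁻¹' ball (κ m) (r / 2) ∈ 𝓝 m :=
    inter_mem (κ.open_source.mem_nhds hms) ((κ.continuousAt hms) (ball_mem_nhds _ (by positivity)))
  obtain ⟨c, ⟨hcs, hcb⟩, hcC⟩ := mem_closure_iff_nhds.1 hm _ hnhds
  set y := κ c with hy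
  have hyb : ‖y - κ m‖ < r / 2 := by simpa [dist_eq_norm] using hcb
  -- A point `m` of the closure is moved towards a nearby `c ∈ C` by repeatedly taking midpoints
  -- with `c`. The sequence converges to `c`, hence enters the open set `C`.
  let w : ℕ → E := fun n ↦ (fun z ↦ P (y, z))^[n] (κ m)
  have hyr : y ∈ ball (κ m) r := by rw [mem_ball, dist_eq_norm]; linarith
  have hw : ∀ n, w n ∈ ball (κ m) r ∧ ‖w n - y‖ ≤ (3 / 4) ^ n * (r / 2) := by
    have key : ∀ z : E, ‖z - y‖ ≤ r / 2 → z ∈ ball (κ m) r := by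
      intro z hz
      rw [mem_ball, dist_eq_norm]
      calc ‖z - κ m‖ = ‖(z - y) + (y - κ m)‖ := by congr 1; abel
        _ ≤ ‖z - y‖ + ‖y - κ m‖ := norm_add_le _ _
        _ < r := by linarith
    intro n
    induction n with
    | zero =>
      refine ⟨mem_ball_self hr, ?_⟩
      simp only [w, Function.iterate_zero, id, pow_zero, one_mul]
      rw [norm_sub_rev]; exact hyb.le
    | succ n ih =>
      have h1 := hPc y hyr _ ih.1
      have h2 : w (n + 1) = P (y, w n) := by
        simp only [w, Function.iterate_succ_apply']
      have h3 : ‖w (n + 1) - y‖ ≤ (3 / 4) ^ (n + 1) * (r / 2) := by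
        rw [h2, pow_succ']
        calc _ ≤ _ := h1
          _ ≤ 3 / 4 * ((3 / 4) ^ n * (r / 2)) := by gcongr; exact ih.2
          _ = _ := by ring
      refine ⟨key _ (h3.trans ?_), h3⟩
      have : (3 / 4 : ℝ) ^ (n + 1) ≤ 1 := pow_le_one₀ (by norm_num) (by norm_num)
      nlinarith
  have hlim : Tendsto w atTop (𝓝 y) := by
    rw [tendsto_iff_norm_sub_tendsto_zero]
    refine squeeze_zero (fun n ↦ norm_nonneg _) (fun n ↦ (hw n).2) ?_
    simpa using (tendsto_pow_atTop_nhds_zero_of_lt_one (r := (3 / 4 : ℝ)) (by norm_num)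
      (by norm_num)).mul_const (r / 2)
  have hyt : y ∈ κ.target := κ.map_source hcs
  have hlim' : Tendsto (fun n ↦ κ.symm (w n)) atTop (𝓝 c) := by
    have := (κ.continuousAt_symm hyt).tendsto
    rw [κ.left_inv hcs] at this
    exact this.comp hlim
  obtain ⟨N, hN⟩ := (hlim'.eventually (hC.mem_nhds hcC)).exists
  -- Each term is the reflection of `c` in its successor, so membership in `C` descends from index
  -- `N` to index `0`, which is `m`.
  have hdown : ∀ k ≤ N, κ.symm (w (N - k)) ∈ C := by
    intro k
    induction k with
    | zero => intro _; exact hN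
    | succ k ih =>
      intro hk
      have h1 := ih (by omega)
      have h2 := (hP y hyr _ (hw (N - (k + 1))).1).2
      have h3 : w (N - k) = P (y, w (N - (k + 1))) := by
        rw [show N - k = N - (k + 1) + 1 by omega]
        simp only [w, Function.iterate_succ_apply']
      rw [← h3, κ.left_inv hcs] at h2
      rw [← h2]
      exact h _ h1 _ hcC
  have := hdown N le_rfl
  simpa [w, κ.left_inv hms] using this

end SymplecticSymmetricSpace

end SymplecticSymmetric

/-! ### Normal charts -/

namespace SymplecticSymmetric

namespace SymplecticSymmetricSpace

open Filter Metric

variable {E : Type*} [NormedAddCommGroup E] [NormedSpace ℝ E]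
  {M : Type*} [TopologicalSpace M] [ChartedSpace E M] [IsManifold 𝓘(ℝ, E) ∞ M]
  (S : SymplecticSymmetricSpace E M)

/-- Maps which are compatible with the symmetries. -/
def IsHom (φ : M → M) : Prop := ∀ x y, φ (S.s x y) = S.s (φ x) (φ y)

/-- A normal chart at `o`: it doubles along `x ↦ s_x(o)` and linearizes the smooth maps which fix
`o` and are compatible with the symmetries. -/
structure NormalChart (o : M) where
  /-- the chart -/
  c : OpenPartialHomeomorph M E
  /-- the radius of its image -/
  r : ℝ
  r_pos : 0 < r
  mem_source : o ∈ c.source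
  map_base : c o = 0
  target_eq : c.target = ball 0 r
  contMDiffOn : ContMDiffOn 𝓘(ℝ, E) 𝓘(ℝ, E) ∞ c c.source
  contMDiffOn_symm : ContMDiffOn 𝓘(ℝ, E) 𝓘(ℝ, E) ∞ c.symm c.target
  double : ∀ v ∈ ball (0 : E) r, S.s (c.symm ((2⁻¹ : ℝ) • v)) o = c.symm v
  linear : ∀ φ : M → M, S.IsHom φ → φ o = o → ContMDiffAt 𝓘(ℝ, E) 𝓘(ℝ, E) ∞ φ o →
    ∃ A : E →L[ℝ] E, ∀ᶠ v in 𝓝 0, φ (c.symm v) = c.symm (A v)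

/-- In a chart centred at `o` the map `x ↦ s_x(o)` is a doubling germ, by its partial derivative
`2`. A homomorphism fixing `o` commutes with it, as `φ(s_x(o)) = s_{φ(x)}(o)`, so the doubling
linearization makes it linear. -/
theorem nonempty_normalChart [FiniteDimensional ℝ E] (o : M) : Nonempty (S.NormalChart o) := by
  have : CompleteSpace E := FiniteDimensional.complete ℝ E
  set κ := chartAt E o with hκ
  set p := κ o with hp
  have ho : o ∈ κ.source := mem_chart_source E o
  have hpt : p ∈ κ.target := κ.map_source ho
  let Q : E → E := fun z ↦ S.localSymm o (z + p, p) - p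
  let U : Set E := (fun z ↦ (z + p, p)) ⁻¹' S.localDom o
  have hcz : Continuous fun z : E ↦ (z + p, p) := by fun_prop
  have hU : IsOpen U := (S.isOpen_localDom o).preimage hcz
  have h0U : (0 : E) ∈ U := by
    change (0 + p, p) ∈ S.localDom o
    rw [zero_add]; exact S.mem_localDom_self o ho
  have hQ : ContDiffOn ℝ ∞ Q U :=
    ((S.contDiffOn_localSymm o).comp (((contDiff_id.add contDiff_const).prodMk
      contDiff_const).contDiffOn) fun z hz ↦ hz).sub contDiffOn_const
  have hQ0 : Q 0 = 0 := by
    simp only [Q, zero_add]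
    rw [S.localSymm_self o hpt, sub_self]
  have hQ' : HasFDerivAt Q ((2 : ℝ) • ContinuousLinearMap.id ℝ E) 0 := by
    have h1 : HasFDerivAt (fun z : E ↦ (z + p, p))
        ((ContinuousLinearMap.id ℝ E).prod (0 : E →L[ℝ] E)) 0 :=
      ((hasFDerivAt_id (0 : E)).add_const p).prodMk (hasFDerivAt_const p (0 : E))
    have h2 : HasFDerivAt Q _ 0 :=
      (HasFDerivAt.comp (g := S.localSymm o) (0 : E)
        (by simpa using S.hasFDerivAt_localSymm o ho) h1).sub_const p
    refine h2.congr_fderiv ?_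
    ext z
    simp
  obtain ⟨e, r, hr, h0e, he0, heU, het, hes, hess, hd, hlin⟩ :=
    exists_doubling_linearization hU h0U hQ hQ0 hQ'
  let T : E ≃ₜ E := Homeomorph.subRight p
  let c : OpenPartialHomeomorph M E := (κ.trans T.toOpenPartialHomeomorph).trans e
  have hcs : ∀ m, m ∈ c.source ↔ m ∈ κ.source ∧ κ m - p ∈ e.source := by
    intro m
    simp [c, T]
  have hcsymm : ∀ v, c.symm v = κ.symm (e.symm v + p) := fun v ↦ rfl
  have hcapp : ∀ m, c m = e (κ m - p) := fun v ↦ rfl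
  have hUt : ∀ z ∈ U, z + p ∈ κ.target := fun z hz ↦ hz.1.1
  have hct : c.target = ball 0 r := by
    ext v
    rw [← het]
    constructor
    · intro hv
      have h1 := c.map_target hv
      have h2 := c.right_inv hv
      rw [hcapp] at h2
      rw [← h2]
      exact e.map_source ((hcs _).1 h1).2
    · intro hv
      have h1 : e.symm v + p ∈ κ.target := hUt _ (heU (e.map_target hv))
      have h2 : c.symm v ∈ c.source := by
        rw [hcs, hcsymm]
        refine ⟨κ.map_target h1, ?_⟩
        rw [κ.right_inv h1, add_sub_cancel_right]
        exact e.map_target hv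
      have h3 := c.map_source h2
      rw [hcapp, hcsymm, κ.right_inv h1, add_sub_cancel_right, e.right_inv hv] at h3
      exact h3
  have hχ := contMDiffOn_chart (I := 𝓘(ℝ, E)) (n := ∞) (x := o)
  have hχs := contMDiffOn_chart_symm (I := 𝓘(ℝ, E)) (n := ∞) (x := o)
  refine ⟨⟨c, r, hr, ?_, ?_, hct, ?_, ?_, ?_, ?_⟩⟩
  · rw [hcs]; exact ⟨ho, by rwa [sub_self]⟩
  · rw [hcapp, sub_self, he0]
  · have h1 : ContMDiffOn 𝓘(ℝ, E) 𝓘(ℝ, E) ∞ (fun m ↦ κ m - p) c.source :=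
      (hχ.mono fun m hm ↦ ((hcs m).1 hm).1).sub contMDiffOn_const
    exact hes.contMDiffOn.comp h1 fun m hm ↦ ((hcs m).1 hm).2
  · rw [hct, ← het]
    have h1 : ContDiffOn ℝ ∞ (fun v ↦ e.symm v + p) e.target := hess.add contDiffOn_const
    exact hχs.comp h1.contMDiffOn fun v hv ↦ hUt _ (heU (e.map_target hv))
  · intro v hv
    obtain ⟨h1, h2⟩ := hd v hv
    have hv2 : (2⁻¹ : ℝ) • v ∈ ball (0 : E) r := by
      rw [mem_ball_zero_iff] at hv ⊢
      rw [norm_smul]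
      norm_num
      linarith [norm_nonneg v]
    have h3 := (hd _ hv2).1
    have h4 : S.s (κ.symm (e.symm ((2⁻¹ : ℝ) • v) + p)) (κ.symm p) ∈ κ.source := h3.2
    have h5 : κ (S.s (κ.symm (e.symm ((2⁻¹ : ℝ) • v) + p)) (κ.symm p)) - p = e.symm v := h2
    rw [κ.left_inv ho] at h4 h5
    rw [hcsymm, hcsymm, ← h5, sub_add_cancel, κ.left_inv h4]
  · intro φ hφ hφo hφs
    let f : E → E := fun z ↦ κ (φ (κ.symm (z + p))) - p
    have hf0 : f 0 = 0 := by
      simp only [f, zero_add]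
      rw [κ.left_inv ho, hφo, sub_self]
    have hzc : Tendsto (fun z ↦ κ.symm (z + p)) (𝓝 0) (𝓝 o) := by
      have h1 := (κ.continuousAt_symm hpt).tendsto
      rw [κ.left_inv ho] at h1
      exact h1.comp (Continuous.tendsto' (by fun_prop) _ _ (by simp))
    have hφc : Tendsto (fun z ↦ φ (κ.symm (z + p))) (𝓝 0) (𝓝 o) := by
      have := hφs.continuousAt.tendsto
      rw [hφo] at this
      exact this.comp hzc
    have hfd : DifferentiableAt ℝ f 0 := by
      have h1 : ContMDiffAt 𝓘(ℝ, E) 𝓘(ℝ, E) ∞ (fun z ↦ κ.symm (z + p)) 0 := by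
        have h2 : ContMDiffAt 𝓘(ℝ, E) 𝓘(ℝ, E) ∞ κ.symm (0 + p) := by
          rw [zero_add]; exact hχs.contMDiffAt (κ.open_target.mem_nhds hpt)
        exact h2.comp (0 : E) (contDiffAt_id.add contDiffAt_const).contMDiffAt
      have h2 : ContMDiffAt 𝓘(ℝ, E) 𝓘(ℝ, E) ∞ (fun z ↦ φ (κ.symm (z + p))) 0 := by
        refine ContMDiffAt.comp_of_eq hφs h1 ?_
        rw [zero_add, κ.left_inv ho]
      have h3 : ContMDiffAt 𝓘(ℝ, E) 𝓘(ℝ, E) ∞ f 0 := by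
        refine ContMDiffAt.sub (ContMDiffAt.comp_of_eq (y := o)
          (hχ.contMDiffAt (κ.open_source.mem_nhds ho)) h2 ?_) contMDiffAt_const
        rw [zero_add, κ.left_inv ho, hφo]
      exact h3.contDiffAt.differentiableAt (by simp)
    have hcomm : ∀ᶠ z in 𝓝 0, f (Q z) = Q (f z) := by
      filter_upwards [hU.mem_nhds h0U, hφc.eventually (κ.open_source.mem_nhds ho)] with z hz hz'
      have h1 : S.s (κ.symm (z + p)) (κ.symm p) ∈ κ.source := hz.2
      simp only [f, Q, localSymm, sub_add_cancel]
      change κ (φ (κ.symm (κ (S.s (κ.symm (z + p)) (κ.symm p))))) - p =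
        κ (S.s (κ.symm (κ (φ (κ.symm (z + p))))) (κ.symm p)) - p
      have hz'' : φ (κ.symm (z + p)) ∈ κ.source := hz'
      rw [κ.left_inv h1, κ.left_inv hz'', κ.left_inv ho, hφ, hφo]
    refine ⟨fderiv ℝ f 0, ?_⟩
    have h1 := hlin f _ hf0 hfd.hasFDerivAt hcomm
    have hec : Tendsto e.symm (𝓝 0) (𝓝 0) := by
      have h2 := (e.continuousAt_symm (x := 0) (by rw [het]; exact mem_ball_self hr)).tendsto
      rwa [show e.symm 0 = 0 by have := e.left_inv h0e; rwa [he0] at this] at h2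
    filter_upwards [h1, (hφc.comp hec).eventually (κ.open_source.mem_nhds ho)] with v h2 h3
    rw [hcsymm, hcsymm, ← h2]
    simp only [f, sub_add_cancel]
    exact (κ.left_inv h3).symm

end SymplecticSymmetricSpace

end SymplecticSymmetric

/-! ### Homomorphisms and their linear parts -/

namespace SymplecticSymmetric

namespace SymplecticSymmetricSpace

open Filter Metric

variable {E : Type*} [NormedAddCommGroup E] [NormedSpace ℝ E]
  {M : Type*} [TopologicalSpace M] [ChartedSpace E M] [IsManifold 𝓘(ℝ, E) ∞ M]
  {S : SymplecticSymmetricSpace E M}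

theorem IsHom.comp {φ ψ : M → M} (hφ : S.IsHom φ) (hψ : S.IsHom ψ) : S.IsHom (φ ∘ ψ) :=
  fun x y ↦ by change φ (ψ (S.s x y)) = _; rw [hψ x y, hφ]; rfl

theorem isHom_aut (g : S.aut) : S.IsHom (g : Diffeo E M) := fun x y ↦
  congrArg (fun f : Diffeo E M ↦ f y) (g.2.2 x)

theorem isHom_s (x : M) : S.IsHom (S.s x) := fun y z ↦ by
  rw [← S.conj, S.involutive]

/-- The interior of the set where two homomorphisms agree is stable under `(u, m) ↦ s_u(m)`, so it
is empty or everything. -/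
theorem IsHom.ext [CompleteSpace E] [ConnectedSpace M] {φ ψ : M → M} (hφ : S.IsHom φ)
    (hψ : S.IsHom ψ) {o : M} (h : ∀ᶠ m in 𝓝 o, φ m = ψ m) : φ = ψ := by
  have hC := S.eq_univ_of_isOpen_of_stable (C := interior {m | φ m = ψ m}) isOpen_interior
    ⟨o, mem_interior_iff_mem_nhds.2 h⟩ fun u hu m hm ↦ by
      rw [mem_interior_iff_mem_nhds] at hm ⊢
      have hu' : φ u = ψ u := (interior_subset hu : u ∈ {m | φ m = ψ m})
      have hc : Tendsto (S.s u) (𝓝 (S.s u m)) (𝓝 m) := by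
        have := (S.contMDiff_s u).continuous.tendsto (S.s u m)
        rwa [S.involutive] at this
      filter_upwards [hc hm] with m' hm'
      have h1 : φ (S.s u m') = ψ (S.s u m') := hm'
      change φ m' = ψ m'
      rw [← S.involutive u m', hφ, hψ, h1, hu']
  funext m
  exact (interior_subset (Set.eq_univ_iff_forall.1 hC m) : m ∈ {m | φ m = ψ m})

namespace NormalChart

variable {o : M} (N : S.NormalChart o)

/-- `A` is the linear part of `φ` in the normal chart. -/
def Lin (φ : M → M) (A : E →L[ℝ] E) : Prop := ∀ᶠ v in 𝓝 0, φ (N.c.symm v) = N.c.symm (A v)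

theorem zero_mem_target : (0 : E) ∈ N.c.target := by
  rw [N.target_eq]; exact mem_ball_self N.r_pos

theorem mem_target {v : E} (hv : ‖v‖ < N.r) : v ∈ N.c.target := by
  rw [N.target_eq]; simpa using hv

theorem norm_lt {v : E} (hv : v ∈ N.c.target) : ‖v‖ < N.r := by
  rw [N.target_eq] at hv; simpa using hv

theorem symm_zero : N.c.symm 0 = o := by
  rw [← N.map_base, N.c.left_inv N.mem_source]

theorem double' {v : E} (hv : ‖v‖ < N.r) : S.s (N.c.symm ((2⁻¹ : ℝ) • v)) o = N.c.symm v :=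
  N.double v (by simpa using hv)

theorem norm_half_lt {v : E} (hv : ‖v‖ < N.r) : ‖(2⁻¹ : ℝ) • v‖ < N.r := by
  rw [norm_smul]
  norm_num
  linarith [norm_nonneg v]

theorem tendsto_symm : Tendsto N.c.symm (𝓝 0) (𝓝 o) := by
  have := (N.c.continuousAt_symm N.zero_mem_target).tendsto
  rwa [N.symm_zero] at this

theorem tendsto_c : Tendsto N.c (𝓝 o) (𝓝 0) := by
  have := (N.c.continuousAt N.mem_source).tendsto
  rwa [N.map_base] at this

theorem contMDiffAt_c {m : M} (hm : m ∈ N.c.source) : ContMDiffAt 𝓘(ℝ, E) 𝓘(ℝ, E) ∞ N.c m :=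
  N.contMDiffOn.contMDiffAt (N.c.open_source.mem_nhds hm)

theorem contMDiffAt_symm {v : E} (hv : ‖v‖ < N.r) :
    ContMDiffAt 𝓘(ℝ, E) 𝓘(ℝ, E) ∞ N.c.symm v :=
  N.contMDiffOn_symm.contMDiffAt (N.c.open_target.mem_nhds (N.mem_target hv))

variable {N} {φ ψ : M → M} {A B : E →L[ℝ] E}

theorem eventually_norm_clm_lt (A : E →L[ℝ] E) {r : ℝ} (hr : 0 < r) :
    ∀ᶠ v in 𝓝 (0 : E), ‖A v‖ < r := by
  have : Tendsto (fun v ↦ ‖A v‖) (𝓝 0) (𝓝 0) :=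
    Continuous.tendsto' (by fun_prop) _ _ (by simp)
  exact this.eventually (gt_mem_nhds hr)

theorem Lin.base (h : N.Lin φ A) : φ o = o := by
  have := h.self_of_nhds
  rwa [map_zero, N.symm_zero] at this

/-- Linearity of the germ spreads over the chart by doubling: the point with coordinate `v` is the
reflection of `o` in the point with coordinate `v/2`, and `φ` respects reflections and fixes `o`. -/
theorem Lin.full (h : N.Lin φ A) (hφ : S.IsHom φ) {v : E} (hv : ‖v‖ < N.r) (hAv : ‖A v‖ < N.r) :
    φ (N.c.symm v) = N.c.symm (A v) := by
  have hlim : Tendsto (fun n : ℕ ↦ ((2⁻¹ : ℝ) ^ n) • v) atTop (𝓝 0) := by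
    have := (tendsto_pow_atTop_nhds_zero_of_lt_one (r := (2⁻¹ : ℝ)) (by norm_num)
      (by norm_num)).smul_const v
    simpa using this
  obtain ⟨n, hn⟩ := (hlim.eventually h).exists
  have key : ∀ n : ℕ, ∀ v : E, ‖v‖ < N.r → ‖A v‖ < N.r →
      φ (N.c.symm (((2⁻¹ : ℝ) ^ n) • v)) = N.c.symm (A (((2⁻¹ : ℝ) ^ n) • v)) →
      φ (N.c.symm v) = N.c.symm (A v) := by
    intro n
    induction n with
    | zero => intro v _ _ h; simpa using h
    | succ n ih =>
      intro v hv hAv h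
      have h1 := ih ((2⁻¹ : ℝ) • v) (N.norm_half_lt hv) (by rw [map_smul]; exact N.norm_half_lt hAv)
        (by rw [smul_smul, ← pow_succ]; exact h)
      rw [← N.double' hv, hφ, h1, ‹N.Lin φ A›.base, map_smul, N.double' hAv]
  exact key n v hv hAv hn

theorem Lin.unique (hA : N.Lin φ A) (hB : N.Lin φ B) : A = B := by
  have h : ∀ᶠ v in 𝓝 (0 : E), A v = B v := by
    filter_upwards [hA, hB, eventually_norm_clm_lt A N.r_pos, eventually_norm_clm_lt B N.r_pos]
      with v h1 h2 h3 h4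
    exact N.c.symm.injOn (N.mem_target h3) (N.mem_target h4) (h1.symm.trans h2)
  obtain ⟨ε, hε, h⟩ := Metric.eventually_nhds_iff_ball.1 h
  ext v
  set c : ℝ := ε / (2 * (‖v‖ + 1)) with hc
  have hc0 : 0 < c := by positivity
  have := h (c • v) (by
    rw [mem_ball_zero_iff, norm_smul, Real.norm_of_nonneg hc0.le, hc, div_mul_eq_mul_div,
      div_lt_iff₀ (by positivity)]
    nlinarith [norm_nonneg v])
  rw [map_smul, map_smul] at this
  exact smul_right_injective E hc0.ne' this

theorem Lin.comp (hA : N.Lin φ A) (hB : N.Lin ψ B) : N.Lin (φ ∘ ψ) (A * B) := by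
  have hBc : Tendsto B (𝓝 0) (𝓝 0) := Continuous.tendsto' (by fun_prop) _ _ (by simp)
  filter_upwards [hBc.eventually hA, hB] with v h1 h2
  rw [Function.comp, h2, h1]
  rfl

theorem lin_id : N.Lin id 1 := Eventually.of_forall fun _ ↦ rfl

/-- The isotropy representation is faithful: the linear part determines the germ at `o`, and the
germ determines the homomorphism. -/
theorem Lin.ext [CompleteSpace E] [ConnectedSpace M] (hA : N.Lin φ A) (hB : N.Lin ψ A)
    (hφ : S.IsHom φ) (hψ : S.IsHom ψ) : φ = ψ := by
  refine hφ.ext hψ (o := o) ?_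
  filter_upwards [N.tendsto_c.eventually hA, N.tendsto_c.eventually hB,
    N.c.open_source.mem_nhds N.mem_source] with m h1 h2 h3
  rw [N.c.left_inv h3] at h1 h2
  rw [h1, h2]

variable (N)

/-- Automorphisms fixing `o` and close to the identity are given, locally around any point, by a
smooth function of their linear part. -/
theorem exists_local_extension [CompleteSpace E] [ConnectedSpace M] (m : M) :
    ∃ (F : (E →L[ℝ] E) × M → M) (W : Set ((E →L[ℝ] E) × M)), IsOpen W ∧ (1, m) ∈ W ∧
      ContMDiffOn (𝓘(ℝ, E →L[ℝ] E).prod 𝓘(ℝ, E)) 𝓘(ℝ, E) ∞ F W ∧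
      ∀ A m', (A, m') ∈ W → ∀ φ, S.IsHom φ → N.Lin φ A → φ m' = F (A, m') := by
  set C : Set M := {m | ∃ (F : (E →L[ℝ] E) × M → M) (W : Set ((E →L[ℝ] E) × M)), IsOpen W ∧
      (1, m) ∈ W ∧ ContMDiffOn (𝓘(ℝ, E →L[ℝ] E).prod 𝓘(ℝ, E)) 𝓘(ℝ, E) ∞ F W ∧
      ∀ A m', (A, m') ∈ W → ∀ φ, S.IsHom φ → N.Lin φ A → φ m' = F (A, m')} with hCdef
  suffices hC : C = Set.univ from (Set.eq_univ_iff_forall.1 hC m :)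
  refine S.eq_univ_of_isOpen_of_stable ?_ ⟨o, ?_⟩ ?_
  · rw [isOpen_iff_mem_nhds]
    rintro m ⟨F, W, hW, hm, hF, hφ⟩
    have hc : ContinuousAt (fun m' : M ↦ ((1 : E →L[ℝ] E), m')) m := by fun_prop
    filter_upwards [hc (hW.mem_nhds hm)] with m' hm'
    exact ⟨F, W, hW, hm', hF, hφ⟩
  -- At `o` itself the extension is explicit: apply the operator in the normal chart.
  · have hsm : ContMDiffOn (𝓘(ℝ, E →L[ℝ] E).prod 𝓘(ℝ, E)) 𝓘(ℝ, E) ∞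
        (fun p : (E →L[ℝ] E) × M ↦ p.1 (N.c p.2)) (Set.univ ×ˢ N.c.source) := by
      have h1 : ContMDiffOn (𝓘(ℝ, E →L[ℝ] E).prod 𝓘(ℝ, E)) 𝓘(ℝ, E) ∞
          (fun p : (E →L[ℝ] E) × M ↦ N.c p.2) (Set.univ ×ˢ N.c.source) :=
        N.contMDiffOn.comp contMDiffOn_snd fun p hp ↦ hp.2
      exact ContMDiffOn.clm_apply contMDiffOn_fst h1
    refine ⟨fun p ↦ N.c.symm (p.1 (N.c p.2)),
      (Set.univ ×ˢ N.c.source) ∩ (fun p ↦ p.1 (N.c p.2)) ⁻¹' N.c.target,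
      hsm.continuousOn.isOpen_inter_preimage (isOpen_univ.prod N.c.open_source) N.c.open_target,
      ⟨⟨trivial, N.mem_source⟩, ?_⟩, ?_, ?_⟩
    · change (1 : E →L[ℝ] E) (N.c o) ∈ N.c.target
      rw [N.map_base, map_zero]; exact N.zero_mem_target
    · exact N.contMDiffOn_symm.comp (hsm.mono Set.inter_subset_left) fun p hp ↦ hp.2
    · rintro A m' ⟨⟨-, hm'⟩, hA⟩ φ hφ hL
      have h1 := hL.full hφ (N.norm_lt (N.c.map_source hm')) (N.norm_lt hA)
      rwa [N.c.left_inv hm'] at h1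
  -- Stability: `φ(m') = s_{φ(u)}(φ(s_u(m')))`, so extensions around `u` and `m` combine to one
  -- around `s_u(m)`.
  · rintro u ⟨Fu, Wu, hWu, hu, hFu, hφu⟩ m ⟨Fm, Wm, hWm, hm, hFm, hφm⟩
    let a : (E →L[ℝ] E) × M → (E →L[ℝ] E) × M := fun p ↦ (p.1, u)
    let b : (E →L[ℝ] E) × M → (E →L[ℝ] E) × M := fun p ↦ (p.1, S.s u p.2)
    have ha : ContMDiff (𝓘(ℝ, E →L[ℝ] E).prod 𝓘(ℝ, E)) (𝓘(ℝ, E →L[ℝ] E).prod 𝓘(ℝ, E)) ∞ a :=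
      contMDiff_fst.prodMk contMDiff_const
    have hb : ContMDiff (𝓘(ℝ, E →L[ℝ] E).prod 𝓘(ℝ, E)) (𝓘(ℝ, E →L[ℝ] E).prod 𝓘(ℝ, E)) ∞ b :=
      contMDiff_fst.prodMk ((S.contMDiff_s u).comp contMDiff_snd)
    refine ⟨fun p ↦ S.s (Fu (a p)) (Fm (b p)), a ⁻¹' Wu ∩ b ⁻¹' Wm,
      (hWu.preimage ha.continuous).inter (hWm.preimage hb.continuous), ⟨hu, ?_⟩, ?_, ?_⟩
    · change (1, S.s u (S.s u m)) ∈ Wm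
      rwa [S.involutive]
    · exact S.smooth.comp_contMDiffOn
        ((hFu.comp ha.contMDiffOn fun p hp ↦ hp.1).prodMk
          (hFm.comp hb.contMDiffOn fun p hp ↦ hp.2))
    · rintro A m' ⟨h1, h2⟩ φ hφ hL
      change φ m' = S.s (Fu (A, u)) (Fm (A, S.s u m'))
      rw [← hφu A u h1 φ hφ hL, ← hφm A _ h2 φ hφ hL, ← hφ, S.involutive]

end NormalChart

end SymplecticSymmetricSpace

end SymplecticSymmetric

/-! ### The isotropy group and its closedness -/

namespace SymplecticSymmetric

namespace SymplecticSymmetricSpace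

open Filter Metric

variable {E : Type*} [NormedAddCommGroup E] [NormedSpace ℝ E]
  {M : Type*} [TopologicalSpace M] [ChartedSpace E M] [IsManifold 𝓘(ℝ, E) ∞ M]
  {S : SymplecticSymmetricSpace E M}

variable (S) in
/-- `φ` preserves the symplectic form at the point `x`. -/
def PresAt (φ : Diffeo E M) (x : M) : Prop :=
  ∀ v w : TangentSpace 𝓘(ℝ, E) x, S.Ω.form (φ x) (diff φ x v) (diff φ x w) = S.Ω.form x v w

theorem PresAt.mul {φ ψ : Diffeo E M} {x : M} (hφ : S.PresAt φ (ψ x)) (hψ : S.PresAt ψ x) :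
    S.PresAt (φ * ψ) x := fun v w ↦ by
  rw [diff_mul, diff_mul]
  exact (hφ _ _).trans (hψ v w)

theorem presAt_symmetry (u x : M) : S.PresAt (S.symmetry u) x := S.symplectic u x

theorem symmetry_apply (u x : M) : S.symmetry u x = S.s u x := rfl

/-- A diffeomorphism compatible with the symmetries and preserving the symplectic form at a point
is an automorphism. -/
theorem mem_aut_of_isHom_of_presAt [CompleteSpace E] [ConnectedSpace M] {φ : Diffeo E M}
    (hφ : S.IsHom φ) {o : M} (ho : S.PresAt φ o) : φ ∈ S.aut := by
  have h1 : ∀ x, φ * S.symmetry x = S.symmetry (φ x) * φ := fun x ↦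
    Diffeomorph.ext fun y ↦ hφ x y
  refine ⟨fun m ↦ ?_, h1⟩
  refine S.symm_induction (C := fun m ↦ S.PresAt φ m) ho (fun u m hm ↦ ?_) m
  -- This factorization carries preservation of the form from `m` to `s_u(m)`, because symmetries
  -- are symplectic; transitivity does the rest.
  have h2 : φ = S.symmetry (φ u) * (φ * S.symmetry u) := by
    rw [h1, ← mul_assoc]
    exact Diffeomorph.ext fun y ↦ (S.involutive (φ u) (φ y)).symm
  rw [h2]
  refine (presAt_symmetry _ _).mul (PresAt.mul ?_ (presAt_symmetry _ _))
  rwa [symmetry_apply, S.involutive]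

theorem symmetry_mem_aut (x : M) : S.symmetry x ∈ S.aut :=
  ⟨S.symplectic x, fun y ↦ Diffeomorph.ext fun z ↦ isHom_s x y z⟩

namespace NormalChart

variable {o : M} (N : S.NormalChart o)

/-- The linear parts of the automorphisms fixing `o`. -/
def isotropy : Set (E →L[ℝ] E) := {A | ∃ g : S.aut, N.Lin (g : Diffeo E M) A}

variable {N} {φ : M → M} {A : E →L[ℝ] E}

theorem Lin.hasMFDerivAt (h : N.Lin φ A) : HasMFDerivAt 𝓘(ℝ, E) 𝓘(ℝ, E) φ o
    (((mfderiv 𝓘(ℝ, E) 𝓘(ℝ, E) N.c.symm 0 : E →L[ℝ] E) ∘L A) ∘L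
      (mfderiv 𝓘(ℝ, E) 𝓘(ℝ, E) N.c o : E →L[ℝ] E)) := by
  have h1 : HasMFDerivAt 𝓘(ℝ, E) 𝓘(ℝ, E) N.c o (mfderiv 𝓘(ℝ, E) 𝓘(ℝ, E) N.c o) :=
    ((N.contMDiffAt_c N.mem_source).mdifferentiableAt (by simp)).hasMFDerivAt
  have h2 : HasMFDerivAt 𝓘(ℝ, E) 𝓘(ℝ, E) A (N.c o) A := A.hasMFDerivAt
  have h3 : HasMFDerivAt 𝓘(ℝ, E) 𝓘(ℝ, E) N.c.symm (A (N.c o))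
      (mfderiv 𝓘(ℝ, E) 𝓘(ℝ, E) N.c.symm 0 : E →L[ℝ] E) := by
    rw [N.map_base, map_zero]
    exact ((N.contMDiffAt_symm (by simpa using N.r_pos)).mdifferentiableAt (by simp)).hasMFDerivAt
  refine (HasMFDerivAt.comp o (HasMFDerivAt.comp (N.c o) h3 h2) h1).congr_of_eventuallyEq ?_
  filter_upwards [N.tendsto_c.eventually h, N.c.open_source.mem_nhds N.mem_source] with m h1 h2
  rw [N.c.left_inv h2] at h1
  exact h1

/-- Since `φ` fixes `o`, the condition becomes an equation between continuous functions of the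
linear part, and so passes to limits. -/
theorem Lin.presAt_iff {φ : Diffeo E M} (h : N.Lin φ A) : S.PresAt φ o ↔
    ∀ v w : E, (S.Ω.form o : E →L[ℝ] E →L[ℝ] ℝ)
      ((mfderiv 𝓘(ℝ, E) 𝓘(ℝ, E) N.c.symm 0 : E →L[ℝ] E) (A
        ((mfderiv 𝓘(ℝ, E) 𝓘(ℝ, E) N.c o : E →L[ℝ] E) v)))
      ((mfderiv 𝓘(ℝ, E) 𝓘(ℝ, E) N.c.symm 0 : E →L[ℝ] E) (A
        ((mfderiv 𝓘(ℝ, E) 𝓘(ℝ, E) N.c o : E →L[ℝ] E) w))) =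
      (S.Ω.form o : E →L[ℝ] E →L[ℝ] ℝ) v w := by
  have h1 : ∀ p : M, p = o → ∀ v w : E, (S.Ω.form p : E →L[ℝ] E →L[ℝ] ℝ) v w =
      (S.Ω.form o : E →L[ℝ] E →L[ℝ] ℝ) v w := by
    rintro p rfl v w; rfl
  have h2 : (mfderiv 𝓘(ℝ, E) 𝓘(ℝ, E) φ o : E →L[ℝ] E) = _ := h.hasMFDerivAt.mfderiv
  have h3 : ∀ v : E, (mfderiv 𝓘(ℝ, E) 𝓘(ℝ, E) φ o : E →L[ℝ] E) v =
      (mfderiv 𝓘(ℝ, E) 𝓘(ℝ, E) N.c.symm 0 : E →L[ℝ] E) (A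
        ((mfderiv 𝓘(ℝ, E) 𝓘(ℝ, E) N.c o : E →L[ℝ] E) v)) := fun v ↦ by rw [h2]; rfl
  have h4 : ∀ v w : E, (S.Ω.form (φ o) : E →L[ℝ] E →L[ℝ] ℝ)
      ((mfderiv 𝓘(ℝ, E) 𝓘(ℝ, E) φ o : E →L[ℝ] E) v)
      ((mfderiv 𝓘(ℝ, E) 𝓘(ℝ, E) φ o : E →L[ℝ] E) w) = _ := fun v w ↦ h1 (φ o) h.base _ _
  constructor
  · intro hp v w
    rw [← h3, ← h3, ← h4]
    exact hp v w
  · intro hp v w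
    refine (h4 v w).trans ?_
    exact (congrArg₂ (fun a b : E ↦ (S.Ω.form o : E →L[ℝ] E →L[ℝ] ℝ) a b) (h3 v) (h3 w)).trans
      (hp v w)

theorem Lin.exists_inv {g : S.aut} (h : N.Lin (g : Diffeo E M) A) :
    ∃ B : E →L[ℝ] E, N.Lin ((g⁻¹ : S.aut) : Diffeo E M) B ∧ B * A = 1 ∧ A * B = 1 := by
  have ho : ((g⁻¹ : S.aut) : Diffeo E M) o = o := by
    have := inv_apply_self (g : Diffeo E M) o
    rwa [h.base] at this
  obtain ⟨B, hB⟩ := N.linear _ (isHom_aut g⁻¹) ho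
    ((g⁻¹ : S.aut) : Diffeo E M).contMDiff.contMDiffAt
  refine ⟨B, hB, ?_, ?_⟩
  · refine (Lin.comp hB h).unique (B := 1) ?_
    convert lin_id (N := N) using 1
    funext x; exact inv_apply_self (g : Diffeo E M) x
  · refine (Lin.comp h hB).unique (B := 1) ?_
    convert lin_id (N := N) using 1
    funext x; exact apply_inv_self (g : Diffeo E M) x

/-- Automorphisms whose linear parts converge to an invertible map converge locally uniformly to a
smooth map. -/
theorem exists_limit [CompleteSpace E] [ConnectedSpace M] [T2Space M] {g : ℕ → S.aut}
    {A B : ℕ → E →L[ℝ] E} (hg : ∀ n, N.Lin (g n : Diffeo E M) (A n))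
    (hB : ∀ n, N.Lin ((g n)⁻¹ : S.aut) (B n)) {a b : E →L[ℝ] E}
    (hA : Tendsto A atTop (𝓝 a)) (hBb : Tendsto B atTop (𝓝 b)) (hba : b * a = 1) :
    ∃ φ : M → M, ContMDiff 𝓘(ℝ, E) 𝓘(ℝ, E) ∞ φ ∧
      ∀ m, Tendsto (fun p : ℕ × M ↦ (g p.1 : Diffeo E M) p.2) (atTop ×ˢ 𝓝 m) (𝓝 (φ m)) := by
  have key : ∀ m : M, ∃ (O : Set M) (ψ : M → M), IsOpen O ∧ m ∈ O ∧
      ContMDiffOn 𝓘(ℝ, E) 𝓘(ℝ, E) ∞ ψ O ∧ ∀ m' ∈ O,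
      Tendsto (fun p : ℕ × M ↦ (g p.1 : Diffeo E M) p.2) (atTop ×ˢ 𝓝 m') (𝓝 (ψ m')) := by
    intro m
    obtain ⟨F, W, hW, hm, hF, hφ⟩ := N.exists_local_extension m
    obtain ⟨U, V, hU, hV, h1U, hmV, hUV⟩ := isOpen_prod_iff.1 hW 1 m hm
    have h1 : Tendsto (fun n ↦ B n * a) atTop (𝓝 1) := by
      rw [← hba]; exact hBb.mul_const a
    -- The limit `a` need not be near `1`, but `B k * a` is for large `k`, since `b * a = 1`. Hence
    -- `g n = g k (g k⁻¹ g n)`, where the second factor has linear part in the domain of the local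
    -- extension.
    obtain ⟨k, hk⟩ : ∃ k, B k * a ∈ U := (h1.eventually (hU.mem_nhds h1U)).exists
    have h2 : Tendsto (fun n ↦ B k * A n) atTop (𝓝 (B k * a)) := hA.const_mul (B k)
    have h3 : ∀ᶠ n in atTop, B k * A n ∈ U := h2.eventually (hU.mem_nhds hk)
    refine ⟨V, fun m' ↦ (g k : Diffeo E M) (F (B k * a, m')), hV, hmV, ?_, ?_⟩
    · exact (g k : Diffeo E M).contMDiff.comp_contMDiffOn (hF.comp
        (contMDiff_const.prodMk contMDiff_id).contMDiffOn fun m' hm' ↦ hUV ⟨hk, hm'⟩)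
    · intro m' hm'
      have h4 : ContinuousAt F (B k * a, m') :=
        (hF.contMDiffAt (hW.mem_nhds (hUV ⟨hk, hm'⟩))).continuousAt
      have h5 : Tendsto (fun p : ℕ × M ↦ (B k * A p.1, p.2)) (atTop ×ˢ 𝓝 m')
          (𝓝 (B k * a, m')) := by
        rw [nhds_prod_eq]
        exact (h2.comp tendsto_fst).prodMk tendsto_snd
      have h6 := ((g k : Diffeo E M).continuous.tendsto _).comp (h4.tendsto.comp h5)
      refine h6.congr' ?_
      filter_upwards [h3.prod_mk (hV.mem_nhds hm')] with p hp
      have h7 := hφ _ _ (hUV hp) _ ((isHom_aut (g k)⁻¹).comp (isHom_aut (g p.1)))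
        ((hB k).comp (hg p.1))
      change (g k : Diffeo E M) (F (B k * A p.1, p.2)) = _
      rw [← h7]
      exact apply_inv_self (g k : Diffeo E M) _
  -- The smooth local limits agree wherever they overlap because limits in a Hausdorff space are
  -- unique, so they glue.
  choose O ψ hO hmO hψ hlim using key
  refine ⟨fun m ↦ ψ m m, fun m ↦ ?_, fun m ↦ hlim m m (hmO m)⟩
  refine ((hψ m).contMDiffAt ((hO m).mem_nhds (hmO m))).congr_of_eventuallyEq ?_
  filter_upwards [(hO m).mem_nhds (hmO m)] with m' hm'
  exact tendsto_nhds_unique (hlim m' m' (hmO m')) (hlim m m' hm')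

theorem continuous_bilin_comp_apply (f : E →L[ℝ] E →L[ℝ] ℝ) (D : E →L[ℝ] E) (x y : E) :
    Continuous fun a : E →L[ℝ] E ↦ f (D (a x)) (D (a y)) := by
  have h2 (x : E) : Continuous fun a : E →L[ℝ] E ↦ D (a x) :=
    D.continuous.comp (ContinuousLinearMap.apply ℝ E x).continuous
  exact (f.continuous.comp (h2 _)).clm_apply (h2 _)

/-- The automorphisms and their inverses both converge to smooth maps. Since the convergence is
joint in the index and the point, the limits are mutually inverse; compatibility with `s`, the
linear part and the form at `o` pass to the limit. -/
theorem mem_isotropy_of_tendsto [CompleteSpace E] [ConnectedSpace M] [T2Space M]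
    {A : ℕ → E →L[ℝ] E} (hAK : ∀ n, A n ∈ N.isotropy) {a b : E →L[ℝ] E}
    (hA : Tendsto A atTop (𝓝 a)) (hab : a * b = 1) (hba : b * a = 1) : a ∈ N.isotropy := by
  choose g hg using hAK
  choose B hB hBA hAB using fun n ↦ (hg n).exists_inv
  have hBb : Tendsto B atTop (𝓝 b) := by
    have h1 := (NormedRing.inverse_continuousAt (⟨a, b, hab, hba⟩ : (E →L[ℝ] E)ˣ)).tendsto.comp hA
    have h2 : Ring.inverse a = b := Ring.inverse_unit (⟨a, b, hab, hba⟩ : (E →L[ℝ] E)ˣ)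
    have h3 : ∀ n, Ring.inverse (A n) = B n := fun n ↦
      Ring.inverse_unit (⟨A n, B n, hAB n, hBA n⟩ : (E →L[ℝ] E)ˣ)
    change Tendsto (fun n ↦ Ring.inverse (A n)) atTop (𝓝 (Ring.inverse a)) at h1
    rw [h2] at h1
    simpa only [h3] using h1
  obtain ⟨φ, hφ, hφl⟩ := exists_limit hg hB hA hBb hba
  obtain ⟨φ', hφ', hφl'⟩ := exists_limit (g := fun n ↦ (g n)⁻¹) hB
    (by simpa only [inv_inv] using hg) hBb hA hab
  have hpt : ∀ m, Tendsto (fun n ↦ (g n : Diffeo E M) m) atTop (𝓝 (φ m)) := fun m ↦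
    (hφl m).comp (tendsto_id.prodMk tendsto_const_nhds : Tendsto (fun n : ℕ ↦ (n, m)) atTop _)
  have hpt' : ∀ m, Tendsto (fun n ↦ ((g n)⁻¹ : Diffeo E M) m) atTop (𝓝 (φ' m)) := fun m ↦
    (hφl' m).comp (tendsto_id.prodMk tendsto_const_nhds : Tendsto (fun n : ℕ ↦ (n, m)) atTop _)
  have hinv : ∀ m, φ' (φ m) = m := fun m ↦ by
    have h1 := (hφl' (φ m)).comp (tendsto_id.prodMk (hpt m))
    refine tendsto_nhds_unique h1 ((tendsto_const_nhds (x := m)).congr fun n ↦ ?_)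
    exact (inv_apply_self (g n : Diffeo E M) m).symm
  have hinv' : ∀ m, φ (φ' m) = m := fun m ↦ by
    have h1 := (hφl (φ' m)).comp (tendsto_id.prodMk (hpt' m))
    refine tendsto_nhds_unique h1 ((tendsto_const_nhds (x := m)).congr fun n ↦ ?_)
    exact (apply_inv_self (g n : Diffeo E M) m).symm
  have hhom : S.IsHom φ := fun x y ↦ by
    have h1 := (S.smooth.continuous.tendsto (φ x, φ y)).comp ((hpt x).prodMk_nhds (hpt y))
    exact tendsto_nhds_unique (hpt (S.s x y)) (h1.congr fun n ↦ (isHom_aut (g n) x y).symm)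
  have hlin : N.Lin φ a := by
    filter_upwards [N.c.open_target.mem_nhds N.zero_mem_target,
      eventually_norm_clm_lt a N.r_pos] with v hv hav
    have h1 : Tendsto (fun n ↦ A n v) atTop (𝓝 (a v)) :=
      ((ContinuousLinearMap.apply ℝ E v).continuous.tendsto a).comp hA
    have h2 := (N.c.continuousAt_symm (N.mem_target hav)).tendsto.comp h1
    refine tendsto_nhds_unique (hpt (N.c.symm v)) (h2.congr' ?_)
    have h3 : ∀ᶠ n in atTop, ‖A n v‖ < N.r := h1.norm.eventually (gt_mem_nhds hav)
    filter_upwards [h3] with n hn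
    exact ((hg n).full (isHom_aut (g n)) (N.norm_lt hv) hn).symm
  let Φ : Diffeo E M := ⟨⟨φ, φ', hinv, hinv'⟩, hφ, hφ'⟩
  have hΦ : N.Lin Φ a := hlin
  refine ⟨⟨Φ, mem_aut_of_isHom_of_presAt hhom (hΦ.presAt_iff.2 fun v w ↦ ?_)⟩, hlin⟩
  have h1 : Tendsto (fun n ↦ (S.Ω.form o : E →L[ℝ] E →L[ℝ] ℝ)
      ((mfderiv 𝓘(ℝ, E) 𝓘(ℝ, E) N.c.symm 0 : E →L[ℝ] E) (A n
        ((mfderiv 𝓘(ℝ, E) 𝓘(ℝ, E) N.c o : E →L[ℝ] E) v)))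
      ((mfderiv 𝓘(ℝ, E) 𝓘(ℝ, E) N.c.symm 0 : E →L[ℝ] E) (A n
        ((mfderiv 𝓘(ℝ, E) 𝓘(ℝ, E) N.c o : E →L[ℝ] E) w)))) atTop (𝓝
      ((S.Ω.form o : E →L[ℝ] E →L[ℝ] ℝ)
      ((mfderiv 𝓘(ℝ, E) 𝓘(ℝ, E) N.c.symm 0 : E →L[ℝ] E) (a
        ((mfderiv 𝓘(ℝ, E) 𝓘(ℝ, E) N.c o : E →L[ℝ] E) v)))
      ((mfderiv 𝓘(ℝ, E) 𝓘(ℝ, E) N.c.symm 0 : E →L[ℝ] E) (a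
        ((mfderiv 𝓘(ℝ, E) 𝓘(ℝ, E) N.c o : E →L[ℝ] E) w))))) := by
    refine Tendsto.comp (g := fun a : E →L[ℝ] E ↦ (S.Ω.form o : E →L[ℝ] E →L[ℝ] ℝ)
      ((mfderiv 𝓘(ℝ, E) 𝓘(ℝ, E) N.c.symm 0 : E →L[ℝ] E) (a
        ((mfderiv 𝓘(ℝ, E) 𝓘(ℝ, E) N.c o : E →L[ℝ] E) v)))
      ((mfderiv 𝓘(ℝ, E) 𝓘(ℝ, E) N.c.symm 0 : E →L[ℝ] E) (a
        ((mfderiv 𝓘(ℝ, E) 𝓘(ℝ, E) N.c o : E →L[ℝ] E) w)))) (Continuous.tendsto ?_ a) hA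
    exact continuous_bilin_comp_apply _ _ _ _
  refine tendsto_nhds_unique h1 (tendsto_const_nhds.congr fun n ↦ ?_)
  exact ((hg n).presAt_iff.1 ((g n).2.1 o) v w).symm

/-- Exponentials are invertible with known inverse. This is why closedness is asked only there: a
limit of isotropy operators in the full algebra might be singular. -/
theorem isExpClosedSubgroup_isotropy [FiniteDimensional ℝ E] [ConnectedSpace M] [T2Space M]
    (N : S.NormalChart o) : IsExpClosedSubgroup N.isotropy where
  one_mem := ⟨1, lin_id⟩
  mul_mem := by
    rintro A B ⟨g, hg⟩ ⟨h, hh⟩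
    exact ⟨g * h, hg.comp hh⟩
  exp_neg_mem := by
    rintro X ⟨g, hg⟩
    obtain ⟨B, hB, hBA, hAB⟩ := hg.exists_inv
    refine ⟨g⁻¹, ?_⟩
    have h1 : NormedSpace.exp (-X) = B := by
      have h2 := expR_neg_mul X
      rw [← mul_one (NormedSpace.exp (-X)), ← hAB, ← mul_assoc, h2, one_mul]
    rwa [h1]
  exp_mem_of_mem_closure := by
    intro X hX
    obtain ⟨A, hA, hlim⟩ := mem_closure_iff_seq_limit.1 hX
    have : CompleteSpace E := FiniteDimensional.complete ℝ E
    exact mem_isotropy_of_tendsto hA hlim (expR_mul_neg X) (expR_neg_mul X)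

end NormalChart

end SymplecticSymmetricSpace

end SymplecticSymmetric

/-! ### Topology of the automorphism group, transvections, smooth dependence -/

namespace SymplecticSymmetric

namespace SymplecticSymmetricSpace

open Filter Metric

variable {E : Type*} [NormedAddCommGroup E] [NormedSpace ℝ E]
  {M : Type*} [TopologicalSpace M] [ChartedSpace E M] [IsManifold 𝓘(ℝ, E) ∞ M]
  {S : SymplecticSymmetricSpace E M}

section Topology

variable {X : Type*} [TopologicalSpace X]

theorem continuous_eval_aut [LocallyCompactSpace M] :
    Continuous (fun p : S.aut × M ↦ (p.1 : Diffeo E M) p.2) := by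
  have h : Continuous fun g : S.aut ↦ (⟨(g : Diffeo E M), (g : Diffeo E M).continuous⟩ : C(M, M)) :=
    Continuous.comp (g := fun φ : Diffeo E M ↦ (⟨φ, φ.continuous⟩ : C(M, M)))
      continuous_induced_dom continuous_subtype_val
  exact (h.comp continuous_fst).eval continuous_snd

/-- Joint continuity of the evaluation at `x` and every point gives, by a tube argument over a
compact set, continuity for the compact-open topology. -/
theorem continuousAt_aut {f : X → S.aut} {x : X}
    (h : ∀ m, ContinuousAt (fun p : X × M ↦ (f p.1 : Diffeo E M) p.2) (x, m)) :
    ContinuousAt f x := by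
  have hi : Topology.IsInducing (fun g : S.aut ↦
      (⟨(g : Diffeo E M), (g : Diffeo E M).continuous⟩ : C(M, M))) :=
    Topology.IsInducing.comp (g := fun φ : Diffeo E M ↦ (⟨φ, φ.continuous⟩ : C(M, M))) ⟨rfl⟩
      Topology.IsInducing.subtypeVal
  rw [hi.continuousAt_iff, ContinuousAt, ContinuousMap.tendsto_nhds_compactOpen]
  intro K hK U hU hKU
  exact hK.eventually_forall_of_forall_eventually
    (P := fun x m ↦ (f x : Diffeo E M) m ∈ U) fun m hm ↦ h m (hU.mem_nhds (hKU hm))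

/-- Left translation. -/
noncomputable def mulLeftHomeo [LocallyCompactSpace M] (g : S.aut) : S.aut ≃ₜ S.aut where
  toEquiv := Equiv.mulLeft g
  continuous_toFun := continuous_iff_continuousAt.2 fun _ ↦ continuousAt_aut fun _ ↦
    ((g : Diffeo E M).continuous.comp continuous_eval_aut).continuousAt
  continuous_invFun := continuous_iff_continuousAt.2 fun _ ↦ continuousAt_aut fun _ ↦
    (((g⁻¹ : S.aut) : Diffeo E M).continuous.comp continuous_eval_aut).continuousAt

end Topology

namespace NormalChart

variable {o : M} (N : S.NormalChart o)

section LinearPart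

variable {N} {X : Type*} [TopologicalSpace X] {k : X → M → M} {A : X → E →L[ℝ] E} {x₀ : X}

/-- Needed before any continuity of `A` is available: a ball of vectors, uniform in `x`, which all
`A x` keep inside the normal chart. -/
theorem eventually_lin_of_continuousAt (hk : ContinuousAt (fun p : X × M ↦ k p.1 p.2) (x₀, o))
    (hl : ∀ᶠ x in 𝓝 x₀, S.IsHom (k x) ∧ N.Lin (k x) (A x)) :
    ∃ δ > 0, ∀ᶠ x in 𝓝 x₀, ∀ v, ‖v‖ < δ →
      ‖A x v‖ < N.r ∧ k x (N.c.symm v) = N.c.symm (A x v) := by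
  have hb : k x₀ o = o := hl.self_of_nhds.2.base
  have h1 : ∀ᶠ m in 𝓝 o, ‖N.c m‖ < N.r / 2 := by
    have := N.tendsto_c.norm
    rw [norm_zero] at this
    exact this.eventually (gt_mem_nhds (half_pos N.r_pos))
  have h2 : ∀ᶠ p : X × M in 𝓝 x₀ ×ˢ 𝓝 o, ‖N.c (k p.1 p.2)‖ < N.r / 2 := by
    rw [← nhds_prod_eq]
    have := hk.tendsto
    change Tendsto _ _ (𝓝 (k x₀ o)) at this
    rw [hb] at this
    exact this.eventually h1
  obtain ⟨P, hP, Q, hQ, hPQ⟩ := eventually_prod_iff.1 h2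
  obtain ⟨δ, hδ, hδQ⟩ := Metric.eventually_nhds_iff_ball.1 (N.tendsto_symm.eventually hQ)
  refine ⟨min δ N.r, lt_min hδ N.r_pos, ?_⟩
  filter_upwards [hP, hl] with x hx hlx v hv
  have hvδ : ‖v‖ < δ := hv.trans_le (min_le_left _ _)
  have hvr : ‖v‖ < N.r := hv.trans_le (min_le_right _ _)
  have hA : ‖A x v‖ < N.r := by
    by_contra! hcon
    have hpos : 0 < ‖A x v‖ := N.r_pos.trans_le hcon
    -- If `A x v` left the chart, a multiple of `v` would have image of norm exactly `3r/4`. That is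
    -- inside the chart, yet beyond the bound `r/2` which continuity of `k` imposes on images of
    -- small vectors.
    set t : ℝ := 3 * N.r / 4 / ‖A x v‖ with ht
    have ht0 : 0 ≤ t := by have := N.r_pos; positivity
    have ht1 : t ≤ 1 := by
      rw [ht, div_le_one hpos]; linarith [N.r_pos]
    have htA : ‖A x (t • v)‖ = 3 * N.r / 4 := by
      rw [map_smul, norm_smul, Real.norm_of_nonneg ht0, ht, div_mul_cancel₀ _ hpos.ne']
    have htv : ‖t • v‖ ≤ ‖v‖ := by
      rw [norm_smul, Real.norm_of_nonneg ht0]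
      exact mul_le_of_le_one_left (norm_nonneg _) ht1
    have hlt : ‖A x (t • v)‖ < N.r := by rw [htA]; linarith [N.r_pos]
    have h3 := hlx.2.full hlx.1 (htv.trans_lt hvr) hlt
    have h4 := hPQ hx (hδQ (t • v) (by rw [mem_ball_zero_iff]; exact htv.trans_lt hvδ))
    dsimp only at h4
    rw [h3, N.c.right_inv (N.mem_target hlt), htA] at h4
    linarith [N.r_pos]
  exact ⟨hA, hlx.2.full hlx.1 hvr hA⟩

/-- `A x v` is read off from the motion of a single point of `M`, chosen independently of `x`, so
`A` inherits the regularity of the evaluation map. -/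
theorem eventually_apply_eq (hk : ContinuousAt (fun p : X × M ↦ k p.1 p.2) (x₀, o))
    (hl : ∀ᶠ x in 𝓝 x₀, S.IsHom (k x) ∧ N.Lin (k x) (A x)) (v : E) :
    ∃ t : ℝ, k x₀ (N.c.symm (t • v)) ∈ N.c.source ∧
      ∀ᶠ x in 𝓝 x₀, A x v = t⁻¹ • N.c (k x (N.c.symm (t • v))) := by
  obtain ⟨δ, hδ, h⟩ := eventually_lin_of_continuousAt hk hl
  set t : ℝ := δ / (2 * (‖v‖ + 1)) with ht
  have ht0 : 0 < t := by positivity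
  have htv : ‖t • v‖ < δ := by
    rw [norm_smul, Real.norm_of_nonneg ht0.le, ht, div_mul_eq_mul_div, div_lt_iff₀ (by positivity)]
    nlinarith [norm_nonneg v]
  refine ⟨t, ?_, ?_⟩
  · obtain ⟨h1, h2⟩ := h.self_of_nhds _ htv
    rw [h2]; exact N.c.map_target (N.mem_target h1)
  · filter_upwards [h] with x hx
    obtain ⟨h1, h2⟩ := hx _ htv
    rw [h2, N.c.right_inv (N.mem_target h1), map_smul, inv_smul_smul₀ ht0.ne']

variable [FiniteDimensional ℝ E]

variable (E) in
/-- The endomorphism with given values on a basis. -/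
noncomputable def clmOfBasis : (Fin (Module.finrank ℝ E) → E) →L[ℝ] (E →L[ℝ] E) :=
  ∑ i, (ContinuousLinearMap.smulRightL ℝ E E (coordCLM E i)) ∘L
    ContinuousLinearMap.proj i

theorem clmOfBasis_apply (L : E →L[ℝ] E) :
    clmOfBasis E (fun i ↦ L (Module.finBasis ℝ E i)) = L := by
  conv_rhs => rw [clm_eq_sum_smulRight L]
  simp [clmOfBasis]

theorem continuousAt_linearPart
    (hk : ∀ m, ContinuousAt (fun p : X × M ↦ k p.1 p.2) (x₀, m))
    (hl : ∀ᶠ x in 𝓝 x₀, S.IsHom (k x) ∧ N.Lin (k x) (A x)) : ContinuousAt A x₀ := by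
  have h1 : A = fun x ↦ clmOfBasis E (fun i ↦ A x (Module.finBasis ℝ E i)) :=
    funext fun x ↦ (clmOfBasis_apply (A x)).symm
  rw [h1]
  refine (clmOfBasis E).continuous.continuousAt.comp (continuousAt_pi.2 fun i ↦ ?_)
  obtain ⟨t, ht, h2⟩ := eventually_apply_eq (hk o) hl (Module.finBasis ℝ E i)
  refine ContinuousAt.congr_of_eventuallyEq ?_ h2
  have h3 : ContinuousAt (fun x ↦ k x (N.c.symm (t • Module.finBasis ℝ E i))) x₀ :=
    ContinuousAt.comp_of_eq (hk _)
      (Continuous.continuousAt (f := fun x ↦ (x, N.c.symm (t • Module.finBasis ℝ E i)))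
        (by fun_prop)) rfl
  exact (ContinuousAt.comp_of_eq (N.c.continuousAt ht) h3 rfl).const_smul t⁻¹

variable {F H : Type*} [NormedAddCommGroup F] [NormedSpace ℝ F] [TopologicalSpace H]
  {J : ModelWithCorners ℝ F H} [ChartedSpace H X]

theorem contMDiffAt_linearPart
    (hk : ∀ m, ContMDiffAt (J.prod 𝓘(ℝ, E)) 𝓘(ℝ, E) ∞ (fun p : X × M ↦ k p.1 p.2) (x₀, m))
    (hl : ∀ᶠ x in 𝓝 x₀, S.IsHom (k x) ∧ N.Lin (k x) (A x)) :
    ContMDiffAt J 𝓘(ℝ, E →L[ℝ] E) ∞ A x₀ := by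
  have h1 : A = fun x ↦ clmOfBasis E (fun i ↦ A x (Module.finBasis ℝ E i)) :=
    funext fun x ↦ (clmOfBasis_apply (A x)).symm
  rw [h1]
  refine (clmOfBasis E).contMDiff.contMDiffAt.comp x₀ (contMDiffAt_pi_space.2 fun i ↦ ?_)
  obtain ⟨t, ht, h2⟩ := eventually_apply_eq (hk o).continuousAt hl (Module.finBasis ℝ E i)
  refine ContMDiffAt.congr_of_eventuallyEq ?_ h2
  have h3 : ContMDiffAt J 𝓘(ℝ, E) ∞ (fun x ↦ k x (N.c.symm (t • Module.finBasis ℝ E i))) x₀ :=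
    ContMDiffAt.comp_of_eq (hk _) (contMDiffAt_id.prodMk contMDiffAt_const) rfl
  exact ContMDiffAt.comp_of_eq (contDiff_const_smul t⁻¹).contMDiff.contMDiffAt
    (ContMDiffAt.comp_of_eq (N.contMDiffAt_c ht) h3 rfl) rfl

end LinearPart

/-- An automorphism which maps `o` to the point with normal coordinates `v`. -/
noncomputable def transvection (v : E) : S.aut :=
  ⟨S.symmetry (N.c.symm ((2⁻¹ : ℝ) • v)) * S.symmetry o,
    mul_mem (symmetry_mem_aut _) (symmetry_mem_aut _)⟩

theorem transvection_apply (v : E) (m : M) : (N.transvection v : Diffeo E M) m =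
    S.s (N.c.symm ((2⁻¹ : ℝ) • v)) (S.s o m) := rfl

theorem transvection_inv_apply (v : E) (m : M) : ((N.transvection v)⁻¹ : Diffeo E M) m =
    S.s o (S.s (N.c.symm ((2⁻¹ : ℝ) • v)) m) := rfl

theorem transvection_base {v : E} (hv : ‖v‖ < N.r) :
    (N.transvection v : Diffeo E M) o = N.c.symm v := by
  rw [N.transvection_apply, S.fixed, N.double' hv]

theorem transvection_inv_base {v : E} (hv : ‖v‖ < N.r) :
    ((N.transvection v)⁻¹ : Diffeo E M) (N.c.symm v) = o := by
  rw [N.transvection_inv_apply, ← N.double' hv, S.involutive, S.fixed]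

section Smooth

variable {F H : Type*} [NormedAddCommGroup F] [NormedSpace ℝ F] [TopologicalSpace H]
  {J : ModelWithCorners ℝ F H} {X : Type*} [TopologicalSpace X] [ChartedSpace H X]

theorem _root_.SymplecticSymmetric.SymplecticSymmetricSpace.contMDiffAt_s
    {f g : X → M} {x : X} (hf : ContMDiffAt J 𝓘(ℝ, E) ∞ f x) (hg : ContMDiffAt J 𝓘(ℝ, E) ∞ g x) :
    ContMDiffAt J 𝓘(ℝ, E) ∞ (fun x ↦ S.s (f x) (g x)) x :=
  ContMDiffAt.comp_of_eq S.smooth.contMDiffAt (hf.prodMk hg) rfl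

theorem contMDiffAt_symm_half {v : X → E} {x : X} (hv : ContMDiffAt J 𝓘(ℝ, E) ∞ v x)
    (hx : ‖v x‖ < N.r) :
    ContMDiffAt J 𝓘(ℝ, E) ∞ (fun x ↦ N.c.symm ((2⁻¹ : ℝ) • v x)) x :=
  ContMDiffAt.comp_of_eq (N.contMDiffAt_symm (N.norm_half_lt hx))
    (ContMDiffAt.comp_of_eq (contDiff_const_smul (2⁻¹ : ℝ)).contMDiff.contMDiffAt hv rfl) rfl

theorem contMDiffAt_transvection {v : X → E} {f : X → M} {x : X}
    (hv : ContMDiffAt J 𝓘(ℝ, E) ∞ v x) (hx : ‖v x‖ < N.r) (hf : ContMDiffAt J 𝓘(ℝ, E) ∞ f x) :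
    ContMDiffAt J 𝓘(ℝ, E) ∞ (fun x ↦ (N.transvection (v x) : Diffeo E M) (f x)) x :=
  contMDiffAt_s (N.contMDiffAt_symm_half hv hx) (contMDiffAt_s contMDiffAt_const hf)

theorem contMDiffAt_transvection_inv {v : X → E} {f : X → M} {x : X}
    (hv : ContMDiffAt J 𝓘(ℝ, E) ∞ v x) (hx : ‖v x‖ < N.r) (hf : ContMDiffAt J 𝓘(ℝ, E) ∞ f x) :
    ContMDiffAt J 𝓘(ℝ, E) ∞ (fun x ↦ ((N.transvection (v x))⁻¹ : Diffeo E M) (f x)) x :=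
  contMDiffAt_s contMDiffAt_const (contMDiffAt_s (N.contMDiffAt_symm_half hv hx) hf)

end Smooth

/-- `g` corrected by a transvection, so that it fixes `o`. -/
noncomputable def correction (g : S.aut) : S.aut := (N.transvection (N.c ((g : Diffeo E M) o)))⁻¹ * g

variable {N} in
theorem exists_lin_correction {g : S.aut} (hg : (g : Diffeo E M) o ∈ N.c.source) :
    ∃ A, N.Lin (N.correction g : Diffeo E M) A := by
  refine N.linear _ (isHom_aut _) ?_ (N.correction g : Diffeo E M).contMDiff.contMDiffAt
  have h := N.transvection_inv_base (N.norm_lt (N.c.map_source hg))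
  rwa [N.c.left_inv hg] at h

open Classical in
/-- The linear part of the correction of `g`. -/
noncomputable def linPart (g : S.aut) : E →L[ℝ] E :=
  if h : ∃ A, N.Lin (N.correction g : Diffeo E M) A then h.choose else 0

variable {N}

theorem lin_linPart {g : S.aut} (hg : (g : Diffeo E M) o ∈ N.c.source) :
    N.Lin (N.correction g : Diffeo E M) (N.linPart g) := by
  rw [linPart, dif_pos (exists_lin_correction hg)]
  exact (exists_lin_correction hg).choose_spec

theorem linPart_mem {g : S.aut} (hg : (g : Diffeo E M) o ∈ N.c.source) :
    N.linPart g ∈ N.isotropy := ⟨_, lin_linPart hg⟩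

theorem transvection_mul_correction (g : S.aut) :
    N.transvection (N.c ((g : Diffeo E M) o)) * N.correction g = g := mul_inv_cancel_left _ _

theorem Lin.ext_aut [CompleteSpace E] [ConnectedSpace M] {g h : S.aut} {A : E →L[ℝ] E}
    (hg : N.Lin (g : Diffeo E M) A) (hh : N.Lin (h : Diffeo E M) A) : g = h :=
  Subtype.ext (Diffeomorph.ext fun m ↦ congrFun (hg.ext hh (isHom_aut g) (isHom_aut h)) m)

section Exp

variable [FiniteDimensional ℝ E] [ConnectedSpace M] [T2Space M]

variable (N) in
/-- The Lie algebra of the isotropy group. -/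
noncomputable abbrev isotropyAlgebra : Submodule ℝ (E →L[ℝ] E) := N.isExpClosedSubgroup_isotropy.lieSubmodule

/-- The exponential map of the isotropy group. -/
noncomputable def isotropyExp (Y : N.isotropyAlgebra) : S.aut :=
  (N.isExpClosedSubgroup_isotropy.exp_mem Y.2).choose

theorem lin_isotropyExp (Y : N.isotropyAlgebra) :
    N.Lin (isotropyExp Y : Diffeo E M) (NormedSpace.exp (Y : E →L[ℝ] E)) :=
  (N.isExpClosedSubgroup_isotropy.exp_mem Y.2).choose_spec

theorem isotropyExp_inv (Y : N.isotropyAlgebra) : (isotropyExp Y)⁻¹ = isotropyExp (-Y) := by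
  have : CompleteSpace E := FiniteDimensional.complete ℝ E
  rw [inv_eq_iff_mul_eq_one]
  refine Lin.ext_aut (A := 1) (N := N) ?_ lin_id
  have h := (lin_isotropyExp Y).comp (lin_isotropyExp (-Y))
  rw [Submodule.coe_neg, expR_mul_neg] at h
  exact h

/-- Near `Y` the operator `exp(-Y) exp(Z)` is close to `1`, where local extensions are smooth in the
operator; left multiplication by the fixed automorphism of `Y` then gives that of `Z`. -/
theorem contMDiff_isotropyExp : ContMDiff (𝓘(ℝ, N.isotropyAlgebra).prod 𝓘(ℝ, E)) 𝓘(ℝ, E) ∞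
    (fun p : N.isotropyAlgebra × M ↦ (isotropyExp p.1 : Diffeo E M) p.2) := by
  have : CompleteSpace E := FiniteDimensional.complete ℝ E
  rintro ⟨Y, m⟩
  obtain ⟨F, W, hW, hm, hF, hφ⟩ := N.exists_local_extension m
  let h : N.isotropyAlgebra × M → (E →L[ℝ] E) × M := fun p ↦
    (NormedSpace.exp (-(Y : E →L[ℝ] E)) * NormedSpace.exp (p.1 : E →L[ℝ] E), p.2)
  have hh : ContMDiff (𝓘(ℝ, N.isotropyAlgebra).prod 𝓘(ℝ, E)) (𝓘(ℝ, E →L[ℝ] E).prod 𝓘(ℝ, E)) ∞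
      h := by
    have h1 : ContDiff ℝ ∞ fun Z : N.isotropyAlgebra ↦
        NormedSpace.exp (-(Y : E →L[ℝ] E)) * NormedSpace.exp (Z : E →L[ℝ] E) :=
      contDiff_const.mul (contDiff_expR.comp N.isotropyAlgebra.subtypeL.contDiff)
    exact (h1.contMDiff.comp contMDiff_fst).prodMk contMDiff_snd
  have h0 : h (Y, m) ∈ W := by simpa [h, expR_neg_mul] using hm
  have h1 : ContMDiffAt (𝓘(ℝ, N.isotropyAlgebra).prod 𝓘(ℝ, E)) 𝓘(ℝ, E) ∞
      (fun p ↦ (isotropyExp Y : Diffeo E M) (F (h p))) (Y, m) :=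
    ContMDiffAt.comp_of_eq (isotropyExp Y : Diffeo E M).contMDiff.contMDiffAt
      (ContMDiffAt.comp_of_eq (hF.contMDiffAt (hW.mem_nhds h0)) hh.contMDiffAt rfl) rfl
  refine h1.congr_of_eventuallyEq ?_
  filter_upwards [hh.continuous.continuousAt (hW.mem_nhds h0)] with p hp
  have h2 := (lin_isotropyExp (-Y)).comp (lin_isotropyExp p.1)
  rw [← hφ _ _ hp _ ((isHom_aut _).comp (isHom_aut _)) h2, ← isotropyExp_inv]
  exact (apply_inv_self (isotropyExp Y : Diffeo E M) _).symm

end Exp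

end NormalChart

end SymplecticSymmetricSpace

end SymplecticSymmetric

/-! ### Lie group structure on the automorphism group -/

namespace SymplecticSymmetric

namespace SymplecticSymmetricSpace

open Filter Metric

variable {E : Type*} [NormedAddCommGroup E] [NormedSpace ℝ E]
  {M : Type*} [TopologicalSpace M] [ChartedSpace E M] [IsManifold 𝓘(ℝ, E) ∞ M]
  {S : SymplecticSymmetricSpace E M} [FiniteDimensional ℝ E] [ConnectedSpace M] [T2Space M]

namespace NormalChart

variable {o : M} {N : S.NormalChart o}

theorem locallyCompactSpace_of_finiteDimensional (E : Type*) [NormedAddCommGroup E]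
    [NormedSpace ℝ E] [FiniteDimensional ℝ E] (M : Type*) [TopologicalSpace M] [ChartedSpace E M] :
    LocallyCompactSpace M :=
  Manifold.locallyCompact_of_finiteDimensional 𝓘(ℝ, E)

variable (N) in
/-- A chart of the automorphism group at `1`. -/
structure LieChart where
  /-- the chart -/
  e : OpenPartialHomeomorph S.aut (E × N.isotropyAlgebra)
  /-- the logarithm of the isotropy group -/
  L : (E →L[ℝ] E) → N.isotropyAlgebra
  /-- the domain of the logarithm -/
  W : Set (E →L[ℝ] E)
  isOpen_W : IsOpen W
  contDiffOn_L : ContDiffOn ℝ ∞ L W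
  one_mem : 1 ∈ e.source
  apply_eq : ∀ g, e g = (N.c ((g : Diffeo E M) o), L (N.linPart g))
  symm_apply_eq : ∀ p, e.symm p = N.transvection p.1 * isotropyExp p.2
  mem_of_mem_source : ∀ g ∈ e.source, (g : Diffeo E M) o ∈ N.c.source ∧ N.linPart g ∈ W
  norm_lt_of_mem_target : ∀ p ∈ e.target, ‖p.1‖ < N.r

omit [ConnectedSpace M] [T2Space M] in
theorem continuousAt_linPart {g : S.aut} (hg : (g : Diffeo E M) o ∈ N.c.source) :
    ContinuousAt N.linPart g := by
  have := locallyCompactSpace_of_finiteDimensional E M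
  have ho : Continuous fun g : S.aut ↦ (g : Diffeo E M) o :=
    continuous_eval_aut.comp (continuous_id.prodMk continuous_const)
  refine continuousAt_linearPart (N := N) (k := fun g ↦ (N.correction g : Diffeo E M)) (fun m ↦ ?_) ?_
  · have h1 : ContinuousAt (fun p : S.aut × M ↦
        N.c.symm ((2⁻¹ : ℝ) • N.c ((p.1 : Diffeo E M) o))) (g, m) := by
      have h2 : ContinuousAt (fun p : S.aut × M ↦ N.c ((p.1 : Diffeo E M) o)) (g, m) :=
        ContinuousAt.comp_of_eq (N.c.continuousAt hg) (ho.comp continuous_fst).continuousAt rfl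
      exact ContinuousAt.comp_of_eq (N.c.continuousAt_symm
        (N.mem_target (N.norm_half_lt (N.norm_lt (N.c.map_source hg))))) (h2.const_smul _) rfl
    have h3 : ContinuousAt (fun p : S.aut × M ↦
        S.s (N.c.symm ((2⁻¹ : ℝ) • N.c ((p.1 : Diffeo E M) o))) ((p.1 : Diffeo E M) p.2)) (g, m) :=
      ContinuousAt.comp_of_eq (g := fun p : M × M ↦ S.s p.1 p.2) S.smooth.continuous.continuousAt
        (h1.prodMk continuous_eval_aut.continuousAt) rfl
    exact (S.contMDiff_s o).continuous.continuousAt.comp h3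
  · filter_upwards [ho.continuousAt (N.c.open_source.mem_nhds hg)] with g' hg'
    exact ⟨isHom_aut _, lin_linPart hg'⟩

theorem transvection_mul_isotropyExp_base (Y : N.isotropyAlgebra) {v : E} (hv : ‖v‖ < N.r) :
    ((N.transvection v * isotropyExp Y : S.aut) : Diffeo E M) o = N.c.symm v := by
  rw [← N.transvection_base hv]
  exact congrArg (N.transvection v : Diffeo E M) (lin_isotropyExp Y).base

/-- The decomposition into a transvection and an element fixing `o` is unique: the image of `o`
determines the transvection. -/
theorem linPart_transvection_mul_isotropyExp (Y : N.isotropyAlgebra) {v : E} (hv : ‖v‖ < N.r) :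
    N.linPart (N.transvection v * isotropyExp Y) = NormedSpace.exp (Y : E →L[ℝ] E) := by
  have h1 := transvection_mul_isotropyExp_base Y hv
  have h2 := lin_linPart (N := N) (g := N.transvection v * isotropyExp Y)
    (by rw [h1]; exact N.c.map_target (N.mem_target hv))
  rw [correction, h1, N.c.right_inv (N.mem_target hv), inv_mul_cancel_left] at h2
  exact h2.unique (lin_isotropyExp Y)

theorem contMDiff_isotropyExp_inv : ContMDiff (𝓘(ℝ, N.isotropyAlgebra).prod 𝓘(ℝ, E)) 𝓘(ℝ, E) ∞
    (fun p : N.isotropyAlgebra × M ↦ ((isotropyExp p.1)⁻¹ : Diffeo E M) p.2) := by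
  have h : (fun p : N.isotropyAlgebra × M ↦ ((isotropyExp p.1)⁻¹ : Diffeo E M) p.2) =
      (fun p : N.isotropyAlgebra × M ↦ (isotropyExp p.1 : Diffeo E M) p.2) ∘
        (fun p : N.isotropyAlgebra × M ↦ (-p.1, p.2)) := by
    funext p
    simp only [Function.comp]
    rw [← isotropyExp_inv]; rfl
  rw [h]
  exact contMDiff_isotropyExp.comp ((contDiff_neg.contMDiff.comp contMDiff_fst).prodMk
    contMDiff_snd)

section Smooth

variable {F H : Type*} [NormedAddCommGroup F] [NormedSpace ℝ F] [TopologicalSpace H]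
  {J : ModelWithCorners ℝ F H} {X : Type*} [TopologicalSpace X] [ChartedSpace H X]

theorem contMDiffAt_transvection_mul {y : X → E × N.isotropyAlgebra} {f : X → M} {x : X}
    (hy : ContMDiffAt J 𝓘(ℝ, E × N.isotropyAlgebra) ∞ y x) (hf : ContMDiffAt J 𝓘(ℝ, E) ∞ f x)
    (hx : ‖(y x).1‖ < N.r) : ContMDiffAt J 𝓘(ℝ, E) ∞ (fun x ↦
      ((N.transvection (y x).1 * isotropyExp (y x).2 : S.aut) : Diffeo E M) (f x)) x := by
  have h1 : ContMDiffAt J 𝓘(ℝ, E) ∞ (fun x ↦ (y x).1) x :=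
    ContMDiffAt.comp_of_eq contDiff_fst.contMDiff.contMDiffAt hy rfl
  have h2 : ContMDiffAt J 𝓘(ℝ, N.isotropyAlgebra) ∞ (fun x ↦ (y x).2) x :=
    ContMDiffAt.comp_of_eq contDiff_snd.contMDiff.contMDiffAt hy rfl
  exact N.contMDiffAt_transvection h1 hx
    (ContMDiffAt.comp_of_eq contMDiff_isotropyExp.contMDiffAt (h2.prodMk hf) rfl)

theorem contMDiffAt_transvection_mul_inv {y : X → E × N.isotropyAlgebra} {f : X → M} {x : X}
    (hy : ContMDiffAt J 𝓘(ℝ, E × N.isotropyAlgebra) ∞ y x) (hf : ContMDiffAt J 𝓘(ℝ, E) ∞ f x)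
    (hx : ‖(y x).1‖ < N.r) : ContMDiffAt J 𝓘(ℝ, E) ∞ (fun x ↦
      (((N.transvection (y x).1 * isotropyExp (y x).2)⁻¹ : S.aut) : Diffeo E M) (f x)) x := by
  have h1 : ContMDiffAt J 𝓘(ℝ, E) ∞ (fun x ↦ (y x).1) x :=
    ContMDiffAt.comp_of_eq contDiff_fst.contMDiff.contMDiffAt hy rfl
  have h2 : ContMDiffAt J 𝓘(ℝ, N.isotropyAlgebra) ∞ (fun x ↦ (y x).2) x :=
    ContMDiffAt.comp_of_eq contDiff_snd.contMDiff.contMDiffAt hy rfl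
  have h3 := ContMDiffAt.comp_of_eq (x := x) contMDiff_isotropyExp_inv.contMDiffAt
    (h2.prodMk (N.contMDiffAt_transvection_inv h1 hx hf)) rfl
  simp only [mul_inv_rev]
  exact h3

end Smooth

-- The first coordinate of `g` is the position of `g(o)`. Removing the transvection with that target
-- leaves an automorphism fixing `o`, which its linear part determines; the closed subgroup theorem
-- provides the logarithm of that operator as second coordinate.
variable (N) in
theorem nonempty_lieChart : Nonempty N.LieChart := by
  have := locallyCompactSpace_of_finiteDimensional E M
  have : CompleteSpace E := FiniteDimensional.complete ℝ E
  obtain ⟨L, W, B, hW, h1W, hB, h0B, hL, hL1, hLW, hLB⟩ := N.isExpClosedSubgroup_isotropy.exists_log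
  have ho : Continuous fun g : S.aut ↦ (g : Diffeo E M) o :=
    continuous_eval_aut.comp (continuous_id.prodMk continuous_const)
  let src : Set S.aut := (fun g : S.aut ↦ (g : Diffeo E M) o) ⁻¹' N.c.source ∩ N.linPart ⁻¹' W
  have hsrc : ∀ g, g ∈ src ↔ (g : Diffeo E M) o ∈ N.c.source ∧ N.linPart g ∈ W := fun g ↦ Iff.rfl
  have hlin1 : N.linPart 1 = 1 := by
    refine (lin_linPart (N := N) (g := 1) N.mem_source).unique ?_
    have h1 : N.correction 1 = 1 := Subtype.ext (Diffeomorph.ext fun m ↦ by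
      change S.s o (S.s (N.c.symm ((2⁻¹ : ℝ) • N.c o)) m) = m
      rw [N.map_base, smul_zero, N.symm_zero, S.involutive])
    rw [h1]
    exact lin_id
  let e : OpenPartialHomeomorph S.aut (E × N.isotropyAlgebra) :=
    { toFun := fun g ↦ (N.c ((g : Diffeo E M) o), L (N.linPart g))
      invFun := fun p ↦ N.transvection p.1 * isotropyExp p.2
      source := src
      target := ball 0 N.r ×ˢ B
      map_source' := fun g hg ↦ ⟨by
        rw [← N.target_eq]; exact N.c.map_source hg.1, (hLW _ hg.2 (linPart_mem hg.1)).2⟩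
      map_target' := fun p hp ↦ by
        have hp1 : ‖p.1‖ < N.r := by simpa using hp.1
        rw [hsrc, transvection_mul_isotropyExp_base _ hp1,
          linPart_transvection_mul_isotropyExp _ hp1]
        exact ⟨N.c.map_target (N.mem_target hp1), (hLB _ hp.2).1⟩
      left_inv' := fun g hg ↦ by
        have h1 : isotropyExp (L (N.linPart g)) = N.correction g := by
          refine Lin.ext_aut (lin_isotropyExp _) ?_
          have h2 : NormedSpace.exp (L (N.linPart g) : E →L[ℝ] E) = N.linPart g :=
            (hLW _ hg.2 (linPart_mem hg.1)).1
          rw [h2]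
          exact lin_linPart hg.1
        change N.transvection (N.c ((g : Diffeo E M) o)) * isotropyExp (L (N.linPart g)) = g
        rw [h1, transvection_mul_correction]
      right_inv' := fun p hp ↦ by
        have hp1 : ‖p.1‖ < N.r := by simpa using hp.1
        change (N.c (((N.transvection p.1 * isotropyExp p.2 : S.aut) : Diffeo E M) o),
          L (N.linPart (N.transvection p.1 * isotropyExp p.2))) = p
        rw [transvection_mul_isotropyExp_base _ hp1,
          linPart_transvection_mul_isotropyExp _ hp1, N.c.right_inv (N.mem_target hp1),
          (hLB _ hp.2).2]
      open_source := by
        refine ContinuousOn.isOpen_inter_preimage (fun g hg ↦ ?_)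
          (N.c.open_source.preimage ho) hW
        exact (continuousAt_linPart hg).continuousWithinAt
      open_target := isOpen_ball.prod hB
      continuousOn_toFun := fun g hg ↦ by
        have h1 : ContinuousAt L (N.linPart g) := (hL.contDiffAt (hW.mem_nhds hg.2)).continuousAt
        exact ((ContinuousAt.comp_of_eq (N.c.continuousAt hg.1) ho.continuousAt rfl).prodMk
          (h1.comp (continuousAt_linPart hg.1))).continuousWithinAt
      continuousOn_invFun := fun p hp ↦ by
        have hp1 : ‖p.1‖ < N.r := by simpa using hp.1
        refine (continuousAt_aut fun m ↦ ?_).continuousWithinAt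
        exact (contMDiffAt_transvection_mul (J := 𝓘(ℝ, E × N.isotropyAlgebra).prod 𝓘(ℝ, E))
          (y := Prod.fst) (f := Prod.snd) (x := (p, m)) contMDiffAt_fst contMDiffAt_snd
          hp1).continuousAt }
  exact ⟨⟨e, L, W, hW, hL, (hsrc 1).2 ⟨N.mem_source, by rwa [hlin1]⟩, fun g ↦ rfl, fun p ↦ rfl,
    fun g hg ↦ hg, fun p hp ↦ by simpa using hp.1⟩⟩

namespace LieChart

variable (D : N.LieChart)

section Smooth

variable {F H : Type*} [NormedAddCommGroup F] [NormedSpace ℝ F] [TopologicalSpace H]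
  {J : ModelWithCorners ℝ F H} {X : Type*} [TopologicalSpace X] [ChartedSpace H X]

/-- A family of automorphisms with smooth evaluation is smooth in the chart. -/
theorem contMDiffAt_comp {f : X → S.aut} {x : X} (hx : f x ∈ D.e.source)
    (hf : ∀ m, ContMDiffAt (J.prod 𝓘(ℝ, E)) 𝓘(ℝ, E) ∞
      (fun p : X × M ↦ (f p.1 : Diffeo E M) p.2) (x, m)) :
    ContMDiffAt J 𝓘(ℝ, E × N.isotropyAlgebra) ∞ (fun x ↦ D.e (f x)) x := by
  obtain ⟨ho, hW⟩ := D.mem_of_mem_source _ hx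
  have h1 : ContMDiffAt J 𝓘(ℝ, E) ∞ (fun x ↦ (f x : Diffeo E M) o) x :=
    ContMDiffAt.comp_of_eq (hf o) (contMDiffAt_id.prodMk contMDiffAt_const) rfl
  have h2 : ContMDiffAt J 𝓘(ℝ, E) ∞ (fun x ↦ N.c ((f x : Diffeo E M) o)) x :=
    ContMDiffAt.comp_of_eq (N.contMDiffAt_c ho) h1 rfl
  have h3 : ContMDiffAt J 𝓘(ℝ, E →L[ℝ] E) ∞ (fun x ↦ N.linPart (f x)) x := by
    refine contMDiffAt_linearPart (N := N) (k := fun x ↦ (N.correction (f x) : Diffeo E M)) (fun m ↦ ?_) ?_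
    · exact N.contMDiffAt_transvection_inv
        (ContMDiffAt.comp_of_eq (g := fun x ↦ N.c ((f x : Diffeo E M) o)) (f := Prod.fst) h2
          contMDiffAt_fst rfl) (N.norm_lt (N.c.map_source ho)) (hf m)
    · filter_upwards [h1.continuousAt (N.c.open_source.mem_nhds ho)] with g' hg'
      exact ⟨isHom_aut _, lin_linPart hg'⟩
  have h4 : ContMDiffAt J 𝓘(ℝ, N.isotropyAlgebra) ∞ (fun x ↦ D.L (N.linPart (f x))) x :=
    ContMDiffAt.comp_of_eq (D.contDiffOn_L.contDiffAt (D.isOpen_W.mem_nhds hW)).contMDiffAt h3 rfl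
  simp only [D.apply_eq]
  exact h2.prodMk_space h4

end Smooth

/-- The chart at `1` with values in a Euclidean space. -/
noncomputable def euclid : OpenPartialHomeomorph S.aut
    (EuclideanSpace ℝ (Fin (Module.finrank ℝ (E × N.isotropyAlgebra)))) :=
  D.e.trans (toEuclidean (E := E × N.isotropyAlgebra)).toHomeomorph.toOpenPartialHomeomorph

theorem mem_euclid_source (g : S.aut) : g ∈ D.euclid.source ↔ g ∈ D.e.source := by
  simp [euclid]

theorem euclid_symm_apply (y) : D.euclid.symm y = D.e.symm (toEuclidean.symm y) := rfl

theorem mem_euclid_target {y} (hy : y ∈ D.euclid.target) : toEuclidean.symm y ∈ D.e.target := by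
  simpa [euclid] using hy

/-- The charts obtained by left translation. -/
@[reducible] noncomputable def chartedSpace [LocallyCompactSpace M] :
    ChartedSpace (EuclideanSpace ℝ (Fin (Module.finrank ℝ (E × N.isotropyAlgebra)))) S.aut where
  atlas := Set.range fun g : S.aut ↦
    (mulLeftHomeo g⁻¹).toOpenPartialHomeomorph.trans D.euclid
  chartAt g := (mulLeftHomeo g⁻¹).toOpenPartialHomeomorph.trans D.euclid
  mem_chart_source g := by
    have : g⁻¹ * g ∈ D.euclid.source := by
      rw [inv_mul_cancel, mem_euclid_source]; exact D.one_mem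
    exact ⟨Set.mem_univ _, this⟩
  chart_mem_atlas g := ⟨g, rfl⟩

section Smooth

variable {F H : Type*} [NormedAddCommGroup F] [NormedSpace ℝ F] [TopologicalSpace H]
  {J : ModelWithCorners ℝ F H} {X : Type*} [TopologicalSpace X] [ChartedSpace H X]

theorem contMDiffAt_euclid_comp {f : X → S.aut} {x : X} (hx : f x ∈ D.euclid.source)
    (hf : ∀ m, ContMDiffAt (J.prod 𝓘(ℝ, E)) 𝓘(ℝ, E) ∞
      (fun p : X × M ↦ (f p.1 : Diffeo E M) p.2) (x, m)) :
    ContMDiffAt J 𝓘(ℝ, EuclideanSpace ℝ (Fin (Module.finrank ℝ (E × N.isotropyAlgebra)))) ∞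
      (fun x ↦ D.euclid (f x)) x :=
  ContMDiffAt.comp_of_eq (f := fun x ↦ D.e (f x)) (toEuclidean (E := E × N.isotropyAlgebra)).contDiff.contMDiff.contMDiffAt
    (D.contMDiffAt_comp ((D.mem_euclid_source _).1 hx) hf) rfl

theorem contMDiffAt_euclid_symm
    {y : X → EuclideanSpace ℝ (Fin (Module.finrank ℝ (E × N.isotropyAlgebra)))} {f : X → M} {x : X}
    (hy : ContMDiffAt J 𝓘(ℝ, EuclideanSpace ℝ (Fin (Module.finrank ℝ (E × N.isotropyAlgebra)))) ∞
      y x) (hf : ContMDiffAt J 𝓘(ℝ, E) ∞ f x) (hx : y x ∈ D.euclid.target) :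
    ContMDiffAt J 𝓘(ℝ, E) ∞ (fun x ↦ (D.euclid.symm (y x) : Diffeo E M) (f x)) x ∧
    ContMDiffAt J 𝓘(ℝ, E) ∞ (fun x ↦ ((D.euclid.symm (y x))⁻¹ : Diffeo E M) (f x)) x := by
  have h1 : ContMDiffAt J 𝓘(ℝ, E × N.isotropyAlgebra) ∞ (fun x ↦ toEuclidean.symm (y x)) x :=
    ContMDiffAt.comp_of_eq
      (toEuclidean (E := E × N.isotropyAlgebra)).symm.contDiff.contMDiff.contMDiffAt hy rfl
  have h2 := D.norm_lt_of_mem_target _ (D.mem_euclid_target hx)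
  simp only [euclid_symm_apply, D.symm_apply_eq]
  exact ⟨contMDiffAt_transvection_mul h1 hf h2, contMDiffAt_transvection_mul_inv h1 hf h2⟩

end Smooth

/-- A transition map sends `y` to the chart at `1` of a fixed product times the automorphism with
coordinate `y`, whose evaluation is smooth in `y` and the point. -/
theorem isManifold [LocallyCompactSpace M] :
    letI := D.chartedSpace
    IsManifold 𝓘(ℝ, EuclideanSpace ℝ (Fin (Module.finrank ℝ (E × N.isotropyAlgebra)))) ∞
      S.aut := by
  let _ := D.chartedSpace
  refine isManifold_of_contDiffOn _ _ _ ?_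
  rintro _ _ ⟨g, rfl⟩ ⟨h, rfl⟩ y ⟨hy, -⟩
  have hy1 : y ∈ D.euclid.target ∧ h⁻¹ * (g⁻¹⁻¹ * D.euclid.symm y) ∈ D.euclid.source :=
    ⟨hy.1.1, hy.2.2⟩
  have h1 : ContMDiffAt 𝓘(ℝ, EuclideanSpace ℝ (Fin (Module.finrank ℝ (E × N.isotropyAlgebra))))
      𝓘(ℝ, EuclideanSpace ℝ (Fin (Module.finrank ℝ (E × N.isotropyAlgebra)))) ∞
      (fun y ↦ D.euclid (h⁻¹ * (g⁻¹⁻¹ * D.euclid.symm y))) y :=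
    D.contMDiffAt_euclid_comp hy1.2 fun m ↦
      ContMDiffAt.comp_of_eq ((h⁻¹ : S.aut) : Diffeo E M).contMDiff.contMDiffAt
        (ContMDiffAt.comp_of_eq ((g⁻¹⁻¹ : S.aut) : Diffeo E M).contMDiff.contMDiffAt
          (D.contMDiffAt_euclid_symm contMDiffAt_fst contMDiffAt_snd hy1.1).1 rfl) rfl
  exact h1.contDiffAt.contDiffWithinAt

section Smooth

variable {F H : Type*} [NormedAddCommGroup F] [NormedSpace ℝ F] [TopologicalSpace H]
  {J : ModelWithCorners ℝ F H} {X : Type*} [TopologicalSpace X] [ChartedSpace H X]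

/-- Smoothness of a map into the group is detected by its evaluation on `M`. Smoothness of
multiplication and inversion is reduced to the action by this criterion. -/
theorem contMDiffAt_of_eval [LocallyCompactSpace M] {f : X → S.aut} {x : X}
    (hf : ∀ m, ContMDiffAt (J.prod 𝓘(ℝ, E)) 𝓘(ℝ, E) ∞
      (fun p : X × M ↦ (f p.1 : Diffeo E M) p.2) (x, m)) :
    letI := D.chartedSpace
    ContMDiffAt J 𝓘(ℝ, EuclideanSpace ℝ (Fin (Module.finrank ℝ (E × N.isotropyAlgebra)))) ∞
      f x := by
  let _ := D.chartedSpace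
  refine contMDiffAt_iff_target.2 ⟨continuousAt_aut fun m ↦ (hf m).continuousAt, ?_⟩
  change ContMDiffAt J _ ∞ (fun z ↦ D.euclid ((f x)⁻¹ * f z)) x
  refine D.contMDiffAt_euclid_comp ?_ fun m ↦ ?_
  · rw [inv_mul_cancel, mem_euclid_source]; exact D.one_mem
  · exact ContMDiffAt.comp_of_eq (((f x)⁻¹ : S.aut) : Diffeo E M).contMDiff.contMDiffAt (hf m) rfl

/-- The second statement is what the evaluation criterion requires for inversion. Both are
transported from a neighbourhood of `1`, where an element is a transvection times an exponential. -/
theorem contMDiff_eval [LocallyCompactSpace M] :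
    letI := D.chartedSpace
    ContMDiff (𝓘(ℝ, EuclideanSpace ℝ (Fin (Module.finrank ℝ (E × N.isotropyAlgebra)))).prod 𝓘(ℝ, E))
      𝓘(ℝ, E) ∞ (fun p : S.aut × M ↦ (p.1 : Diffeo E M) p.2) ∧
    ContMDiff (𝓘(ℝ, EuclideanSpace ℝ (Fin (Module.finrank ℝ (E × N.isotropyAlgebra)))).prod 𝓘(ℝ, E))
      𝓘(ℝ, E) ∞ (fun p : S.aut × M ↦ ((p.1)⁻¹ : Diffeo E M) p.2) := by
  let _ := D.chartedSpace
  have := D.isManifold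
  rw [ContMDiff, ContMDiff, ← forall_and]
  rintro ⟨g, m⟩
  set J := 𝓘(ℝ, EuclideanSpace ℝ (Fin (Module.finrank ℝ (E × N.isotropyAlgebra)))) with hJ
  have h1 : ContMDiffAt (J.prod 𝓘(ℝ, E)) J ∞
      (fun p : S.aut × M ↦ D.euclid (g⁻¹ * p.1)) (g, m) :=
    ContMDiffAt.comp_of_eq (g := fun h ↦ D.euclid (g⁻¹ * h)) (f := Prod.fst)
      (contMDiffAt_extChartAt (I := J) (x := g)) contMDiffAt_fst rfl
  have hg : g⁻¹ * g ∈ D.euclid.source := by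
    rw [inv_mul_cancel, mem_euclid_source]; exact D.one_mem
  have h2 : ∀ᶠ p : S.aut × M in 𝓝 (g, m), g⁻¹ * p.1 ∈ D.euclid.source :=
    ((mulLeftHomeo g⁻¹).continuous.comp continuous_fst).continuousAt
      (D.euclid.open_source.mem_nhds hg)
  have h3 : ∀ f : S.aut × M → M, ContMDiffAt (J.prod 𝓘(ℝ, E)) 𝓘(ℝ, E) ∞ f (g, m) → _ :=
    fun f hf ↦ D.contMDiffAt_euclid_symm h1 hf (D.euclid.map_source hg)
  constructor
  · refine ContMDiffAt.congr_of_eventuallyEq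
      (ContMDiffAt.comp_of_eq (g : Diffeo E M).contMDiff.contMDiffAt
        (h3 _ contMDiffAt_snd).1 rfl) ?_
    filter_upwards [h2] with p hp
    simp only [Function.comp]
    rw [D.euclid.left_inv hp]
    exact (apply_inv_self (g : Diffeo E M) _).symm
  · refine ContMDiffAt.congr_of_eventuallyEq (h3 (fun p ↦ ((g⁻¹ : S.aut) : Diffeo E M) p.2)
      (ContMDiffAt.comp_of_eq ((g⁻¹ : S.aut) : Diffeo E M).contMDiff.contMDiffAt
        contMDiffAt_snd rfl)).2 ?_
    filter_upwards [h2] with p hp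
    rw [D.euclid.left_inv hp]
    change _ = (((g⁻¹ * p.1)⁻¹ * g⁻¹ : S.aut) : Diffeo E M) p.2
    rw [mul_inv_rev, inv_inv, mul_inv_cancel_right]; rfl

end Smooth

end LieChart

end NormalChart

/-- The automorphism group is a Lie transformation group. -/
theorem isLieTransformationGroup_aut (S : SymplecticSymmetricSpace E M) :
    IsLieTransformationGroup S.aut := by
  have := NormalChart.locallyCompactSpace_of_finiteDimensional E M
  obtain ⟨o⟩ : Nonempty M := inferInstance
  obtain ⟨N⟩ := S.nonempty_normalChart o
  obtain ⟨D⟩ := N.nonempty_lieChart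
  let _ := D.chartedSpace
  have := D.isManifold
  obtain ⟨h1, h2⟩ := D.contMDiff_eval
  refine ⟨_, D.chartedSpace, ?_, h1⟩
  -- By the evaluation criterion the product only has to be smooth as `(g, h, m) ↦ g(h(m))`, and the
  -- inverse as `(g, m) ↦ g⁻¹(m)`.
  refine { contMDiff_mul := fun p ↦ D.contMDiffAt_of_eval fun m ↦ ?_,
           contMDiff_inv := fun g ↦ D.contMDiffAt_of_eval fun m ↦ ?_ }
  · exact ContMDiffAt.comp_of_eq h1.contMDiffAt
      ((ContMDiffAt.comp_of_eq contMDiffAt_fst contMDiffAt_fst rfl).prodMk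
        (ContMDiffAt.comp_of_eq h1.contMDiffAt
          ((ContMDiffAt.comp_of_eq contMDiffAt_snd contMDiffAt_fst rfl).prodMk
            contMDiffAt_snd) rfl)) rfl
  · exact h2.contMDiffAt

end SymplecticSymmetricSpace

end SymplecticSymmetric

/-! ### Vector fields and maps in preferred charts -/

namespace SymplecticSymmetric

section Coordinates

open Filter

variable {E : Type*} [NormedAddCommGroup E] [NormedSpace ℝ E]
  {M : Type*} [TopologicalSpace M] [ChartedSpace E M]

variable (E) in
/-- Coordinates of tangent vectors in the preferred chart at `a`. -/
noncomputable def toCoord (a y : M) : E →L[ℝ] E := mfderiv 𝓘(ℝ, E) 𝓘(ℝ, E) (chartAt E a) y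

variable (E) in
/-- The tangent vector with given coordinates in the preferred chart at `a`. -/
noncomputable def ofCoord (a y : M) : E →L[ℝ] E :=
  mfderiv 𝓘(ℝ, E) 𝓘(ℝ, E) (chartAt E a).symm (chartAt E a y)

/-- A vector field in the preferred chart at `a`. -/
noncomputable def coordField (a : M) (Y : VField E M) (p : E) : E :=
  toCoord E a ((chartAt E a).symm p) (Y ((chartAt E a).symm p))

variable (E) in
/-- The differential of a map, as an endomorphism of the model space. -/
noncomputable def tangentCLM (φ : M → M) (y : M) : E →L[ℝ] E := mfderiv 𝓘(ℝ, E) 𝓘(ℝ, E) φ y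

variable (E) in
/-- The local expression of a map in the preferred charts at `a` and `b`. -/
noncomputable def localRep (a b : M) (φ : M → M) (p : E) : E :=
  chartAt E b (φ ((chartAt E a).symm p))

variable [IsManifold 𝓘(ℝ, E) ∞ M] {a b y : M}

theorem isManifold_one : IsManifold 𝓘(ℝ, E) 1 M := IsManifold.of_le (n := ∞) (by simp)

theorem contMDiffAt_chart (hy : y ∈ (chartAt E a).source) :
    ContMDiffAt 𝓘(ℝ, E) 𝓘(ℝ, E) ∞ (chartAt E a) y :=
  (contMDiffOn_chart (I := 𝓘(ℝ, E)) (n := ∞) (x := a)).contMDiffAt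
    ((chartAt E a).open_source.mem_nhds hy)

theorem contMDiffAt_chart_symm {p : E} (hp : p ∈ (chartAt E a).target) :
    ContMDiffAt 𝓘(ℝ, E) 𝓘(ℝ, E) ∞ (chartAt E a).symm p :=
  (contMDiffOn_chart_symm (I := 𝓘(ℝ, E)) (n := ∞) (x := a)).contMDiffAt
    ((chartAt E a).open_target.mem_nhds hp)

theorem hasMFDerivAt_chart (hy : y ∈ (chartAt E a).source) :
    HasMFDerivAt 𝓘(ℝ, E) 𝓘(ℝ, E) (chartAt E a) y (toCoord E a y) :=
  ((contMDiffAt_chart hy).mdifferentiableAt (by simp)).hasMFDerivAt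

theorem hasMFDerivAt_chart_symm (hy : y ∈ (chartAt E a).source) :
    HasMFDerivAt 𝓘(ℝ, E) 𝓘(ℝ, E) (chartAt E a).symm (chartAt E a y) (ofCoord E a y) :=
  ((contMDiffAt_chart_symm ((chartAt E a).map_source hy)).mdifferentiableAt (by simp)).hasMFDerivAt

theorem toCoord_ofCoord (hy : y ∈ (chartAt E a).source) (v : E) :
    toCoord E a y (ofCoord E a y v) = v := by
  have h1 : HasMFDerivAt 𝓘(ℝ, E) 𝓘(ℝ, E) (chartAt E a) ((chartAt E a).symm (chartAt E a y))
      (toCoord E a y) := by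
    rw [(chartAt E a).left_inv hy]; exact hasMFDerivAt_chart hy
  have h2 := HasMFDerivAt.comp (chartAt E a y) h1 (hasMFDerivAt_chart_symm hy)
  have h3 : HasMFDerivAt 𝓘(ℝ, E) 𝓘(ℝ, E) (chartAt E a ∘ (chartAt E a).symm) (chartAt E a y)
      (ContinuousLinearMap.id ℝ E) := by
    refine (hasMFDerivAt_id (I := 𝓘(ℝ, E)) (chartAt E a y)).congr_of_eventuallyEq ?_
    filter_upwards [(chartAt E a).open_target.mem_nhds ((chartAt E a).map_source hy)] with p hp
    exact (chartAt E a).right_inv hp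
  have h4 : (toCoord E a y).comp (ofCoord E a y) = ContinuousLinearMap.id ℝ E :=
    hasMFDerivAt_unique h2 h3
  exact DFunLike.congr_fun h4 v

theorem ofCoord_toCoord (hy : y ∈ (chartAt E a).source) (v : E) :
    ofCoord E a y (toCoord E a y v) = v := by
  have h2 := HasMFDerivAt.comp y (hasMFDerivAt_chart_symm hy) (hasMFDerivAt_chart hy)
  have h3 : HasMFDerivAt 𝓘(ℝ, E) 𝓘(ℝ, E) ((chartAt E a).symm ∘ chartAt E a) y
      (ContinuousLinearMap.id ℝ E) := by
    refine (hasMFDerivAt_id (I := 𝓘(ℝ, E)) y).congr_of_eventuallyEq ?_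
    filter_upwards [(chartAt E a).open_source.mem_nhds hy] with p hp
    exact (chartAt E a).left_inv hp
  have h4 : (ofCoord E a y).comp (toCoord E a y) = ContinuousLinearMap.id ℝ E :=
    hasMFDerivAt_unique h2 h3
  exact DFunLike.congr_fun h4 v

/-- The tangent space at `x` is the model space by way of the preferred chart at `x`, so at the base
point coordinates are the vector itself. Pointwise formulas computed in that chart thus need no
translation. -/
theorem toCoord_self (x : M) (v : E) : toCoord E x x v = v := by
  have := isManifold_one (E := E) (M := M)
  have h : toCoord E x x = tangentCoordChange 𝓘(ℝ, E) x x x :=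
    mfderiv_chartAt_eq_tangentCoordChange (I := 𝓘(ℝ, E)) (mem_chart_source E x)
  rw [h]
  exact tangentCoordChange_self (mem_extChartAt_source x)

theorem ofCoord_self (x : M) (v : E) : ofCoord E x x v = v := by
  conv_lhs => rw [← toCoord_self x v]
  exact ofCoord_toCoord (mem_chart_source E x) v

theorem trivializationAt_apply (hy : y ∈ (chartAt E a).source) (v : TangentSpace 𝓘(ℝ, E) y) :
    (trivializationAt E (fun x : M ↦ TangentSpace 𝓘(ℝ, E) x) a ⟨y, v⟩).2 = toCoord E a y v := by
  have := isManifold_one (E := E) (M := M)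
  have h := TangentBundle.continuousLinearMapAt_trivializationAt (I := 𝓘(ℝ, E)) hy
  have h2 : (trivializationAt E (fun x : M ↦ TangentSpace 𝓘(ℝ, E) x) a).continuousLinearMapAt ℝ y v
      = toCoord E a y v := congrArg (fun L : E →L[ℝ] E ↦ L v) h
  rw [← h2]
  rw [Trivialization.continuousLinearMapAt_apply,
    Trivialization.linearMapAt_apply, if_pos (by simpa using hy)]

theorem trivializationAt_symm_apply (hy : y ∈ (chartAt E a).source) (w : E) :
    (trivializationAt E (fun x : M ↦ TangentSpace 𝓘(ℝ, E) x) a).symm y w = ofCoord E a y w := by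
  have hb : y ∈ (trivializationAt E (fun x : M ↦ TangentSpace 𝓘(ℝ, E) x) a).baseSet := by
    simpa using hy
  have h1 := (trivializationAt E (fun x : M ↦ TangentSpace 𝓘(ℝ, E) x) a).apply_mk_symm hb w
  have h2 := congrArg Prod.snd h1
  rw [trivializationAt_apply hy] at h2
  have h3 := congrArg (ofCoord E a y) h2
  exact (ofCoord_toCoord hy _).symm.trans h3

omit [IsManifold 𝓘(ℝ, E) ∞ M] in
theorem coordField_chart (hy : y ∈ (chartAt E a).source) (Y : VField E M) :
    coordField a Y (chartAt E a y) = toCoord E a y (Y y) := by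
  rw [coordField, (chartAt E a).left_inv hy]

/-- Differentiability of a section is that of its component in a trivialization, and the tangent
trivialization at `a` is the differential of the chart. -/
theorem mdifferentiableAt_iff_coordField (hy : y ∈ (chartAt E a).source) {Y : VField E M} :
    MDifferentiableAt 𝓘(ℝ, E) 𝓘(ℝ, E).tangent
      (fun y ↦ (⟨y, Y y⟩ : TangentBundle 𝓘(ℝ, E) M)) y ↔
    DifferentiableAt ℝ (coordField a Y) (chartAt E a y) := by
  have := isManifold_one (E := E) (M := M)
  have hb : y ∈ (trivializationAt E (fun x : M ↦ TangentSpace 𝓘(ℝ, E) x) a).baseSet := by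
    simpa using hy
  have h1 := (trivializationAt E (fun x : M ↦ TangentSpace 𝓘(ℝ, E) x)
    a).mdifferentiableAt_section_iff 𝓘(ℝ, E) Y hb
  refine h1.trans ?_
  rw [← mdifferentiableAt_iff_differentiableAt]
  constructor
  · intro h
    have h2 : MDifferentiableAt 𝓘(ℝ, E) 𝓘(ℝ, E) (chartAt E a).symm (chartAt E a y) :=
      (hasMFDerivAt_chart_symm hy).mdifferentiableAt
    rw [← (chartAt E a).left_inv hy] at h
    refine (MDifferentiableAt.comp (chartAt E a y) h h2).congr_of_eventuallyEq ?_
    filter_upwards [(chartAt E a).open_target.mem_nhds ((chartAt E a).map_source hy)] with p hp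
    exact (trivializationAt_apply ((chartAt E a).map_target hp) _).symm
  · intro h
    refine (MDifferentiableAt.comp y h (hasMFDerivAt_chart hy).mdifferentiableAt
      ).congr_of_eventuallyEq ?_
    filter_upwards [(chartAt E a).open_source.mem_nhds hy] with z hz
    exact (trivializationAt_apply hz _).trans (coordField_chart hz Y).symm

theorem IsSmoothField.contDiffOn_coordField {Y : VField E M} (hY : IsSmoothField Y) (a : M) :
    ContDiffOn ℝ ∞ (coordField a Y) (chartAt E a).target := by
  have h1 : ContMDiffOn 𝓘(ℝ, E) 𝓘(ℝ, E) ∞ (fun x ↦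
      (trivializationAt E (fun x : M ↦ TangentSpace 𝓘(ℝ, E) x) a ⟨x, Y x⟩).2)
      (chartAt E a).source := by
    have h2 := (trivializationAt E (fun x : M ↦ TangentSpace 𝓘(ℝ, E) x)
      a).contMDiffOn_section_baseSet_iff (IB := 𝓘(ℝ, E)) (n := ∞) (s := Y)
    have h3 := h2.1 hY.contMDiffOn
    rwa [TangentBundle.trivializationAt_baseSet] at h3
  have h2 := h1.comp (contMDiffOn_chart_symm (I := 𝓘(ℝ, E)) (n := ∞) (x := a))
    fun p hp ↦ (chartAt E a).map_target hp
  refine ContDiffOn.congr h2.contDiffOn fun p hp ↦ ?_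
  exact (trivializationAt_apply ((chartAt E a).map_target hp) _).symm

theorem IsSmoothField.mdifferentiableAt {Y : VField E M} (hY : IsSmoothField Y) (x : M) :
    MDifferentiableAt 𝓘(ℝ, E) 𝓘(ℝ, E).tangent
      (fun y ↦ (⟨y, Y y⟩ : TangentBundle 𝓘(ℝ, E) M)) x :=
  (hY x).mdifferentiableAt (by simp)

omit [NormedSpace ℝ E] [IsManifold 𝓘(ℝ, E) ∞ M] in
/-- The set on which the local expression of `φ` is meaningful is open. -/
theorem isOpen_localRep_dom {φ : M → M} (hφ : Continuous φ) (a b : M) :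
    IsOpen ((chartAt E a).target ∩ (chartAt E a).symm ⁻¹' (φ ⁻¹' (chartAt E b).source)) :=
  (chartAt E a).isOpen_inter_preimage_symm ((chartAt E b).open_source.preimage hφ)

theorem contDiffAt_localRep {φ : M → M} (hφ : ContMDiff 𝓘(ℝ, E) 𝓘(ℝ, E) ∞ φ) {p : E}
    (hp : p ∈ (chartAt E a).target) (hφp : φ ((chartAt E a).symm p) ∈ (chartAt E b).source) :
    ContDiffAt ℝ ∞ (localRep E a b φ) p := by
  have h : ContMDiffAt 𝓘(ℝ, E) 𝓘(ℝ, E) ∞ (localRep E a b φ) p :=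
    ContMDiffAt.comp_of_eq (contMDiffAt_chart hφp)
      (ContMDiffAt.comp_of_eq hφ.contMDiffAt (contMDiffAt_chart_symm hp) rfl) rfl
  exact h.contDiffAt

omit [NormedSpace ℝ E] [IsManifold 𝓘(ℝ, E) ∞ M] in
theorem localRep_chart {φ : M → M} (hy : y ∈ (chartAt E a).source) :
    localRep E a b φ (chartAt E a y) = chartAt E b (φ y) := by
  rw [localRep, (chartAt E a).left_inv hy]

theorem hasFDerivAt_localRep {φ : M → M} (hφ : ContMDiff 𝓘(ℝ, E) 𝓘(ℝ, E) ∞ φ)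
    (hy : y ∈ (chartAt E a).source) (hφy : φ y ∈ (chartAt E b).source) :
    HasFDerivAt (localRep E a b φ) (((toCoord E b (φ y)).comp
      (tangentCLM E φ y)).comp (ofCoord E a y)) (chartAt E a y) := by
  have h1 : HasMFDerivAt 𝓘(ℝ, E) 𝓘(ℝ, E) φ ((chartAt E a).symm (chartAt E a y))
      (tangentCLM E φ y) := by
    rw [(chartAt E a).left_inv hy]
    exact ((hφ y).mdifferentiableAt (by simp)).hasMFDerivAt
  have h2 : HasMFDerivAt 𝓘(ℝ, E) 𝓘(ℝ, E) (chartAt E b)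
      (φ ((chartAt E a).symm (chartAt E a y))) (toCoord E b (φ y)) := by
    rw [(chartAt E a).left_inv hy]
    exact hasMFDerivAt_chart hφy
  exact (HasMFDerivAt.comp (chartAt E a y) h2
    (HasMFDerivAt.comp (chartAt E a y) h1 (hasMFDerivAt_chart_symm hy))).hasFDerivAt

theorem fderiv_localRep_toCoord {φ : M → M} (hφ : ContMDiff 𝓘(ℝ, E) 𝓘(ℝ, E) ∞ φ)
    (hy : y ∈ (chartAt E a).source) (hφy : φ y ∈ (chartAt E b).source) (v : E) :
    fderiv ℝ (localRep E a b φ) (chartAt E a y) (toCoord E a y v) =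
      toCoord E b (φ y) (tangentCLM E φ y v) := by
  rw [(hasFDerivAt_localRep hφ hy hφy).fderiv]
  simp only [ContinuousLinearMap.comp_apply]
  rw [ofCoord_toCoord hy]

theorem coordField_pushforward (φ : Diffeo E M) (Y : VField E M) {p : E}
    (hp : p ∈ (chartAt E a).target) (hφp : φ ((chartAt E a).symm p) ∈ (chartAt E b).source) :
    coordField b (pushforward φ Y) (localRep E a b φ p) =
      fderiv ℝ (localRep E a b φ) p (coordField a Y p) := by
  have hy : (chartAt E a).symm p ∈ (chartAt E a).source := (chartAt E a).map_target hp
  have h1 := fderiv_localRep_toCoord φ.contMDiff hy hφp (Y ((chartAt E a).symm p))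
  rw [(chartAt E a).right_inv hp] at h1
  refine Eq.trans ?_ h1.symm
  rw [localRep, coordField_chart hφp]
  exact congrArg (toCoord E b _) (pushforward_apply φ Y _)

end Coordinates

end SymplecticSymmetric

/-! ### Christoffel symbols and their transformation law -/

namespace SymplecticSymmetric

open Filter

section Calculus

variable {E : Type*} [NormedAddCommGroup E] [NormedSpace ℝ E]

/-- Differentiate `F ∘ f = f' ∘ F` twice at `p`. With `Df = Df' = -1`, the term in `D²F` is `+D²F(v,
w)` on the left and `-D²F(v, w)` on the right; hence the factor `2`. -/
theorem two_smul_fderiv_fderiv_of_intertwine {f f' F : E → E} {p : E} (hf : ContDiffAt ℝ ∞ f p)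
    (hf' : ContDiffAt ℝ ∞ f' (F p)) (hF : ContDiffAt ℝ ∞ F p) (hfp : f p = p)
    (hDf : fderiv ℝ f p = -ContinuousLinearMap.id ℝ E)
    (hDf' : fderiv ℝ f' (F p) = -ContinuousLinearMap.id ℝ E)
    (h : ∀ᶠ z in 𝓝 p, F (f z) = f' (F z)) (v w : E) :
    (2 : ℝ) • fderiv ℝ (fderiv ℝ F) p v w =
      fderiv ℝ (fderiv ℝ f') (F p) (fderiv ℝ F p v) (fderiv ℝ F p w) -
        fderiv ℝ F p (fderiv ℝ (fderiv ℝ f) p v w) := by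
  have d1 {g : E → E} {q : E} (hg : ContDiffAt ℝ ∞ g q) : ∀ᶠ z in 𝓝 q, DifferentiableAt ℝ g z := by
    filter_upwards [(hg.of_le (m := 1) (by simp)).eventually (by simp)] with z hz
    exact hz.differentiableAt (by simp)
  have d2 {g : E → E} {q : E} (hg : ContDiffAt ℝ ∞ g q) :
      HasFDerivAt (fderiv ℝ g) (fderiv ℝ (fderiv ℝ g) q) q :=
    ((hg.fderiv_right (m := ∞) (by simp)).differentiableAt (by simp)).hasFDerivAt
  have hft : Tendsto f (𝓝 p) (𝓝 p) := by
    have := hf.continuousAt.tendsto; rwa [hfp] at this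
  have h1 : ∀ᶠ z in 𝓝 p, fderiv ℝ F (f z) (fderiv ℝ f z w) = fderiv ℝ f' (F z) (fderiv ℝ F z w) := by
    filter_upwards [h.eventually_nhds, d1 hf, d1 hF, hft.eventually (d1 hF),
      hF.continuousAt.tendsto.eventually (d1 hf')] with z hz h1 h2 h3 h4
    have h5 : HasFDerivAt (F ∘ f) _ z := h3.hasFDerivAt.comp z h1.hasFDerivAt
    have h6 : HasFDerivAt (f' ∘ F) _ z := h4.hasFDerivAt.comp z h2.hasFDerivAt
    exact DFunLike.congr_fun (h5.unique (h6.congr_of_eventuallyEq hz)) w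
  have h2 : HasFDerivAt (fun z ↦ fderiv ℝ F (f z))
      ((fderiv ℝ (fderiv ℝ F) p).comp (-ContinuousLinearMap.id ℝ E)) p := by
    have h3 := (hf.differentiableAt (by simp)).hasFDerivAt
    rw [hDf] at h3
    have h4 := d2 hF
    have h5 : HasFDerivAt (fderiv ℝ F) (fderiv ℝ (fderiv ℝ F) p) (f p) := by rwa [hfp]
    exact h5.comp p h3
  have h3 : HasFDerivAt (fun z ↦ fderiv ℝ f' (F z))
      ((fderiv ℝ (fderiv ℝ f') (F p)).comp (fderiv ℝ F p)) p :=
    HasFDerivAt.comp (g := fderiv ℝ f') p (d2 hf') (hF.differentiableAt (by simp)).hasFDerivAt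
  have h4 := h2.clm_apply ((d2 hf).clm_apply (hasFDerivAt_const w p))
  have h5 := h3.clm_apply ((d2 hF).clm_apply (hasFDerivAt_const w p))
  have h6 := DFunLike.congr_fun (h4.unique (h5.congr_of_eventuallyEq h1)) v
  simp [hDf, hDf', hfp] at h6
  rw [two_smul, ← sub_eq_zero]
  rw [← sub_eq_zero] at h6
  rw [← h6]
  abel

end Calculus

namespace SymplecticSymmetricSpace

variable {E : Type*} [NormedAddCommGroup E] [NormedSpace ℝ E] [CompleteSpace E]
  {M : Type*} [TopologicalSpace M] [ChartedSpace E M] [IsManifold 𝓘(ℝ, E) ∞ M]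
  (S : SymplecticSymmetricSpace E M)

/-- The Christoffel symbols of the canonical connection in the preferred chart at `a`. -/
noncomputable def christoffel (a : M) (p : E) : E →L[ℝ] E →L[ℝ] E :=
  (-2⁻¹ : ℝ) • fderiv ℝ (fderiv ℝ fun z ↦ S.localSymm a (p, z)) p

variable {a b : M}

omit [CompleteSpace E] in
theorem mem_localDom_of_mem_target {p : E} (hp : p ∈ (chartAt E a).target) :
    (p, p) ∈ S.localDom a := by
  have := S.mem_localDom_self a ((chartAt E a).map_target hp)
  rwa [(chartAt E a).right_inv hp] at this

omit [CompleteSpace E] in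
theorem contDiffAt_localSymm {q : E × E} (hq : q ∈ S.localDom a) :
    ContDiffAt ℝ ∞ (S.localSymm a) q :=
  (S.contDiffOn_localSymm a).contDiffAt ((S.isOpen_localDom a).mem_nhds hq)

omit [CompleteSpace E] in
theorem contDiffAt_localSymm_slice {q : E × E} (hq : q ∈ S.localDom a) :
    ContDiffAt ℝ ∞ (fun z ↦ S.localSymm a (q.1, z)) q.2 :=
  ContDiffAt.comp (g := S.localSymm a) (f := fun z ↦ (q.1, z)) q.2 (S.contDiffAt_localSymm hq)
    (contDiffAt_const.prodMk contDiffAt_id)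

omit [CompleteSpace E] in
theorem eventually_mem_localDom {p : E} (hp : p ∈ (chartAt E a).target) :
    ∀ᶠ z in 𝓝 p, (p, z) ∈ S.localDom a :=
  (Continuous.continuousAt (f := fun z : E ↦ (p, z)) (by fun_prop))
    ((S.isOpen_localDom a).mem_nhds (S.mem_localDom_of_mem_target hp))

theorem fderiv_localSymm_slice {p : E} (hp : p ∈ (chartAt E a).target) :
    fderiv ℝ (fun z ↦ S.localSymm a (p, z)) p = -ContinuousLinearMap.id ℝ E := by
  have := S.fderiv_localSymm_right a ((chartAt E a).map_target hp)
  rwa [(chartAt E a).right_inv hp] at this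

omit [CompleteSpace E] in
theorem contDiffOn_christoffel (a : M) :
    ContDiffOn ℝ ∞ (S.christoffel a) (chartAt E a).target := by
  set f := S.localSymm a
  -- The partial derivative as a function of both variables: the Christoffel symbol is its
  -- derivative in the second variable, restricted to the diagonal, which makes it smooth in `p`.
  let g : E × E → E →L[ℝ] E := fun q ↦ (fderiv ℝ f q).comp (ContinuousLinearMap.inr ℝ E E)
  have hg : ∀ q ∈ S.localDom a, ContDiffAt ℝ ∞ g q := fun q hq ↦
    ((S.contDiffAt_localSymm hq).fderiv_right (m := ∞) (by simp)).clm_comp contDiffAt_const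
  have h1 : ∀ q ∈ S.localDom a, fderiv ℝ (fun z ↦ f (q.1, z)) q.2 = g q := fun q hq ↦ by
    have h2 := ((S.contDiffAt_localSymm hq).differentiableAt (by simp)).hasFDerivAt
    exact (HasFDerivAt.comp (g := f) (f := fun z ↦ (q.1, z)) q.2 h2
      (hasFDerivAt_prodMk_right q.1 q.2)).fderiv
  have h2 : ∀ p ∈ (chartAt E a).target, S.christoffel a p =
      (-2⁻¹ : ℝ) • (fderiv ℝ g (p, p)).comp (ContinuousLinearMap.inr ℝ E E) := by
    intro p hp
    rw [christoffel]
    congr 1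
    have h3 : (fderiv ℝ fun z ↦ f (p, z)) =ᶠ[𝓝 p] fun z ↦ g (p, z) := by
      filter_upwards [S.eventually_mem_localDom hp] with z hz
      exact h1 (p, z) hz
    rw [h3.fderiv_eq]
    have h4 := ((hg _ (S.mem_localDom_of_mem_target hp)).differentiableAt (by simp)).hasFDerivAt
    exact (HasFDerivAt.comp (g := g) (f := fun z ↦ (p, z)) p h4
      (hasFDerivAt_prodMk_right p p)).fderiv
  refine ContDiffOn.congr (fun p hp ↦ ?_) h2
  have h3 : ContDiffAt ℝ ∞ (fun p : E ↦ fderiv ℝ g (p, p)) p :=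
    ContDiffAt.comp (g := fderiv ℝ g) (f := fun p ↦ (p, p)) p
      ((hg _ (S.mem_localDom_of_mem_target hp)).fderiv_right (m := ∞) (by simp))
      (contDiffAt_id.prodMk contDiffAt_id)
  exact ((contDiffAt_const (c := (-2⁻¹ : ℝ))).smul (h3.clm_comp
    (contDiffAt_const (c := ContinuousLinearMap.inr ℝ E E)))).contDiffWithinAt

omit [CompleteSpace E] in
theorem christoffel_symm {p : E} (hp : p ∈ (chartAt E a).target) (v w : E) :
    S.christoffel a p v w = S.christoffel a p w v := by
  have h := (S.contDiffAt_localSymm_slice (S.mem_localDom_of_mem_target hp)).isSymmSndFDerivAt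
    (by simpa using WithTop.coe_le_coe.2 (le_top : (2 : ℕ∞) ≤ ⊤))
  simp only [christoffel, smul_apply]
  rw [h.eq]

/-- The transformation law of the Christoffel symbols. -/
theorem fderiv_fderiv_localRep {φ : M → M} (hφ : S.IsHom φ) (hφs : ContMDiff 𝓘(ℝ, E) 𝓘(ℝ, E) ∞ φ)
    {p : E} (hp : p ∈ (chartAt E a).target)
    (hφp : φ ((chartAt E a).symm p) ∈ (chartAt E b).source) (v w : E) :
    fderiv ℝ (fderiv ℝ (localRep E a b φ)) p v w =
      fderiv ℝ (localRep E a b φ) p (S.christoffel a p v w) -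
        S.christoffel b (localRep E a b φ p) (fderiv ℝ (localRep E a b φ) p v)
          (fderiv ℝ (localRep E a b φ) p w) := by
  set F := localRep E a b φ with hF
  have hFp : F p ∈ (chartAt E b).target := (chartAt E b).map_source hφp
  have hcs : ContDiffAt ℝ ∞ F p := contDiffAt_localRep hφs hp hφp
  have h := two_smul_fderiv_fderiv_of_intertwine (F := F) (p := p)
    (S.contDiffAt_localSymm_slice (S.mem_localDom_of_mem_target hp))
    (S.contDiffAt_localSymm_slice (S.mem_localDom_of_mem_target hFp)) hcs
    (S.localSymm_self a hp) (S.fderiv_localSymm_slice hp) (S.fderiv_localSymm_slice hFp)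
    (by
      filter_upwards [S.eventually_mem_localDom hp,
        (isOpen_localRep_dom hφs.continuous a b).mem_nhds ⟨hp, hφp⟩] with z hz hz'
      have h1 : S.s ((chartAt E a).symm p) ((chartAt E a).symm z) ∈ (chartAt E a).source := hz.2
      simp only [hF, localRep, localSymm]
      rw [(chartAt E a).left_inv h1, (chartAt E b).left_inv hφp, (chartAt E b).left_inv hz'.2, hφ])
    v w
  simp only [christoffel, smul_apply, map_smul]
  rw [← smul_right_injective E (two_ne_zero (α := ℝ)) |>.eq_iff]
  rw [h, smul_sub, smul_smul, smul_smul]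
  norm_num
  abel

end SymplecticSymmetricSpace

end SymplecticSymmetric

/-! ### The canonical connection and its invariance -/

namespace SymplecticSymmetric

open Filter

section Coordinates

variable {E : Type*} [NormedAddCommGroup E] [NormedSpace ℝ E]
  {M : Type*} [TopologicalSpace M] [ChartedSpace E M] [IsManifold 𝓘(ℝ, E) ∞ M] {a y : M}

variable (E) in
/-- The differential of a function, as a linear form on the model space. -/
noncomputable def tangentForm (g : M → ℝ) (y : M) : E →L[ℝ] ℝ := mfderiv 𝓘(ℝ, E) 𝓘(ℝ, ℝ) g y

theorem hasFDerivAt_comp_chart_symm {g : M → ℝ} (hy : y ∈ (chartAt E a).source)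
    (hg : MDifferentiableAt 𝓘(ℝ, E) 𝓘(ℝ, ℝ) g y) :
    HasFDerivAt (g ∘ (chartAt E a).symm) ((tangentForm E g y).comp (ofCoord E a y))
      (chartAt E a y) := by
  have h1 : HasMFDerivAt 𝓘(ℝ, E) 𝓘(ℝ, ℝ) g ((chartAt E a).symm (chartAt E a y))
      (tangentForm E g y) := by
    rw [(chartAt E a).left_inv hy]; exact hg.hasMFDerivAt
  exact (HasMFDerivAt.comp (chartAt E a y) h1 (hasMFDerivAt_chart_symm hy)).hasFDerivAt

theorem mvfderiv_eq_fderiv {g : M → ℝ} (hy : y ∈ (chartAt E a).source)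
    (hg : MDifferentiableAt 𝓘(ℝ, E) 𝓘(ℝ, ℝ) g y) (v : E) :
    mvfderiv 𝓘(ℝ, E) g y v =
      fderiv ℝ (g ∘ (chartAt E a).symm) (chartAt E a y) (toCoord E a y v) := by
  rw [(hasFDerivAt_comp_chart_symm hy hg).fderiv]
  change _ = tangentForm E g y (ofCoord E a y (toCoord E a y v))
  rw [ofCoord_toCoord hy]
  rfl

theorem coordField_self (x : M) (Y : VField E M) :
    coordField (E := E) x Y (chartAt E x x) = (show E from Y x) :=
  (coordField_chart (mem_chart_source E x) Y).trans (toCoord_self (E := E) x (Y x))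

omit [IsManifold 𝓘(ℝ, E) ∞ M] in
theorem tangentCLM_one (y : M) : tangentCLM E (1 : Diffeo E M) y = ContinuousLinearMap.id ℝ E := by
  change (mfderiv 𝓘(ℝ, E) 𝓘(ℝ, E) id y : E →L[ℝ] E) = _
  exact mfderiv_id

theorem fderiv_localRep_self {φ : M → M} (hφ : ContMDiff 𝓘(ℝ, E) 𝓘(ℝ, E) ∞ φ) (y : M) (v : E) :
    fderiv ℝ (localRep E y (φ y) φ) (chartAt E y y) v = tangentCLM E φ y v := by
  have h := fderiv_localRep_toCoord hφ (mem_chart_source E y) (mem_chart_source E (φ y)) v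
  rwa [toCoord_self, toCoord_self] at h

end Coordinates

namespace SymplecticSymmetricSpace

variable {E : Type*} [NormedAddCommGroup E] [NormedSpace ℝ E] [CompleteSpace E]
  {M : Type*} [TopologicalSpace M] [ChartedSpace E M] [IsManifold 𝓘(ℝ, E) ∞ M]
  (S : SymplecticSymmetricSpace E M) {a b y : M}

/-- The expression of the canonical connection in the preferred chart at `a`. -/
noncomputable def covCoord (a : M) (Y : VField E M) (p : E) : E →L[ℝ] E :=
  fderiv ℝ (coordField a Y) p + (S.christoffel a p).flip (coordField a Y p)

omit [CompleteSpace E] in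
theorem covCoord_apply (a : M) (Y : VField E M) (p v : E) : S.covCoord a Y p v =
    fderiv ℝ (coordField a Y) p v + S.christoffel a p v (coordField a Y p) := rfl

/-- The canonical connection is invariant under automorphisms. -/
theorem covCoord_pushforward {φ : Diffeo E M} (hφ : S.IsHom φ) {Y : VField E M} {p : E}
    (hp : p ∈ (chartAt E a).target) (hφp : φ ((chartAt E a).symm p) ∈ (chartAt E b).source)
    (hY : DifferentiableAt ℝ (coordField a Y) p)
    (hZ : DifferentiableAt ℝ (coordField b (pushforward φ Y)) (localRep E a b φ p)) (v : E) :
    S.covCoord b (pushforward φ Y) (localRep E a b φ p) (fderiv ℝ (localRep E a b φ) p v) =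
      fderiv ℝ (localRep E a b φ) p (S.covCoord a Y p v) := by
  have hF := contDiffAt_localRep φ.contMDiff hp hφp
  -- Differentiating the coordinate formula for the push-forward produces a second derivative of
  -- `φ`; the transformation law trades it for the two Christoffel terms.
  have h1 : (fun q ↦ coordField b (pushforward φ Y) (localRep E a b φ q)) =ᶠ[𝓝 p]
      fun q ↦ fderiv ℝ (localRep E a b φ) q (coordField a Y q) := by
    filter_upwards [(isOpen_localRep_dom φ.continuous a b).mem_nhds ⟨hp, hφp⟩] with q hq
    exact coordField_pushforward φ Y hq.1 hq.2
  have h2 : HasFDerivAt (fun q ↦ coordField b (pushforward φ Y) (localRep E a b φ q)) _ p :=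
    HasFDerivAt.comp (g := coordField b (pushforward φ Y)) p hZ.hasFDerivAt
      (hF.differentiableAt (by simp)).hasFDerivAt
  have h3 := ((hF.fderiv_right (m := ∞) (by simp)).differentiableAt
    (by simp)).hasFDerivAt.clm_apply hY.hasFDerivAt
  have h4 := DFunLike.congr_fun (h2.unique (h3.congr_of_eventuallyEq h1)) v
  simp only [ContinuousLinearMap.comp_apply, add_apply,
    ContinuousLinearMap.flip_apply] at h4
  rw [covCoord_apply, covCoord_apply, h4, coordField_pushforward φ Y hp hφp, map_add,
    S.fderiv_fderiv_localRep hφ φ.contMDiff hp hφp]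
  abel

/-- The canonical connection, as an operator on vector fields. -/
noncomputable def connectionFun (Y : VField E M) (x : M) :
    TangentSpace 𝓘(ℝ, E) x →L[ℝ] TangentSpace 𝓘(ℝ, E) x :=
  (S.covCoord x Y (chartAt E x x) : E →L[ℝ] E)

omit [CompleteSpace E] in
theorem covCoord_add {Y Z : VField E M} {p : E} (hY : DifferentiableAt ℝ (coordField a Y) p)
    (hZ : DifferentiableAt ℝ (coordField a Z) p) (v : E) :
    S.covCoord a (Y + Z) p v = S.covCoord a Y p v + S.covCoord a Z p v := by
  have h1 : coordField a (Y + Z) = fun p ↦ coordField a Y p + coordField a Z p := by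
    funext p
    exact map_add (toCoord E a ((chartAt E a).symm p)) _ _
  rw [covCoord_apply, covCoord_apply, covCoord_apply, h1, fderiv_fun_add hY hZ, map_add, add_apply]
  abel

omit [CompleteSpace E] in
theorem covCoord_smul {g : M → ℝ} {Y : VField E M} {x : M} (hx : x ∈ (chartAt E a).source)
    (hY : DifferentiableAt ℝ (coordField a Y) (chartAt E a x))
    (hg : MDifferentiableAt 𝓘(ℝ, E) 𝓘(ℝ, ℝ) g x) (v : E) :
    S.covCoord a (g • Y) (chartAt E a x) (toCoord E a x v) =
      g x • S.covCoord a Y (chartAt E a x) (toCoord E a x v) +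
        (mvfderiv 𝓘(ℝ, E) g x v) • coordField a Y (chartAt E a x) := by
  have h1 : coordField a (g • Y) = fun p ↦ (g ∘ (chartAt E a).symm) p • coordField a Y p := by
    funext p
    exact map_smul (toCoord E a ((chartAt E a).symm p)) _ _
  rw [covCoord_apply, covCoord_apply, h1,
    fderiv_fun_smul (hasFDerivAt_comp_chart_symm hx hg).differentiableAt hY,
    mvfderiv_eq_fderiv hx hg, map_smul]
  simp only [add_apply, smul_apply, ContinuousLinearMap.smulRight_apply, Function.comp,
    (chartAt E a).left_inv hx, smul_add]
  abel

omit [CompleteSpace E] in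
theorem isCovariantDerivativeOn_connectionFun :
    IsCovariantDerivativeOn E S.connectionFun Set.univ where
  add {Y Z x} hY hZ _ := by
    have hx := mem_chart_source E x
    rw [mdifferentiableAt_iff_coordField hx] at hY hZ
    exact ContinuousLinearMap.ext (S.covCoord_add hY hZ)
  leibniz {Y g x} hY hg _ := by
    have hx := mem_chart_source E x
    rw [mdifferentiableAt_iff_coordField hx] at hY
    have h1 : ∀ v : E, S.covCoord x (g • Y) (chartAt E x x) v =
        g x • S.covCoord x Y (chartAt E x x) v + (mvfderiv 𝓘(ℝ, E) g x v) • (show E from Y x) := fun v ↦ by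
      have h := S.covCoord_smul hx hY hg v
      rw [toCoord_self] at h
      rw [h, coordField_self]
    exact ContinuousLinearMap.ext h1

/-- The canonical connection. -/
noncomputable def connection : AffineConnection E M where
  toFun := S.connectionFun
  isCovariantDerivativeOnUniv := S.isCovariantDerivativeOn_connectionFun

omit [CompleteSpace E] in
theorem isHom_one : S.IsHom (1 : Diffeo E M) := fun _ _ ↦ rfl

/-- The canonical connection in an arbitrary preferred chart. -/
theorem toCoord_connection (hy : y ∈ (chartAt E a).source) {Y : VField E M}
    (hY : MDifferentiableAt 𝓘(ℝ, E) 𝓘(ℝ, E).tangent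
      (fun y ↦ (⟨y, Y y⟩ : TangentBundle 𝓘(ℝ, E) M)) y) (v : E) :
    toCoord E a y (S.connection Y y v) =
      S.covCoord a Y (chartAt E a y) (toCoord E a y v) := by
  have hyy := mem_chart_source E y
  have h1 : ∀ w : E, fderiv ℝ (localRep E y a (1 : Diffeo E M)) (chartAt E y y) w =
      toCoord E a y w := fun w ↦ by
    have h := fderiv_localRep_toCoord (1 : Diffeo E M).contMDiff hyy
      (show (1 : Diffeo E M) y ∈ (chartAt E a).source from hy) w
    rw [toCoord_self, tangentCLM_one] at h
    exact h
  have h2 : localRep E y a (1 : Diffeo E M) (chartAt E y y) = chartAt E a y :=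
    localRep_chart hyy
  -- A change of charts is the local expression of the identity, which is a homomorphism, so
  -- independence of the chart is a case of invariance.
  have h := S.covCoord_pushforward (a := y) (b := a) (φ := 1) S.isHom_one (Y := Y)
    ((chartAt E y).map_source hyy) (by rw [(chartAt E y).left_inv hyy]; exact hy)
    ((mdifferentiableAt_iff_coordField hyy).1 hY)
    (by rw [h2, pushforward_one]; exact (mdifferentiableAt_iff_coordField hy).1 hY) v
  rw [h1, h1, h2, pushforward_one] at h
  exact h.symm

theorem covCoord_pushforward_self {φ : Diffeo E M} (hφ : S.IsHom φ) {Y : VField E M} {y : M}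
    (hY : MDifferentiableAt 𝓘(ℝ, E) 𝓘(ℝ, E).tangent
      (fun y ↦ (⟨y, Y y⟩ : TangentBundle 𝓘(ℝ, E) M)) y)
    (hZ : MDifferentiableAt 𝓘(ℝ, E) 𝓘(ℝ, E).tangent
      (fun y ↦ (⟨y, pushforward φ Y y⟩ : TangentBundle 𝓘(ℝ, E) M)) (φ y)) (v : E) :
    S.covCoord (φ y) (pushforward φ Y) (chartAt E (φ y) (φ y)) (tangentCLM E φ y v) =
      tangentCLM E φ y (S.covCoord y Y (chartAt E y y) v) := by
  have hyy := mem_chart_source E y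
  have h2 : localRep E y (φ y) φ (chartAt E y y) = chartAt E (φ y) (φ y) := localRep_chart hyy
  have h := S.covCoord_pushforward (a := y) (b := φ y) hφ (Y := Y)
    ((chartAt E y).map_source hyy) (by
      rw [(chartAt E y).left_inv hyy]; exact mem_chart_source E (φ y))
    ((mdifferentiableAt_iff_coordField hyy).1 hY)
    (by
      rw [h2]
      exact (mdifferentiableAt_iff_coordField (mem_chart_source E (φ y))).1 hZ) v
  rwa [fderiv_localRep_self φ.contMDiff, fderiv_localRep_self φ.contMDiff, h2] at h

theorem isAffineTransformation_of_isHom {φ : Diffeo E M} (hφ : S.IsHom φ) :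
    IsAffineTransformation S.connection φ := fun _ hY y v ↦
  (S.covCoord_pushforward_self hφ (hY.mdifferentiableAt y)
    ((hY.pushforward φ).mdifferentiableAt (φ y)) v).symm

theorem aut_le_aff : S.aut ≤ aff S.connection := fun g hg ↦
  S.isAffineTransformation_of_isHom (isHom_aut ⟨g, hg⟩)

end SymplecticSymmetricSpace

end SymplecticSymmetric

/-! ### Locally constant fields and the symplectic form in charts -/

namespace SymplecticSymmetric

open Filter

section Fields

variable {E : Type*} [NormedAddCommGroup E] [NormedSpace ℝ E]
  {M : Type*} [TopologicalSpace M] [ChartedSpace E M] [IsManifold 𝓘(ℝ, E) ∞ M] {a x y : M}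

/-- The vector field with constant components `w` in the preferred chart at `a`. -/
noncomputable def constField (a : M) (w : E) : VField E M := fun y ↦ ofCoord E a y w

theorem coordField_constField (w : E) {p : E} (hp : p ∈ (chartAt E a).target) :
    coordField a (constField a w) p = w := by
  have h := (chartAt E a).map_target hp
  exact toCoord_ofCoord h w

theorem contMDiffOn_constField (a : M) (w : E) :
    ContMDiffOn 𝓘(ℝ, E) 𝓘(ℝ, E).tangent ∞
      (fun y ↦ (⟨y, constField a w y⟩ : TangentBundle 𝓘(ℝ, E) M)) (chartAt E a).source := by
  have h2 := (trivializationAt E (fun x : M ↦ TangentSpace 𝓘(ℝ, E) x)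
    a).contMDiffOn_section_baseSet_iff (IB := 𝓘(ℝ, E)) (n := ∞) (s := constField a w)
  rw [TangentBundle.trivializationAt_baseSet] at h2
  refine h2.2 ((contMDiffOn_const (c := w)).congr fun y hy ↦ ?_)
  rw [trivializationAt_apply hy]
  exact toCoord_ofCoord hy w

variable [FiniteDimensional ℝ E] [T2Space M]

/-- Affine transformations are tested on global smooth fields; cutting off with a bump function
realizes any local constant field by such a field. -/
theorem exists_isSmoothField_eventuallyEq_constField (hy : y ∈ (chartAt E a).source) (w : E) :
    ∃ Z : VField E M, IsSmoothField Z ∧ ∀ᶠ z in 𝓝 y, Z z = constField a w z := by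
  obtain ⟨f, -, hf⟩ := (SmoothBumpFunction.nhds_basis_tsupport (I := 𝓘(ℝ, E)) y).mem_iff.1
    ((chartAt E a).open_source.mem_nhds hy)
  refine ⟨fun z ↦ f z • constField a w z, fun z ↦ ?_, ?_⟩
  · by_cases hz : z ∈ (chartAt E a).source
    · exact f.contMDiffAt.smul_section
        ((contMDiffOn_constField a w).contMDiffAt ((chartAt E a).open_source.mem_nhds hz))
    · have h1 : ∀ᶠ u in 𝓝 z, f u = 0 := by
        have h2 : z ∉ tsupport f := fun h ↦ hz (hf h)
        filter_upwards [(isClosed_tsupport f).isOpen_compl.mem_nhds h2] with u hu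
        exact image_eq_zero_of_notMem_tsupport hu
      refine ((contMDiff_zeroSection ℝ (fun x : M ↦ TangentSpace 𝓘(ℝ, E) x)
        (IB := 𝓘(ℝ, E)) (F := E) (n := ∞)) z).congr_of_eventuallyEq ?_
      filter_upwards [h1] with u hu
      rw [hu, zero_smul]; rfl
  · filter_upwards [f.eventuallyEq_one] with z hz
    rw [hz, Pi.one_apply, one_smul]

theorem exists_isSmoothField_eq (x : M) (w : E) :
    ∃ Z : VField E M, IsSmoothField Z ∧ (show E from Z x) = w := by
  obtain ⟨Z, hZ, h⟩ := exists_isSmoothField_eventuallyEq_constField (mem_chart_source E x) w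
  exact ⟨Z, hZ, h.self_of_nhds.trans (ofCoord_self x w)⟩

end Fields

section Form

variable {E : Type*} [NormedAddCommGroup E] [NormedSpace ℝ E]
  {M : Type*} [TopologicalSpace M] [ChartedSpace E M] [IsManifold 𝓘(ℝ, E) ∞ M]
  (Ω : SymplecticForm E M) {x : M} {Y Z : VField E M}

/-- A symplectic form at a point, as a bilinear form on the model space. -/
noncomputable def SymplecticForm.bilin (x : M) : E →L[ℝ] E →L[ℝ] ℝ := Ω.form x

theorem SymplecticForm.mdifferentiableAt_apply
    (hY : MDifferentiableAt 𝓘(ℝ, E) 𝓘(ℝ, E).tangent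
      (fun y ↦ (⟨y, Y y⟩ : TangentBundle 𝓘(ℝ, E) M)) x)
    (hZ : MDifferentiableAt 𝓘(ℝ, E) 𝓘(ℝ, E).tangent
      (fun y ↦ (⟨y, Z y⟩ : TangentBundle 𝓘(ℝ, E) M)) x) :
    MDifferentiableAt 𝓘(ℝ, E) 𝓘(ℝ, ℝ) (fun y ↦ Ω.form y (Y y) (Z y)) x := by
  have h := MDifferentiableAt.clm_bundle_apply₂ (F₃ := ℝ) (E₃ := fun _ : M ↦ ℝ)
    ((Ω.smooth x).mdifferentiableAt (by simp)) hY hZ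
  rw [mdifferentiableAt_totalSpace] at h
  simpa using h.2

theorem SymplecticForm.contMDiffAt_apply
    (hY : ContMDiffAt 𝓘(ℝ, E) 𝓘(ℝ, E).tangent ∞
      (fun y ↦ (⟨y, Y y⟩ : TangentBundle 𝓘(ℝ, E) M)) x)
    (hZ : ContMDiffAt 𝓘(ℝ, E) 𝓘(ℝ, E).tangent ∞
      (fun y ↦ (⟨y, Z y⟩ : TangentBundle 𝓘(ℝ, E) M)) x) :
    ContMDiffAt 𝓘(ℝ, E) 𝓘(ℝ, ℝ) ∞ (fun y ↦ Ω.form y (Y y) (Z y)) x := by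
  have h := ContMDiffAt.clm_bundle_apply₂ (F₃ := ℝ) (E₃ := fun _ : M ↦ ℝ) (Ω.smooth x) hY hZ
  rw [contMDiffAt_totalSpace] at h
  simpa using h.2

/-- A symplectic form in the preferred chart at `a`. -/
noncomputable def SymplecticForm.coord (a : M) (p : E) : E →L[ℝ] E →L[ℝ] ℝ :=
  (Ω.bilin ((chartAt E a).symm p)).bilinearComp (ofCoord E a ((chartAt E a).symm p))
    (ofCoord E a ((chartAt E a).symm p))

theorem SymplecticForm.coord_self (x : M) : Ω.coord x (chartAt E x x) = Ω.bilin x := by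
  ext v w
  simp only [coord, ContinuousLinearMap.bilinearComp_apply,
    (chartAt E x).left_inv (mem_chart_source E x), ofCoord_self]

theorem SymplecticForm.coord_apply_coordField {a : M} {p : E} (hp : p ∈ (chartAt E a).target)
    (Y Z : VField E M) :
    Ω.coord a p (coordField a Y p) (coordField a Z p) =
      Ω.form ((chartAt E a).symm p) (Y ((chartAt E a).symm p)) (Z ((chartAt E a).symm p)) := by
  have h := (chartAt E a).map_target hp
  rw [coord, ContinuousLinearMap.bilinearComp_apply, coordField, coordField]
  have h1 := ofCoord_toCoord (E := E) h (Y ((chartAt E a).symm p))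
  have h2 := ofCoord_toCoord (E := E) h (Z ((chartAt E a).symm p))
  exact congrArg₂ (fun v w ↦ Ω.bilin ((chartAt E a).symm p) v w) h1 h2

theorem SymplecticForm.differentiableAt_coord [FiniteDimensional ℝ E] (x : M) :
    DifferentiableAt ℝ (Ω.coord x) (chartAt E x x) := by
  have hd : ContDiffAt ℝ ∞ (Ω.coord x) (chartAt E x x) → DifferentiableAt ℝ (Ω.coord x)
    (chartAt E x x) := fun h ↦ h.differentiableAt (by simp)
  refine hd (contDiffAt_clm_of_apply (F := E) (G := E →L[ℝ] ℝ) fun v ↦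
    contDiffAt_clm_of_apply (F := E) (G := ℝ) fun w ↦ ?_)
  have hx := mem_chart_source E x
  have hc : ∀ w : E, ContMDiffAt 𝓘(ℝ, E) 𝓘(ℝ, E).tangent ∞
      (fun y ↦ (⟨y, constField x w y⟩ : TangentBundle 𝓘(ℝ, E) M)) x := fun w ↦
    (contMDiffOn_constField x w).contMDiffAt ((chartAt E x).open_source.mem_nhds hx)
  have h1 := ContMDiffAt.comp_of_eq (Ω.contMDiffAt_apply (hc v) (hc w))
    (contMDiffAt_chart_symm ((chartAt E x).map_source hx)) ((chartAt E x).left_inv hx)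
  exact h1.contDiffAt

theorem fderiv_comp_chart_symm_self {g : M → ℝ} (hg : MDifferentiableAt 𝓘(ℝ, E) 𝓘(ℝ, ℝ) g x)
    (v : E) : dirDeriv g x v = fderiv ℝ (g ∘ (chartAt E x).symm) (chartAt E x x) v := by
  have h := mvfderiv_eq_fderiv (mem_chart_source E x) hg v
  rw [toCoord_self] at h
  exact h

/-- In the product rule, the terms differentiating the form and `Z` both contain the value of `Y` at
`x`, which is zero; only the derivative of `Y` survives, and no connection is involved. -/
theorem SymplecticForm.dirDeriv_apply_of_eq_zero [FiniteDimensional ℝ E]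
    (hY : MDifferentiableAt 𝓘(ℝ, E) 𝓘(ℝ, E).tangent
      (fun y ↦ (⟨y, Y y⟩ : TangentBundle 𝓘(ℝ, E) M)) x)
    (hZ : MDifferentiableAt 𝓘(ℝ, E) 𝓘(ℝ, E).tangent
      (fun y ↦ (⟨y, Z y⟩ : TangentBundle 𝓘(ℝ, E) M)) x) (h0 : (show E from Y x) = 0) (v : E) :
    dirDeriv (fun y ↦ Ω.form y (Y y) (Z y)) x v =
      Ω.bilin x (fderiv ℝ (coordField x Y) (chartAt E x x) v) (show E from Z x) := by
  have hx := mem_chart_source E x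
  rw [fderiv_comp_chart_symm_self (Ω.mdifferentiableAt_apply hY hZ)]
  have h1 : (fun p ↦ Ω.coord x p (coordField x Y p) (coordField x Z p)) =ᶠ[𝓝 (chartAt E x x)]
      (fun y ↦ Ω.form y (Y y) (Z y)) ∘ (chartAt E x).symm := by
    filter_upwards [(chartAt E x).open_target.mem_nhds ((chartAt E x).map_source hx)] with p hp
    exact Ω.coord_apply_coordField hp Y Z
  rw [← h1.fderiv_eq]
  have h2 := (mdifferentiableAt_iff_coordField hx).1 hY
  have h3 := (mdifferentiableAt_iff_coordField hx).1 hZ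
  rw [(((Ω.differentiableAt_coord x).hasFDerivAt.clm_apply h2.hasFDerivAt).clm_apply
    h3.hasFDerivAt).fderiv]
  have h4 : coordField x Y (chartAt E x x) = 0 := (coordField_self x Y).trans h0
  simp [h4, coordField_self, Ω.coord_self]
  rfl

end Form

end SymplecticSymmetric

/-! ### Uniqueness of the invariant connection -/

namespace SymplecticSymmetric

open Filter

section Affine

variable {E : Type*} [NormedAddCommGroup E] [NormedSpace ℝ E]
  {M : Type*} [TopologicalSpace M] [ChartedSpace E M] [IsManifold 𝓘(ℝ, E) ∞ M] {x y : M}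

/-- A covariant derivative at a point, as an endomorphism of the model space. -/
noncomputable def covAt (cov : AffineConnection E M) (Y : VField E M) (x : M) : E →L[ℝ] E := cov Y x

theorem IsAffineTransformation.tangentCLM_covAt {cov : AffineConnection E M} {φ : Diffeo E M}
    (hφ : IsAffineTransformation cov φ) {Y : VField E M} (hY : IsSmoothField Y) (x : M) (v : E) :
    tangentCLM E φ x (covAt cov Y x v) =
      covAt cov (pushforward φ Y) (φ x) (tangentCLM E φ x v) := hφ Y hY x v

/-- In charts the push-forward is the field composed with `φ⁻¹`, multiplied by the Jacobian of `φ`.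
-/
theorem mdifferentiableAt_pushforward (φ : Diffeo E M) [CompleteSpace E] {Y : VField E M}
    (hY : MDifferentiableAt 𝓘(ℝ, E) 𝓘(ℝ, E).tangent
      (fun y ↦ (⟨y, Y y⟩ : TangentBundle 𝓘(ℝ, E) M)) x) :
    MDifferentiableAt 𝓘(ℝ, E) 𝓘(ℝ, E).tangent
      (fun y ↦ (⟨y, pushforward φ Y y⟩ : TangentBundle 𝓘(ℝ, E) M)) (φ x) := by
  have hx := mem_chart_source E x
  have hφx := mem_chart_source E (φ x)
  rw [mdifferentiableAt_iff_coordField hx] at hY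
  rw [mdifferentiableAt_iff_coordField hφx]
  have hinv : ∀ z, φ (φ.symm z) = z := φ.apply_symm_apply
  have hinv' : ∀ z, φ.symm (φ z) = z := φ.symm_apply_apply
  set G := localRep E (φ x) x φ.symm with hG
  have hGx : G (chartAt E (φ x) (φ x)) = chartAt E x x := by
    rw [hG, localRep_chart hφx, hinv']
  have hGs : φ.symm ((chartAt E (φ x)).symm (chartAt E (φ x) (φ x))) ∈ (chartAt E x).source := by
    rw [(chartAt E (φ x)).left_inv hφx, hinv']; exact hx
  have h1 : DifferentiableAt ℝ G (chartAt E (φ x) (φ x)) :=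
    (contDiffAt_localRep φ.symm.contMDiff ((chartAt E (φ x)).map_source hφx)
      hGs).differentiableAt (by simp)
  have hF : ContDiffAt ℝ ∞ (localRep E x (φ x) φ) (chartAt E x x) :=
    contDiffAt_localRep φ.contMDiff ((chartAt E x).map_source hx)
      (by rw [(chartAt E x).left_inv hx]; exact hφx)
  have h2 : DifferentiableAt ℝ (fun q ↦ fderiv ℝ (localRep E x (φ x) φ) q (coordField x Y q))
      (G (chartAt E (φ x) (φ x))) := by
    rw [hGx]
    exact ((hF.fderiv_right (m := ∞) (by simp)).differentiableAt (by simp)).clm_apply hY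
  refine (h2.comp _ h1).congr_of_eventuallyEq ?_
  filter_upwards [(isOpen_localRep_dom φ.symm.continuous (φ x) x).mem_nhds
    ⟨(chartAt E (φ x)).map_source hφx, hGs⟩] with q hq
  have h3 : (chartAt E x).symm (G q) = φ.symm ((chartAt E (φ x)).symm q) :=
    (chartAt E x).left_inv hq.2
  have h4 := coordField_pushforward (a := x) (b := φ x) φ Y (p := G q)
    ((chartAt E x).map_source hq.2) (by
      rw [h3, hinv]; exact (chartAt E (φ x)).map_target hq.1)
  have h5 : localRep E x (φ x) φ (G q) = q := by
    rw [localRep, h3, hinv, (chartAt E (φ x)).right_inv hq.1]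
  rw [h5] at h4
  exact h4

end Affine

namespace SymplecticSymmetricSpace

variable {E : Type*} [NormedAddCommGroup E] [NormedSpace ℝ E] [FiniteDimensional ℝ E]
  [CompleteSpace E]
  {M : Type*} [TopologicalSpace M] [T2Space M] [ChartedSpace E M] [IsManifold 𝓘(ℝ, E) ∞ M]
  (S : SymplecticSymmetricSpace E M) {x : M} {Y Z : VField E M}

omit [FiniteDimensional ℝ E] [T2Space M] in
theorem tangentCLM_symmetry (x : M) (v : E) : tangentCLM E (S.symmetry x) x v = -v :=
  S.mfderiv_symm_self x v

omit [FiniteDimensional ℝ E] [CompleteSpace E] [T2Space M] in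
theorem symmetry_self (x : M) : S.symmetry x x = x := S.fixed x

omit [FiniteDimensional ℝ E] [T2Space M] in
theorem pushforward_symmetry_self (x : M) (Y : VField E M) :
    (show E from pushforward (S.symmetry x) Y x) = -(show E from Y x) := by
  have h1 : (show E from pushforward (S.symmetry x) Y (S.symmetry x x)) =
      -(show E from Y x) :=
    (congrArg (fun v : E ↦ v) (pushforward_apply (S.symmetry x) Y x)).trans
      (S.tangentCLM_symmetry x (Y x))
  have h2 := congrArg (fun z ↦ (show E from pushforward (S.symmetry x) Y z)) (S.symmetry_self x)
  exact h2.symm.trans h1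

omit [FiniteDimensional ℝ E] [T2Space M] in
theorem mdifferentiableAt_pushforward_symmetry
    (hY : MDifferentiableAt 𝓘(ℝ, E) 𝓘(ℝ, E).tangent
      (fun y ↦ (⟨y, Y y⟩ : TangentBundle 𝓘(ℝ, E) M)) x) :
    MDifferentiableAt 𝓘(ℝ, E) 𝓘(ℝ, E).tangent
      (fun y ↦ (⟨y, pushforward (S.symmetry x) Y y⟩ : TangentBundle 𝓘(ℝ, E) M)) x := by
  have h := mdifferentiableAt_pushforward (S.symmetry x) hY
  rwa [S.symmetry_self] at h

-- The symmetry at `x` changes the sign of the direction and that of the result, and the two signs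
-- cancel.
omit [FiniteDimensional ℝ E] [T2Space M] in
theorem covAt_pushforward_symmetry {cov : AffineConnection E M}
    (h : ∀ x, S.symmetry x ∈ aff cov) (hY : IsSmoothField Y) (x : M) (v : E) :
    covAt cov (pushforward (S.symmetry x) Y) x v = covAt cov Y x v := by
  have h1 := IsAffineTransformation.tangentCLM_covAt (h x) hY x v
  rw [S.tangentCLM_symmetry, S.tangentCLM_symmetry, S.symmetry_self, map_neg] at h1
  exact (neg_injective h1).symm

omit [FiniteDimensional ℝ E] [T2Space M] in
theorem covCoord_pushforward_symmetry
    (hY : MDifferentiableAt 𝓘(ℝ, E) 𝓘(ℝ, E).tangent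
      (fun y ↦ (⟨y, Y y⟩ : TangentBundle 𝓘(ℝ, E) M)) x) (v : E) :
    S.covCoord x (pushforward (S.symmetry x) Y) (chartAt E x x) v =
      S.covCoord x Y (chartAt E x x) v := by
  have h1 := S.covCoord_pushforward_self (φ := S.symmetry x) (S.isHom_s x) hY
    (mdifferentiableAt_pushforward (S.symmetry x) hY) v
  rw [S.tangentCLM_symmetry, S.tangentCLM_symmetry, S.symmetry_self, map_neg] at h1
  exact neg_injective h1

/-- At most one connection is invariant under the symmetries. -/
theorem covAt_eq_of_symmetry_mem_aff {cov cov' : AffineConnection E M}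
    (h : ∀ x, S.symmetry x ∈ aff cov) (h' : ∀ x, S.symmetry x ∈ aff cov')
    (hY : MDifferentiableAt 𝓘(ℝ, E) 𝓘(ℝ, E).tangent
      (fun y ↦ (⟨y, Y y⟩ : TangentBundle 𝓘(ℝ, E) M)) x) : cov' Y x = cov Y x := by
  have := isManifold_one (E := E) (M := M)
  -- The difference of two connections is tensorial, hence bilinear in the value of the field and
  -- the direction.
  have hd : ∃ A : E →L[ℝ] E →L[ℝ] E, ∀ Z : VField E M,
      MDifferentiableAt 𝓘(ℝ, E) 𝓘(ℝ, E).tangent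
        (fun y ↦ (⟨y, Z y⟩ : TangentBundle 𝓘(ℝ, E) M)) x →
      ∀ v : E, A (show E from Z x) v = covAt cov' Z x v - covAt cov Z x v := by
    refine ⟨IsCovariantDerivativeOn.difference cov'.isCovariantDerivativeOnUniv
      cov.isCovariantDerivativeOnUniv x, fun Z hZ v ↦ ?_⟩
    exact congrArg (fun L : E →L[ℝ] E ↦ L v) (IsCovariantDerivativeOn.difference_apply
      cov'.isCovariantDerivativeOnUniv cov.isCovariantDerivativeOnUniv (Set.mem_univ x) hZ)
  obtain ⟨A, hA⟩ := hd
  -- Invariance is available for smooth fields only; by tensoriality `Y` may be replaced by a smooth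
  -- field with the same value at `x`. Pushing it forward by `s_x` changes that value to its
  -- negative but neither covariant derivative, so `A` is equal to its negative.
  obtain ⟨Z, hZ, hZx⟩ := exists_isSmoothField_eq x (show E from Y x)
  have h2 : ∀ v : E, covAt cov' Y x v = covAt cov Y x v := fun v ↦ by
    have h3 := hA Z (hZ.mdifferentiableAt x) v
    have h4 := hA _ ((hZ.pushforward (S.symmetry x)).mdifferentiableAt x) v
    rw [S.covAt_pushforward_symmetry h hZ, S.covAt_pushforward_symmetry h' hZ, ← h3,
      S.pushforward_symmetry_self, map_neg] at h4
    have h5 := hA Y hY v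
    rw [hZx] at h4
    have h6 : A (show E from Y x) v = 0 := by
      have h7 : (2 : ℝ) • A (show E from Y x) v = 0 := by
        rw [two_smul]
        nth_rewrite 1 [← h4]
        exact neg_add_cancel _
      exact (smul_eq_zero.1 h7).resolve_left two_ne_zero
    exact sub_eq_zero.1 (h5.symm.trans h6)
  exact ContinuousLinearMap.ext h2

omit [FiniteDimensional ℝ E] [T2Space M] in
theorem symmetry_mem_aff (x : M) : S.symmetry x ∈ aff S.connection :=
  S.isAffineTransformation_of_isHom (S.isHom_s x)

end SymplecticSymmetricSpace

end SymplecticSymmetric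

/-! ### Explicit formula, parallelism, torsion and smoothness -/

namespace SymplecticSymmetric

open Filter

section Calculus

variable {E : Type*} [NormedAddCommGroup E] [NormedSpace ℝ E]
  {M : Type*} [TopologicalSpace M] [ChartedSpace E M] [IsManifold 𝓘(ℝ, E) ∞ M] {x : M}

theorem dirDeriv_add {f g : M → ℝ} (hf : MDifferentiableAt 𝓘(ℝ, E) 𝓘(ℝ, ℝ) f x)
    (hg : MDifferentiableAt 𝓘(ℝ, E) 𝓘(ℝ, ℝ) g x) (v : E) :
    dirDeriv (fun y ↦ f y + g y) x v = dirDeriv f x v + dirDeriv g x v := by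
  have hx := mem_chart_source E x
  have hfg : MDifferentiableAt 𝓘(ℝ, E) 𝓘(ℝ, ℝ) (fun y ↦ f y + g y) x := hf.add hg
  rw [fderiv_comp_chart_symm_self hfg, fderiv_comp_chart_symm_self hf,
    fderiv_comp_chart_symm_self hg]
  have h := fderiv_fun_add (hasFDerivAt_comp_chart_symm hx hf).differentiableAt
    (hasFDerivAt_comp_chart_symm hx hg).differentiableAt
  exact DFunLike.congr_fun h v

theorem dirDeriv_neg {f : M → ℝ} (hf : MDifferentiableAt 𝓘(ℝ, E) 𝓘(ℝ, ℝ) f x) (v : E) :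
    dirDeriv (fun y ↦ -f y) x v = -dirDeriv f x v := by
  have hf' : MDifferentiableAt 𝓘(ℝ, E) 𝓘(ℝ, ℝ) (fun y ↦ -f y) x := hf.neg
  rw [fderiv_comp_chart_symm_self hf', fderiv_comp_chart_symm_self hf]
  exact DFunLike.congr_fun (fderiv_fun_neg (f := f ∘ (chartAt E x).symm)
    (x := chartAt E x x)) v

omit [IsManifold 𝓘(ℝ, E) ∞ M] in
theorem dirDeriv_comp (φ : Diffeo E M) {g : M → ℝ}
    (hg : MDifferentiableAt 𝓘(ℝ, E) 𝓘(ℝ, ℝ) g (φ x)) (v : E) :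
    dirDeriv (fun y ↦ g (φ y)) x v = tangentForm E g (φ x) (tangentCLM E φ x v) := by
  have h := mfderiv_comp x hg (φ.mdifferentiable (by simp) x)
  exact congrArg (fun L : E →L[ℝ] ℝ ↦ L v) h

theorem inverse_ofCoord {a y : M} (hy : y ∈ (chartAt E a).source) :
    (ofCoord E a y).inverse = toCoord E a y :=
  ContinuousLinearMap.inverse_eq (ContinuousLinearMap.ext (ofCoord_toCoord hy))
    (ContinuousLinearMap.ext (toCoord_ofCoord hy))

theorem mlieBracket_eq_sub (X Y : VField E M) (x : M) :
    (show E from VectorField.mlieBracket 𝓘(ℝ, E) X Y x) =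
      fderiv ℝ (coordField x Y) (chartAt E x x) (show E from X x) -
        fderiv ℝ (coordField x X) (chartAt E x x) (show E from Y x) := by
  have hx := mem_chart_source E x
  have h1 : ∀ Z : VField E M, VectorField.mpullbackWithin 𝓘(ℝ, E) 𝓘(ℝ, E)
      (extChartAt 𝓘(ℝ, E) x).symm Z (Set.range 𝓘(ℝ, E)) =ᶠ[𝓝 (chartAt E x x)]
        coordField x Z := fun Z ↦ by
    filter_upwards [(chartAt E x).open_target.mem_nhds ((chartAt E x).map_source hx)] with p hp
    have h2 : ((mfderiv 𝓘(ℝ, E) 𝓘(ℝ, E) (chartAt E x).symm p : E →L[ℝ] E)).inverse =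
        toCoord E x ((chartAt E x).symm p) := by
      have h3 : (mfderiv 𝓘(ℝ, E) 𝓘(ℝ, E) (chartAt E x).symm p : E →L[ℝ] E) =
          ofCoord E x ((chartAt E x).symm p) := by
        rw [ofCoord, (chartAt E x).right_inv hp]
      exact (congrArg (fun L : E →L[ℝ] E ↦ L.inverse) h3).trans
        (inverse_ofCoord ((chartAt E x).map_target hp))
    rw [VectorField.mpullbackWithin_apply]
    simp only [modelWithCornersSelf_coe, Set.range_id, mfderivWithin_univ]
    exact congrArg (fun L : E →L[ℝ] E ↦ L (Z ((chartAt E x).symm p))) h2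
  have h4 : (toCoord E x x).inverse = ContinuousLinearMap.id ℝ E := by
    have : toCoord E x x = ContinuousLinearMap.id ℝ E :=
      ContinuousLinearMap.ext (toCoord_self x)
    rw [this, ContinuousLinearMap.inverse_id]
  have h5 : ∀ X' Y' : E → E, X' = VectorField.mpullbackWithin 𝓘(ℝ, E) 𝓘(ℝ, E)
        (extChartAt 𝓘(ℝ, E) x).symm X (Set.range 𝓘(ℝ, E)) →
      Y' = VectorField.mpullbackWithin 𝓘(ℝ, E) 𝓘(ℝ, E)
        (extChartAt 𝓘(ℝ, E) x).symm Y (Set.range 𝓘(ℝ, E)) →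
      (show E from VectorField.mlieBracket 𝓘(ℝ, E) X Y x) =
        (toCoord E x x).inverse (VectorField.lieBracketWithin ℝ X' Y' Set.univ (chartAt E x x)) := by
    rintro _ _ rfl rfl
    have h6 := VectorField.mlieBracketWithin_apply (I := 𝓘(ℝ, E)) (V := X) (W := Y)
      (s := Set.univ) (x₀ := x)
    simp only [modelWithCornersSelf_coe, Set.range_id, Set.preimage_univ, Set.inter_univ] at h6 ⊢
    exact h6
  obtain ⟨X', hX'⟩ : ∃ X' : E → E, X' = VectorField.mpullbackWithin 𝓘(ℝ, E) 𝓘(ℝ, E)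
        (extChartAt 𝓘(ℝ, E) x).symm X (Set.range 𝓘(ℝ, E)) := ⟨_, rfl⟩
  obtain ⟨Y', hY'⟩ : ∃ Y' : E → E, Y' = VectorField.mpullbackWithin 𝓘(ℝ, E) 𝓘(ℝ, E)
        (extChartAt 𝓘(ℝ, E) x).symm Y (Set.range 𝓘(ℝ, E)) := ⟨_, rfl⟩
  have h6 : X' =ᶠ[𝓝 (chartAt E x x)] coordField x X := hX' ▸ h1 X
  have h7 : Y' =ᶠ[𝓝 (chartAt E x x)] coordField x Y := hY' ▸ h1 Y
  refine (h5 X' Y' hX' hY').trans ?_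
  rw [h4, VectorField.lieBracketWithin_univ, h6.lieBracket_vectorField_eq h7,
    ContinuousLinearMap.id_apply, VectorField.lieBracket, coordField_self, coordField_self]

end Calculus

section Form

variable {E : Type*} [NormedAddCommGroup E] [NormedSpace ℝ E]
  {M : Type*} [TopologicalSpace M] [ChartedSpace E M] [IsManifold 𝓘(ℝ, E) ∞ M]
  (Ω : SymplecticForm E M)

theorem SymplecticForm.bilin_neg (x : M) (v w : E) : Ω.bilin x v w = -Ω.bilin x w v := by
  have h : ∀ u : E, Ω.bilin x u u = 0 := Ω.alternating x
  have h1 := h (v + w)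
  simp only [map_add, add_apply, h] at h1
  linarith

theorem PreservesForm.pushforward {Ω : SymplecticForm E M} {φ : Diffeo E M}
    (hφ : PreservesForm Ω φ) (Y Z : VField E M) (x : M) :
    Ω.form (φ x) (pushforward φ Y (φ x)) (pushforward φ Z (φ x)) = Ω.form x (Y x) (Z x) := by
  rw [pushforward_apply, pushforward_apply]
  exact hφ x _ _

end Form

namespace SymplecticSymmetricSpace

variable {E : Type*} [NormedAddCommGroup E] [NormedSpace ℝ E]
  [CompleteSpace E]
  {M : Type*} [TopologicalSpace M] [ChartedSpace E M] [IsManifold 𝓘(ℝ, E) ∞ M]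
  (S : SymplecticSymmetricSpace E M) {x : M} {Y Z : VField E M}

omit [CompleteSpace E] in
theorem preservesForm_symmetry (x : M) : PreservesForm S.Ω (S.symmetry x) := S.symplectic x

/-- The field vanishes at `x`, so its ordinary and covariant derivatives agree there, and both
summands have the same covariant derivative by invariance. -/
theorem fderiv_coordField_add_pushforward
    (hY : MDifferentiableAt 𝓘(ℝ, E) 𝓘(ℝ, E).tangent
      (fun y ↦ (⟨y, Y y⟩ : TangentBundle 𝓘(ℝ, E) M)) x) (v : E) :
    fderiv ℝ (coordField x (Y + pushforward (S.symmetry x) Y)) (chartAt E x x) v =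
      (2 : ℝ) • S.covCoord x Y (chartAt E x x) v := by
  have hx := mem_chart_source E x
  have h1 := S.covCoord_add ((mdifferentiableAt_iff_coordField hx).1 hY)
    ((mdifferentiableAt_iff_coordField hx).1 (S.mdifferentiableAt_pushforward_symmetry hY)) v
  rw [S.covCoord_pushforward_symmetry hY, ← two_smul ℝ, covCoord_apply] at h1
  have h2 : coordField x (Y + pushforward (S.symmetry x) Y) (chartAt E x x) = 0 := by
    rw [coordField_self]
    have := S.pushforward_symmetry_self x Y
    exact (congrArg (fun w : E ↦ (show E from Y x) + w) this).trans (add_neg_cancel _)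
  rw [h2, map_zero, add_zero] at h1
  exact h1

/-- Since `Y + s_{x*}Y` vanishes at `x`, differentiating its pairing with `Z` only sees its own
derivative, which is `2∇Y`. -/
theorem two_mul_bilin_covCoord [FiniteDimensional ℝ E]
    (hY : MDifferentiableAt 𝓘(ℝ, E) 𝓘(ℝ, E).tangent
      (fun y ↦ (⟨y, Y y⟩ : TangentBundle 𝓘(ℝ, E) M)) x)
    (hZ : MDifferentiableAt 𝓘(ℝ, E) 𝓘(ℝ, E).tangent
      (fun y ↦ (⟨y, Z y⟩ : TangentBundle 𝓘(ℝ, E) M)) x) (v : E) :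
    2 * S.Ω.bilin x (S.covCoord x Y (chartAt E x x) v) (show E from Z x) =
      dirDeriv (fun y ↦ S.Ω.form y (Y y + pushforward (S.symmetry x) Y y) (Z y)) x v := by
  have hV := mdifferentiableAt_add_section hY (S.mdifferentiableAt_pushforward_symmetry hY)
  have h0 := (congrArg (fun w : E ↦ (show E from Y x) + w)
    (S.pushforward_symmetry_self x Y)).trans (add_neg_cancel _)
  have h := S.Ω.dirDeriv_apply_of_eq_zero hV hZ h0 v
  rw [S.fderiv_coordField_add_pushforward hY, map_smul] at h
  exact h.symm

/-- Adding the explicit formula for `Y, Z` to the one with the roles exchanged gives twice the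
derivative of `ω(Y, Z)`, plus the derivative of the mixed terms `ω(s_{x*}Y, Z) + ω(Y, s_{x*}Z)`. The
two identities below show that the mixed terms contribute nothing. -/
theorem dirDeriv_apply_eq [FiniteDimensional ℝ E] (hYs : IsSmoothField Y) (hZs : IsSmoothField Z)
    (x : M) (v : E) : dirDeriv (fun y ↦ S.Ω.form y (Y y) (Z y)) x v =
      S.Ω.bilin x (S.covCoord x Y (chartAt E x x) v) (show E from Z x) +
      S.Ω.bilin x (show E from Y x) (S.covCoord x Z (chartAt E x x) v) := by
  have hY := hYs.mdifferentiableAt x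
  have hZ := hZs.mdifferentiableAt x
  have hY' := S.mdifferentiableAt_pushforward_symmetry hY
  have hZ' := S.mdifferentiableAt_pushforward_symmetry hZ
  obtain ⟨Y', hY'e⟩ : ∃ Y' : VField E M, Y' = pushforward (S.symmetry x) Y := ⟨_, rfl⟩
  obtain ⟨Z', hZ'e⟩ : ∃ Z' : VField E M, Z' = pushforward (S.symmetry x) Z := ⟨_, rfl⟩
  have h1 := S.two_mul_bilin_covCoord hY hZ v
  have h2 := S.two_mul_bilin_covCoord hZ hY v
  have hW := mdifferentiableAt_add_section hZ hZ'
  have hV0 := (congrArg (fun w : E ↦ (show E from Y x) + w)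
    (S.pushforward_symmetry_self x Y)).trans (add_neg_cancel _)
  have hW0 := (congrArg (fun w : E ↦ (show E from Z x) + w)
    (S.pushforward_symmetry_self x Z)).trans (add_neg_cancel _)
  have h3 := S.Ω.dirDeriv_apply_of_eq_zero (mdifferentiableAt_add_section hY hY') hW hV0 v
  -- Both `Y + s_{x*}Y` and `Z + s_{x*}Z` vanish at `x`, so their pairing has zero derivative.
  have h3' := h3.trans ((congrArg (S.Ω.bilin x _) hW0).trans (map_zero _))
  -- Pull the pairing of the pushed fields back by the symplectic `s_x`: the function becomes the
  -- original pairing and the direction changes sign.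
  have h4 : dirDeriv (fun y ↦ S.Ω.form y (Y y) (Z y)) x v =
      -dirDeriv (fun y ↦ S.Ω.form y (pushforward (S.symmetry x) Y y)
        (pushforward (S.symmetry x) Z y)) x v := by
    have h5 := dirDeriv_comp (x := x) (S.symmetry x)
      (g := fun y ↦ S.Ω.form y (pushforward (S.symmetry x) Y y) (pushforward (S.symmetry x) Z y))
      (by rw [S.symmetry_self]; exact S.Ω.mdifferentiableAt_apply hY' hZ') v
    simp only [(S.preservesForm_symmetry x).pushforward] at h5
    rw [S.tangentCLM_symmetry, S.symmetry_self, map_neg] at h5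
    exact h5
  rw [← hY'e] at hY' h1 h3' h4
  rw [← hZ'e] at hZ' h2 h3' h4
  have hd : ∀ {U V W : VField E M}, MDifferentiableAt 𝓘(ℝ, E) 𝓘(ℝ, E).tangent
        (fun y ↦ (⟨y, U y⟩ : TangentBundle 𝓘(ℝ, E) M)) x →
      MDifferentiableAt 𝓘(ℝ, E) 𝓘(ℝ, E).tangent
        (fun y ↦ (⟨y, V y⟩ : TangentBundle 𝓘(ℝ, E) M)) x →
      MDifferentiableAt 𝓘(ℝ, E) 𝓘(ℝ, E).tangent
        (fun y ↦ (⟨y, W y⟩ : TangentBundle 𝓘(ℝ, E) M)) x →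
      dirDeriv (fun y ↦ S.Ω.form y (U y + V y) (W y)) x v =
        dirDeriv (fun y ↦ S.Ω.form y (U y) (W y)) x v +
          dirDeriv (fun y ↦ S.Ω.form y (V y) (W y)) x v := fun {U V W} hU hV hW ↦ by
    have h := dirDeriv_add (S.Ω.mdifferentiableAt_apply hU hW)
      (S.Ω.mdifferentiableAt_apply hV hW) v
    rw [← h]
    congr 1
    funext y
    rw [map_add]; rfl
  have ha : ∀ {U V : VField E M}, MDifferentiableAt 𝓘(ℝ, E) 𝓘(ℝ, E).tangent
        (fun y ↦ (⟨y, U y⟩ : TangentBundle 𝓘(ℝ, E) M)) x →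
      MDifferentiableAt 𝓘(ℝ, E) 𝓘(ℝ, E).tangent
        (fun y ↦ (⟨y, V y⟩ : TangentBundle 𝓘(ℝ, E) M)) x →
      dirDeriv (fun y ↦ S.Ω.form y (U y) (V y)) x v =
        -dirDeriv (fun y ↦ S.Ω.form y (V y) (U y)) x v := fun {U V} hU hV ↦ by
    rw [← dirDeriv_neg (S.Ω.mdifferentiableAt_apply hV hU)]
    congr 1
    funext y
    exact S.Ω.bilin_neg y (U y) (V y)
  rw [hd hY hY' hZ] at h1
  rw [hd hZ hZ' hY] at h2
  have h6 : dirDeriv (fun y ↦ S.Ω.form y (Y y + Y' y) ((Z + Z') y)) x v = 0 := h3'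
  rw [hd (W := Z + Z') hY hY' (by rw [hZ'e]; exact hW)] at h6
  have h7 : ∀ {U : VField E M}, MDifferentiableAt 𝓘(ℝ, E) 𝓘(ℝ, E).tangent
        (fun y ↦ (⟨y, U y⟩ : TangentBundle 𝓘(ℝ, E) M)) x →
      dirDeriv (fun y ↦ S.Ω.form y (U y) ((Z + Z') y)) x v =
        dirDeriv (fun y ↦ S.Ω.form y (U y) (Z y)) x v +
          dirDeriv (fun y ↦ S.Ω.form y (U y) (Z' y)) x v := fun {U} hU ↦ by
    rw [ha hU (V := Z + Z') (by rw [hZ'e]; exact hW), ha hU hZ, ha hU hZ']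
    have := hd hZ hZ' hU
    rw [← neg_add, ← this]
    rfl
  rw [h7 hY, h7 hY'] at h6
  have h8 := S.Ω.bilin_neg x (S.covCoord x Z (chartAt E x x) v) (show E from Y x)
  rw [h8] at h2
  have h9 := ha hZ hY
  have h10 := ha hZ' hY
  linarith

theorem isParallel_connection [FiniteDimensional ℝ E] : IsParallel S.connection S.Ω :=
  fun _ _ hY hZ x v ↦ S.dirDeriv_apply_eq hY hZ x v

theorem bilin_connection [FiniteDimensional ℝ E] {X Y Z : VField E M}
    (hY : IsSmoothField Y) (hZ : IsSmoothField Z) (x : M) :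
    S.Ω.form x (S.connection Y x (X x)) (Z x) = (1 / 2) * dirDeriv
      (fun y ↦ S.Ω.form y (Y y + pushforward (S.symmetry x) Y y) (Z y)) x (X x) := by
  have h := S.two_mul_bilin_covCoord (hY.mdifferentiableAt x) (hZ.mdifferentiableAt x) (X x)
  rw [← h, ← mul_assoc]
  norm_num
  rfl

theorem torsion_connection [FiniteDimensional ℝ E] : S.connection.torsion = 0 := by
  rw [CovariantDerivative.torsion_eq_zero_iff]
  intro X Y x _ _
  have hx := mem_chart_source E x
  have h1 : S.covCoord x Y (chartAt E x x) (show E from X x) -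
      S.covCoord x X (chartAt E x x) (show E from Y x) =
      (show E from VectorField.mlieBracket 𝓘(ℝ, E) X Y x) := by
    rw [mlieBracket_eq_sub, covCoord_apply, covCoord_apply, coordField_self, coordField_self,
      S.christoffel_symm ((chartAt E x).map_source hx)]
    abel
  exact h1

omit [CompleteSpace E] in
theorem contDiffOn_covCoord {Y : VField E M} (hY : IsSmoothField Y) (a : M) :
    ContDiffOn ℝ ∞ (S.covCoord a Y) (chartAt E a).target := by
  have h1 := hY.contDiffOn_coordField a
  refine ContDiffOn.add (h1.fderiv_of_isOpen (chartAt E a).open_target (m := ∞) (by simp)) ?_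
  exact ((ContinuousLinearMap.flipₗᵢ ℝ E E E).toContinuousLinearEquiv.contDiff.comp_contDiffOn
    (S.contDiffOn_christoffel a)).clm_apply h1

/-- In the trivialization of the endomorphism bundle given by the chart at `x`, the covariant
derivative is `covCoord`, by chart independence. -/
theorem contMDiffCovariantDerivative_connection :
    CovariantDerivative.ContMDiffCovariantDerivative S.connection ∞ := by
  refine ⟨⟨fun {σ} hσ ↦ ?_⟩⟩
  have := isManifold_one (E := E) (M := M)
  have hσ' : IsSmoothField σ := contMDiffOn_univ.1 (hσ.of_le (by simp))
  intro x _
  refine ContMDiffAt.contMDiffWithinAt ?_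
  rw [contMDiffAt_hom_bundle]
  refine ⟨contMDiffAt_id, ?_⟩
  have hx := mem_chart_source E x
  have h1 : ContMDiffAt 𝓘(ℝ, E) 𝓘(ℝ, E →L[ℝ] E) ∞
      (fun y ↦ S.covCoord x σ (chartAt E x y)) x :=
    ContMDiffAt.comp_of_eq (g := S.covCoord x σ) ((S.contDiffOn_covCoord hσ' x).contDiffAt
      ((chartAt E x).open_target.mem_nhds ((chartAt E x).map_source hx))).contMDiffAt
      (contMDiffAt_chart hx) rfl
  refine h1.congr_of_eventuallyEq ?_
  filter_upwards [(chartAt E x).open_source.mem_nhds hx] with y hy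
  have hb : y ∈ (trivializationAt E (fun x : M ↦ TangentSpace 𝓘(ℝ, E) x) x).baseSet := by
    simpa using hy
  refine ContinuousLinearMap.ext fun v ↦ ?_
  rw [ContinuousLinearMap.inCoordinates_eq hb hb]
  have h2 := S.toCoord_connection hy (hσ'.mdifferentiableAt y) (ofCoord E x y v)
  rw [toCoord_ofCoord hy] at h2
  rw [← h2]
  refine Eq.trans ?_ (trivializationAt_apply hy (S.connection σ y (ofCoord E x y v)))
  exact congrArg (fun w : E ↦ (trivializationAt E (fun x : M ↦ TangentSpace 𝓘(ℝ, E) x) x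
    ⟨y, S.connection σ y w⟩).2) (trivializationAt_symm_apply hy v)

theorem isAdmissible_connection [FiniteDimensional ℝ E] : S.IsAdmissible S.connection where
  smooth := S.contMDiffCovariantDerivative_connection
  parallel := S.isParallel_connection
  affine := S.symmetry_mem_aff

end SymplecticSymmetricSpace

end SymplecticSymmetric

/-! ### The geodesic equation in charts -/

namespace SymplecticSymmetric

open Filter

section Curves

variable {E : Type*} [NormedAddCommGroup E] [NormedSpace ℝ E]
  {M : Type*} [TopologicalSpace M] [ChartedSpace E M] [IsManifold 𝓘(ℝ, E) ∞ M] {a b : M}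
  {γ : ℝ → M} {t : ℝ}

theorem toCoord_velocity (hγ : MDifferentiableAt 𝓘(ℝ, ℝ) 𝓘(ℝ, E) γ t)
    (ht : γ t ∈ (chartAt E a).source) :
    toCoord E a (γ t) (velocity γ t) = deriv (chartAt E a ∘ γ) t := by
  have h1 : ∀ L : ℝ →L[ℝ] E, HasMFDerivAt 𝓘(ℝ, ℝ) 𝓘(ℝ, E) γ t L →
      deriv (chartAt E a ∘ γ) t = toCoord E a (γ t) (L 1) := fun L hL ↦ by
    have h : HasFDerivAt (chartAt E a ∘ γ) ((toCoord E a (γ t)).comp L) t :=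
      (HasMFDerivAt.comp t (hasMFDerivAt_chart ht) hL).hasFDerivAt
    exact h.hasDerivAt.deriv
  exact (h1 _ hγ.hasMFDerivAt).symm

theorem contDiffAt_chart_comp (hγ : ContMDiffAt 𝓘(ℝ, ℝ) 𝓘(ℝ, E) ∞ γ t)
    (ht : γ t ∈ (chartAt E a).source) : ContDiffAt ℝ ∞ (chartAt E a ∘ γ) t :=
  (ContMDiffAt.comp t (contMDiffAt_chart ht) hγ).contDiffAt

omit [NormedSpace ℝ E] [IsManifold 𝓘(ℝ, E) ∞ M] in
theorem eventually_mem_chart_source (hγ : ContinuousAt γ t) (ht : γ t ∈ (chartAt E a).source) :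
    ∀ᶠ τ in 𝓝 t, γ τ ∈ (chartAt E a).source :=
  hγ.eventually ((chartAt E a).open_source.mem_nhds ht)

omit [NormedSpace ℝ E] [IsManifold 𝓘(ℝ, E) ∞ M] in
theorem eventuallyEq_localRep_comp {φ : M → M} (hγ : ContinuousAt γ t)
    (ht : γ t ∈ (chartAt E a).source) :
    chartAt E b ∘ φ ∘ γ =ᶠ[𝓝 t] localRep E a b φ ∘ chartAt E a ∘ γ := by
  filter_upwards [eventually_mem_chart_source hγ ht] with τ hτ
  exact (localRep_chart (b := b) (φ := φ) hτ).symm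

end Curves

namespace SymplecticSymmetricSpace

variable {E : Type*} [NormedAddCommGroup E] [NormedSpace ℝ E] [CompleteSpace E]
  {M : Type*} [TopologicalSpace M] [ChartedSpace E M] [IsManifold 𝓘(ℝ, E) ∞ M]
  (S : SymplecticSymmetricSpace E M) {a b : M} {γ : ℝ → M} {t : ℝ}

/-- The covariant acceleration of a curve, in the preferred chart at `a`. -/
noncomputable def coordAccel (a : M) (c : ℝ → E) (t : ℝ) : E :=
  deriv (deriv c) t + S.christoffel a (c t) (deriv c t) (deriv c t)

omit [CompleteSpace E] in
theorem coordAccel_congr {c c' : ℝ → E} (h : c =ᶠ[𝓝 t] c') :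
    S.coordAccel a c t = S.coordAccel a c' t := by
  rw [coordAccel, coordAccel, h.deriv.deriv_eq, h.deriv_eq, h.eq_of_nhds]

/-- The second derivative of `F ∘ c` contributes `D²F(c', c')`, which the transformation law of the
Christoffel symbols cancels. -/
theorem coordAccel_localRep {φ : M → M} (hφ : S.IsHom φ) (hφs : ContMDiff 𝓘(ℝ, E) 𝓘(ℝ, E) ∞ φ)
    {c : ℝ → E} (hc : ContDiffAt ℝ ∞ c t) (ht : c t ∈ (chartAt E a).target)
    (hφt : φ ((chartAt E a).symm (c t)) ∈ (chartAt E b).source) :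
    S.coordAccel b (localRep E a b φ ∘ c) t =
      fderiv ℝ (localRep E a b φ) (c t) (S.coordAccel a c t) := by
  set F := localRep E a b φ
  have hF : ∀ᶠ τ in 𝓝 t, ContDiffAt ℝ ∞ F (c τ) := by
    filter_upwards [hc.continuousAt.eventually ((isOpen_localRep_dom hφs.continuous a b).mem_nhds
      ⟨ht, hφt⟩)] with τ hτ
    exact contDiffAt_localRep hφs hτ.1 hτ.2
  have hcd : ∀ᶠ τ in 𝓝 t, DifferentiableAt ℝ c τ := by
    filter_upwards [(hc.of_le (m := 1) (by simp)).eventually (by simp)] with τ hτ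
    exact hτ.differentiableAt (by simp)
  have h1 : deriv (F ∘ c) =ᶠ[𝓝 t] fun τ ↦ fderiv ℝ F (c τ) (deriv c τ) := by
    filter_upwards [hF, hcd] with τ h1 h2
    exact fderiv_comp_deriv τ (h1.differentiableAt (by simp)) h2
  have h2 : HasDerivAt (deriv c) (deriv (deriv c) t) t := by
    have : ContDiffAt ℝ ∞ (deriv c) t := by
      have h3 : deriv c = fun τ ↦ fderiv ℝ c τ 1 := funext fun τ ↦ (fderiv_apply_one_eq_deriv).symm
      rw [h3]
      exact (hc.fderiv_right (m := ∞) (by simp)).clm_apply contDiffAt_const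
    exact (this.differentiableAt (by simp)).hasDerivAt
  have h3 : HasDerivAt (fun τ ↦ fderiv ℝ F (c τ)) (fderiv ℝ (fderiv ℝ F) (c t) (deriv c t)) t :=
    ((hF.self_of_nhds.fderiv_right (m := ∞) (by simp)).differentiableAt
      (by simp)).hasFDerivAt.comp_hasDerivAt t hcd.self_of_nhds.hasDerivAt
  have h4 := (h3.clm_apply h2).deriv
  rw [coordAccel, coordAccel, h1.deriv_eq, h4, h1.eq_of_nhds, map_add,
    S.fderiv_fderiv_localRep hφ hφs ht hφt]
  simp only [Function.comp]
  abel

theorem coordAccel_comp_chart {φ : M → M} (hφ : S.IsHom φ)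
    (hφs : ContMDiff 𝓘(ℝ, E) 𝓘(ℝ, E) ∞ φ) (hγ : ContMDiffAt 𝓘(ℝ, ℝ) 𝓘(ℝ, E) ∞ γ t)
    (ht : γ t ∈ (chartAt E a).source) (hφt : φ (γ t) ∈ (chartAt E b).source)
    (h : S.coordAccel a (chartAt E a ∘ γ) t = 0) :
    S.coordAccel b (chartAt E b ∘ φ ∘ γ) t = 0 := by
  rw [S.coordAccel_congr (eventuallyEq_localRep_comp (φ := φ) hγ.continuousAt ht),
    S.coordAccel_localRep hφ hφs (contDiffAt_chart_comp hγ ht) ((chartAt E a).map_source ht)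
      (by rwa [Function.comp, (chartAt E a).left_inv ht]), h, map_zero]

-- The frame in the definition of the acceleration is constant in the chart, so the covariant
-- derivative of a frame field is a pure Christoffel term.
omit [CompleteSpace E] in
theorem acceleration_eq_coordAccel (hγ : ContMDiffAt 𝓘(ℝ, ℝ) 𝓘(ℝ, E) ∞ γ t) :
    (show E from acceleration S.connection γ t) =
      S.coordAccel (γ t) (chartAt E (γ t) ∘ γ) t := by
  have hx := mem_chart_source E (γ t)
  have hd : ∀ᶠ τ in 𝓝 t, MDifferentiableAt 𝓘(ℝ, ℝ) 𝓘(ℝ, E) γ τ := by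
    have := isManifold_one (E := E) (M := M)
    filter_upwards [(contMDiffAt_iff_contMDiffAt_nhds (n := 1) (by simp)).1
      (hγ.of_le (m := 1) (by simp))] with τ hτ
    exact hτ.mdifferentiableAt (by simp)
  obtain ⟨u, hu⟩ : ∃ u : ℝ → E, u = fun τ ↦ (trivializationAt E
    (fun x : M ↦ TangentSpace 𝓘(ℝ, E) x) (γ t) ⟨γ τ, velocity γ τ⟩).2 := ⟨_, rfl⟩
  have h1 : u =ᶠ[𝓝 t] deriv (chartAt E (γ t) ∘ γ) := by
    filter_upwards [hd, eventually_mem_chart_source hγ.continuousAt hx] with τ h1 h2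
    rw [hu]
    exact (trivializationAt_apply h2 _).trans (toCoord_velocity h1 h2)
  have h2 : (show E from velocity γ t) = deriv (chartAt E (γ t) ∘ γ) t :=
    (toCoord_self (γ t) _).symm.trans (toCoord_velocity hd.self_of_nhds hx)
  have h3 : coordField (γ t) (fun y ↦ (trivializationAt E
      (fun x : M ↦ TangentSpace 𝓘(ℝ, E) x) (γ t)).symm y (u t)) =ᶠ[𝓝 (chartAt E (γ t) (γ t))]
        fun _ ↦ u t := by
    filter_upwards [(chartAt E (γ t)).open_target.mem_nhds ((chartAt E (γ t)).map_source hx)]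
      with p hp
    have h4 := (chartAt E (γ t)).map_target hp
    exact (congrArg (toCoord E (γ t) _) (trivializationAt_symm_apply h4 (u t))).trans
      (toCoord_ofCoord h4 (u t))
  have h4 : S.covCoord (γ t) (fun y ↦ (trivializationAt E
      (fun x : M ↦ TangentSpace 𝓘(ℝ, E) x) (γ t)).symm y (u t)) (chartAt E (γ t) (γ t))
        (show E from velocity γ t) = S.christoffel (γ t) (chartAt E (γ t) (γ t))
          (deriv (chartAt E (γ t) ∘ γ) t) (deriv (chartAt E (γ t) ∘ γ) t) := by
    rw [covCoord_apply, h3.fderiv_eq, h3.eq_of_nhds, h2, h1.eq_of_nhds]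
    simp
  have h5 : (show E from acceleration S.connection γ t) = (show E from (trivializationAt E
      (fun x : M ↦ TangentSpace 𝓘(ℝ, E) x) (γ t)).symm (γ t) (deriv u t)) +
      S.covCoord (γ t) (fun y ↦ (trivializationAt E
      (fun x : M ↦ TangentSpace 𝓘(ℝ, E) x) (γ t)).symm y (u t)) (chartAt E (γ t) (γ t))
        (show E from velocity γ t) := by
    rw [hu]; rfl
  have h6 : (show E from (trivializationAt E
      (fun x : M ↦ TangentSpace 𝓘(ℝ, E) x) (γ t)).symm (γ t) (deriv u t)) = deriv u t :=
    (trivializationAt_symm_apply hx _).trans (ofCoord_self (E := E) (γ t) _)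
  rw [h5, h4, h6, h1.deriv_eq]
  rfl

theorem acceleration_eq_zero_iff (hγ : ContMDiffAt 𝓘(ℝ, ℝ) 𝓘(ℝ, E) ∞ γ t)
    (ht : γ t ∈ (chartAt E a).source) :
    acceleration S.connection γ t = 0 ↔ S.coordAccel a (chartAt E a ∘ γ) t = 0 := by
  have h1 : acceleration S.connection γ t = 0 ↔
      S.coordAccel (γ t) (chartAt E (γ t) ∘ γ) t = 0 := by
    rw [← S.acceleration_eq_coordAccel hγ]; rfl
  rw [h1]
  -- The identity is a homomorphism, so vanishing of the acceleration does not depend on the chart.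
  exact ⟨S.coordAccel_comp_chart (φ := id) (fun _ _ ↦ rfl) contMDiff_id hγ (mem_chart_source E _) ht,
    S.coordAccel_comp_chart (φ := id) (fun _ _ ↦ rfl) contMDiff_id hγ ht (mem_chart_source E _)⟩

/-- The curve `γ` solves the geodesic equation at time `t`. -/
def IsGeodesicAt (γ : ℝ → M) (t : ℝ) : Prop :=
  ContMDiffAt 𝓘(ℝ, ℝ) 𝓘(ℝ, E) ∞ γ t ∧ acceleration S.connection γ t = 0

variable {S}

theorem IsGeodesicAt.coordAccel (h : S.IsGeodesicAt γ t) (ht : γ t ∈ (chartAt E a).source) :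
    S.coordAccel a (chartAt E a ∘ γ) t = 0 := (S.acceleration_eq_zero_iff h.1 ht).1 h.2

omit [CompleteSpace E] in
theorem isGeodesicOn_iff {J : Set ℝ} (hJ : IsOpen J) :
    IsGeodesicOn S.connection γ J ↔ ∀ t ∈ J, S.IsGeodesicAt γ t :=
  ⟨fun h t ht ↦ ⟨h.1.contMDiffAt (hJ.mem_nhds ht), h.2 t ht⟩,
    fun h ↦ ⟨fun t ht ↦ (h t ht).1.contMDiffWithinAt, fun t ht ↦ (h t ht).2⟩⟩

theorem IsGeodesicAt.congr {γ' : ℝ → M} (h : S.IsGeodesicAt γ t) (he : γ' =ᶠ[𝓝 t] γ) :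
    S.IsGeodesicAt γ' t := by
  have h1 := h.1.congr_of_eventuallyEq he
  have h2 := mem_chart_source E (γ t)
  refine ⟨h1, (S.acceleration_eq_zero_iff (a := γ t) h1 (by rwa [he.eq_of_nhds])).2 ?_⟩
  rw [S.coordAccel_congr (he.fun_comp (chartAt E (γ t)))]
  exact h.coordAccel h2

theorem IsGeodesicAt.map {φ : M → M} (h : S.IsGeodesicAt γ t) (hφ : S.IsHom φ)
    (hφs : ContMDiff 𝓘(ℝ, E) 𝓘(ℝ, E) ∞ φ) : S.IsGeodesicAt (φ ∘ γ) t := by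
  have h1 : ContMDiffAt 𝓘(ℝ, ℝ) 𝓘(ℝ, E) ∞ (φ ∘ γ) t := ContMDiffAt.comp t (hφs _) h.1
  have h2 := mem_chart_source E (γ t)
  have h3 := mem_chart_source E (φ (γ t))
  exact ⟨h1, (S.acceleration_eq_zero_iff h1 h3).2
    (S.coordAccel_comp_chart hφ hφs h.1 h2 h3 (h.coordAccel h2))⟩

omit [CompleteSpace E] in
theorem coordAccel_comp_add_const (c : ℝ → E) (r t : ℝ) :
    S.coordAccel a (fun τ ↦ c (τ + r)) t = S.coordAccel a c (t + r) := by
  have h1 : deriv (fun τ ↦ c (τ + r)) = fun τ ↦ deriv c (τ + r) :=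
    funext fun τ ↦ deriv_comp_add_const c r τ
  rw [SymplecticSymmetricSpace.coordAccel, h1, deriv_comp_add_const]; rfl

omit [CompleteSpace E] in
theorem coordAccel_comp_const_sub (c : ℝ → E) (r t : ℝ) :
    S.coordAccel a (fun τ ↦ c (r - τ)) t = S.coordAccel a c (r - t) := by
  have h1 : deriv (fun τ ↦ c (r - τ)) = fun τ ↦ -deriv c (r - τ) :=
    funext fun τ ↦ deriv_comp_const_sub c r τ
  have h2 : deriv (fun τ ↦ -deriv c (r - τ)) t = deriv (deriv c) (r - t) := by
    rw [deriv.fun_neg, deriv_comp_const_sub, neg_neg]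
  rw [SymplecticSymmetricSpace.coordAccel, h1, h2]
  simp [SymplecticSymmetricSpace.coordAccel]

theorem IsGeodesicAt.comp_add_const {r : ℝ} (h : S.IsGeodesicAt γ (t + r)) :
    S.IsGeodesicAt (fun τ ↦ γ (τ + r)) t := by
  have h1 : ContMDiffAt 𝓘(ℝ, ℝ) 𝓘(ℝ, E) ∞ (fun τ ↦ γ (τ + r)) t :=
    ContMDiffAt.comp (g := γ) (f := fun τ ↦ τ + r) t h.1
      (contDiff_id.add contDiff_const).contMDiff.contMDiffAt
  have h2 := mem_chart_source E (γ (t + r))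
  exact ⟨h1, (S.acceleration_eq_zero_iff h1 h2).2
    ((coordAccel_comp_add_const (chartAt E (γ (t + r)) ∘ γ) r t).trans (h.coordAccel h2))⟩

theorem IsGeodesicAt.comp_const_sub {r : ℝ} (h : S.IsGeodesicAt γ (r - t)) :
    S.IsGeodesicAt (fun τ ↦ γ (r - τ)) t := by
  have h1 : ContMDiffAt 𝓘(ℝ, ℝ) 𝓘(ℝ, E) ∞ (fun τ ↦ γ (r - τ)) t :=
    ContMDiffAt.comp (g := γ) (f := fun τ ↦ r - τ) t h.1
      (contDiff_const.sub contDiff_id).contMDiff.contMDiffAt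
  have h2 := mem_chart_source E (γ (r - t))
  exact ⟨h1, (S.acceleration_eq_zero_iff h1 h2).2
    ((coordAccel_comp_const_sub (chartAt E (γ (r - t)) ∘ γ) r t).trans (h.coordAccel h2))⟩

end SymplecticSymmetricSpace

end SymplecticSymmetric

/-! ### Existence, uniqueness and reflection of geodesics -/

namespace SymplecticSymmetric

open Filter

section ODE

variable {G : Type*} [NormedAddCommGroup G] [NormedSpace ℝ G]

/-- Picard–Lindelöf, followed by bootstrapping: `α' = f ∘ α` is as regular as `α`, so each order
yields the next on the same interval. -/
theorem exists_contDiffAt_hasDerivAt [CompleteSpace G] {f : G → G} {U : Set G} (hU : IsOpen U)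
    (hf : ContDiffOn ℝ ∞ f U) {x₀ : G} (hx₀ : x₀ ∈ U) :
    ∃ α : ℝ → G, α 0 = x₀ ∧ ∃ ε > (0 : ℝ), ∀ t ∈ Set.Ioo (-ε) ε,
      HasDerivAt α (f (α t)) t ∧ ContDiffAt ℝ ∞ α t ∧ α t ∈ U := by
  have hf0 : ContDiffAt ℝ 1 f x₀ := (hf.contDiffAt (hU.mem_nhds hx₀)).of_le (by simp)
  obtain ⟨α, hα0, ε, hε, hα⟩ :=
    hf0.exists_forall_mem_closedBall_exists_eq_forall_mem_Ioo_hasDerivAt₀ 0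
  simp only [zero_sub, zero_add] at hα
  have hc : ContinuousAt α 0 := (hα 0 ⟨by linarith, hε⟩).continuousAt
  obtain ⟨δ, hδ, hδU⟩ := Metric.eventually_nhds_iff_ball.1
    (hc.eventually (by rw [hα0]; exact hU.mem_nhds hx₀))
  have hI : ∀ t ∈ Set.Ioo (-min ε δ) (min ε δ), HasDerivAt α (f (α t)) t ∧ α t ∈ U := by
    intro t ht
    refine ⟨hα t ⟨by linarith [ht.1, min_le_left ε δ], by linarith [ht.2, min_le_left ε δ]⟩,
      hδU t ?_⟩
    rw [Real.ball_eq_Ioo]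
    exact ⟨by linarith [ht.1, min_le_right ε δ], by linarith [ht.2, min_le_right ε δ]⟩
  refine ⟨α, hα0, min ε δ, lt_min hε hδ, fun t ht ↦ ⟨(hI t ht).1, ?_, (hI t ht).2⟩⟩
  have hn : ∀ n : ℕ, ContDiffOn ℝ n α (Set.Ioo (-min ε δ) (min ε δ)) := by
    intro n
    induction n with
    | zero =>
      exact contDiffOn_zero.2 fun t ht ↦ (hI t ht).1.continuousAt.continuousWithinAt
    | succ n ih =>
      push_cast
      rw [contDiffOn_succ_iff_deriv_of_isOpen isOpen_Ioo]
      refine ⟨fun t ht ↦ (hI t ht).1.differentiableAt.differentiableWithinAt, by simp, ?_⟩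
      refine ContDiffOn.congr (f := f ∘ α) ?_ fun t ht ↦ (hI t ht).1.deriv
      exact (hf.of_le (by exact_mod_cast le_top)).comp ih fun t ht ↦ (hI t ht).2
  exact (contDiffOn_infty.2 hn).contDiffAt (isOpen_Ioo.mem_nhds ht)

theorem eventuallyEq_of_hasDerivAt {f : G → G} {α β : ℝ → G} {t : ℝ}
    (hf : ContDiffAt ℝ 1 f (α t)) (hα : ∀ᶠ τ in 𝓝 t, HasDerivAt α (f (α τ)) τ)
    (hβ : ∀ᶠ τ in 𝓝 t, HasDerivAt β (f (β τ)) τ) (h : α t = β t) : α =ᶠ[𝓝 t] β := by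
  obtain ⟨K, s, hs, hK⟩ := hf.exists_lipschitzOnWith
  have h1 := hα.self_of_nhds.continuousAt.eventually hs
  have h2 := hβ.self_of_nhds.continuousAt.eventually (h ▸ hs)
  exact ODE_solution_unique_of_eventually (v := fun _ ↦ f) (s := fun _ ↦ s)
    (Eventually.of_forall fun _ ↦ hK) (hα.and h1) (hβ.and h2) h

end ODE

namespace SymplecticSymmetricSpace

variable {E : Type*} [NormedAddCommGroup E] [NormedSpace ℝ E] [CompleteSpace E]
  {M : Type*} [TopologicalSpace M] [ChartedSpace E M] [IsManifold 𝓘(ℝ, E) ∞ M]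
  {S : SymplecticSymmetricSpace E M} {a b : M} {γ γ' : ℝ → M} {t : ℝ}

/-- The geodesic spray in the preferred chart at `a`. -/
noncomputable def spray (S : SymplecticSymmetricSpace E M) (a : M) (q : E × E) : E × E :=
  (q.2, -S.christoffel a q.1 q.2 q.2)

omit [CompleteSpace E] in
theorem contDiffOn_spray (S : SymplecticSymmetricSpace E M) (a : M) :
    ContDiffOn ℝ ∞ (S.spray a) ((chartAt E a).target ×ˢ Set.univ) := by
  have h1 : ContDiffOn ℝ ∞ (fun q : E × E ↦ S.christoffel a q.1)
      ((chartAt E a).target ×ˢ Set.univ) :=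
    (S.contDiffOn_christoffel a).comp contDiff_fst.contDiffOn fun q hq ↦ hq.1
  exact contDiff_snd.contDiffOn.prodMk
    ((h1.clm_apply contDiff_snd.contDiffOn).clm_apply contDiff_snd.contDiffOn).neg

theorem exists_isGeodesicAt (S : SymplecticSymmetricSpace E M) (x : M) (v : E) :
    ∃ γ : ℝ → M, γ 0 = x ∧ deriv (chartAt E x ∘ γ) 0 = v ∧
      ∃ ε > (0 : ℝ), ∀ t ∈ Set.Ioo (-ε) ε, S.IsGeodesicAt γ t := by
  have hx := mem_chart_source E x
  obtain ⟨α, hα0, ε, hε, hα⟩ := exists_contDiffAt_hasDerivAt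
    ((chartAt E x).open_target.prod isOpen_univ) (S.contDiffOn_spray x)
    (x₀ := (chartAt E x x, v)) ⟨(chartAt E x).map_source hx, Set.mem_univ _⟩
  have ht : ∀ t ∈ Set.Ioo (-ε) ε, (α t).1 ∈ (chartAt E x).target := fun t ht ↦ (hα t ht).2.2.1
  have hI : ∀ t ∈ Set.Ioo (-ε) ε, chartAt E x ∘ (fun τ ↦ (chartAt E x).symm (α τ).1) =ᶠ[𝓝 t]
      fun τ ↦ (α τ).1 := fun t h ↦ by
    filter_upwards [isOpen_Ioo.mem_nhds h] with τ hτ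
    exact (chartAt E x).right_inv (ht τ hτ)
  have hd : ∀ t ∈ Set.Ioo (-ε) ε, HasDerivAt (fun τ ↦ (α τ).1) (α t).2 t := fun t h ↦
    (hα t h).1.fst
  refine ⟨fun t ↦ (chartAt E x).symm (α t).1, by simp [hα0, (chartAt E x).left_inv hx], ?_,
    ε, hε, fun t h ↦ ?_⟩
  · have h0 : (0 : ℝ) ∈ Set.Ioo (-ε) ε := ⟨by linarith, hε⟩
    rw [(hI 0 h0).deriv_eq, (hd 0 h0).deriv, hα0]
  · have h1 : ContMDiffAt 𝓘(ℝ, ℝ) 𝓘(ℝ, E) ∞ (fun t ↦ (chartAt E x).symm (α t).1) t :=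
      ContMDiffAt.comp (g := (chartAt E x).symm) (f := fun t ↦ (α t).1) t
        (contMDiffAt_chart_symm (ht t h)) (hα t h).2.1.fst.contMDiffAt
    refine ⟨h1, (S.acceleration_eq_zero_iff (a := x) h1 ((chartAt E x).map_target (ht t h))).2 ?_⟩
    rw [S.coordAccel_congr (hI t h), coordAccel, (hd t h).deriv]
    have h2 : deriv (fun τ ↦ (α τ).1) =ᶠ[𝓝 t] fun τ ↦ (α τ).2 := by
      filter_upwards [isOpen_Ioo.mem_nhds h] with τ hτ
      exact (hd τ hτ).deriv
    have h3 : HasDerivAt (fun τ ↦ (α τ).2) (-S.christoffel x (α t).1 (α t).2 (α t).2) t :=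
      (hα t h).1.snd
    rw [h2.deriv_eq, h3.deriv, neg_add_cancel]

omit [CompleteSpace E] in
theorem _root_.SymplecticSymmetric.contDiffAt_deriv {c : ℝ → E} (hc : ContDiffAt ℝ ∞ c t) :
    ContDiffAt ℝ ∞ (deriv c) t := by
  have h3 : deriv c = fun τ ↦ fderiv ℝ c τ 1 := funext fun τ ↦ (fderiv_apply_one_eq_deriv).symm
  rw [h3]
  exact (hc.fderiv_right (m := ∞) (by simp)).clm_apply contDiffAt_const

theorem IsGeodesicAt.hasDerivAt_spray (h : S.IsGeodesicAt γ t)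
    (ht : γ t ∈ (chartAt E a).source) :
    HasDerivAt (fun τ ↦ (chartAt E a (γ τ), deriv (chartAt E a ∘ γ) τ))
      (S.spray a (chartAt E a (γ t), deriv (chartAt E a ∘ γ) t)) t := by
  have h1 := contDiffAt_chart_comp h.1 ht
  have h2 : HasDerivAt (chartAt E a ∘ γ) (deriv (chartAt E a ∘ γ) t) t :=
    (h1.differentiableAt (by simp)).hasDerivAt
  have h3 := ((contDiffAt_deriv h1).differentiableAt (by simp)).hasDerivAt
  have h4 : deriv (deriv (chartAt E a ∘ γ)) t = -S.christoffel a (chartAt E a (γ t))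
      (deriv (chartAt E a ∘ γ) t) (deriv (chartAt E a ∘ γ) t) :=
    eq_neg_of_add_eq_zero_left (h.coordAccel ht)
  rw [h4] at h3
  exact h2.prodMk h3

/-- Position and velocity form an integral curve of the spray, to which local uniqueness for
ordinary differential equations applies. -/
theorem eventuallyEq_of_isGeodesicAt (hγ : ∀ᶠ τ in 𝓝 t, S.IsGeodesicAt γ τ)
    (hγ' : ∀ᶠ τ in 𝓝 t, S.IsGeodesicAt γ' τ) (ht : γ t ∈ (chartAt E a).source)
    (h : γ t = γ' t) (hd : deriv (chartAt E a ∘ γ) t = deriv (chartAt E a ∘ γ') t) :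
    γ =ᶠ[𝓝 t] γ' := by
  have hs := eventually_mem_chart_source hγ.self_of_nhds.1.continuousAt ht
  have hs' := eventually_mem_chart_source hγ'.self_of_nhds.1.continuousAt (h ▸ ht)
  have h1 := eventuallyEq_of_hasDerivAt (f := S.spray a)
    (α := fun τ ↦ (chartAt E a (γ τ), deriv (chartAt E a ∘ γ) τ))
    (β := fun τ ↦ (chartAt E a (γ' τ), deriv (chartAt E a ∘ γ') τ)) (t := t)
    (((S.contDiffOn_spray a).contDiffAt (((chartAt E a).open_target.prod isOpen_univ).mem_nhds
      ⟨(chartAt E a).map_source ht, Set.mem_univ _⟩)).of_le (by simp))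
    ((hγ.and hs).mono fun τ hτ ↦ hτ.1.hasDerivAt_spray hτ.2)
    ((hγ'.and hs').mono fun τ hτ ↦ hτ.1.hasDerivAt_spray hτ.2) (by simp only [h, hd])
  filter_upwards [h1, hs, hs'] with τ hτ h2 h3
  exact (chartAt E a).injOn h2 h3 (congrArg Prod.fst hτ)

/-- The times at which the germs agree form an open set. It is closed in `J`, because at a limit
time positions and velocities agree by continuity, so local uniqueness applies again. -/
theorem eqOn_of_isGeodesicAt [T2Space M] {J : Set ℝ} (hJ : IsOpen J) (hJc : J.OrdConnected)
    (hγ : ∀ τ ∈ J, S.IsGeodesicAt γ τ) (hγ' : ∀ τ ∈ J, S.IsGeodesicAt γ' τ) (htJ : t ∈ J)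
    (ht : γ t ∈ (chartAt E a).source) (h : γ t = γ' t)
    (hd : deriv (chartAt E a ∘ γ) t = deriv (chartAt E a ∘ γ') t) : Set.EqOn γ γ' J := by
  have hev : ∀ τ ∈ J, ∀ᶠ σ in 𝓝 τ, S.IsGeodesicAt γ σ ∧ S.IsGeodesicAt γ' σ := fun τ hτ ↦ by
    filter_upwards [hJ.mem_nhds hτ] with σ hσ
    exact ⟨hγ σ hσ, hγ' σ hσ⟩
  have hopen : IsOpen {τ | γ =ᶠ[𝓝 τ] γ'} := isOpen_iff_mem_nhds.2 fun τ hτ ↦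
    (eventually_eventually_nhds (p := fun σ ↦ γ σ = γ' σ)).2 hτ
  have key : J ⊆ {τ | γ =ᶠ[𝓝 τ] γ'} := by
    refine hJc.isPreconnected.subset_of_closure_inter_subset hopen ⟨t, htJ,
      eventuallyEq_of_isGeodesicAt ((hev t htJ).mono fun _ h ↦ h.1)
        ((hev t htJ).mono fun _ h ↦ h.2) ht h hd⟩ ?_
    rintro τ ⟨hτ, hτJ⟩
    have hτ' : ∃ᶠ σ in 𝓝 τ, γ =ᶠ[𝓝 σ] γ' := mem_closure_iff_frequently.1 hτ
    have h1 : γ τ = γ' τ := tendsto_nhds_unique_of_frequently_eq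
      (hγ τ hτJ).1.continuousAt (hγ' τ hτJ).1.continuousAt (hτ'.mono fun σ hσ ↦ hσ.eq_of_nhds)
    have hx := mem_chart_source E (γ τ)
    have h2 : deriv (chartAt E (γ τ) ∘ γ) τ = deriv (chartAt E (γ τ) ∘ γ') τ :=
      tendsto_nhds_unique_of_frequently_eq
        (contDiffAt_deriv (contDiffAt_chart_comp (hγ τ hτJ).1 hx)).continuousAt
        (contDiffAt_deriv (contDiffAt_chart_comp (hγ' τ hτJ).1 (h1 ▸ hx))).continuousAt
        (hτ'.mono fun σ hσ ↦ (hσ.fun_comp (chartAt E (γ τ))).deriv_eq)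
    exact eventuallyEq_of_isGeodesicAt ((hev τ hτJ).mono fun _ h ↦ h.1)
      ((hev τ hτJ).mono fun _ h ↦ h.2) hx h1 h2
  exact fun τ hτ ↦ Filter.EventuallyEq.eq_of_nhds (key hτ)

/-- The symmetry at a point of a geodesic reverses the geodesic. -/
theorem s_geodesic [T2Space M] {J : Set ℝ} (hJ : IsOpen J) (hJc : J.OrdConnected)
    (hγ : ∀ τ ∈ J, S.IsGeodesicAt γ τ) {r u : ℝ} (hr : r ∈ J) (hu : u ∈ J) (hu' : 2 * r - u ∈ J) :
    S.s (γ r) (γ u) = γ (2 * r - u) := by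
  have hx := mem_chart_source E (γ r)
  have hrr : 2 * r - r = r := by ring
  -- The reflected curve is a geodesic only for times whose reflection lies in `J`, so uniqueness is
  -- applied on the part of `J` symmetric about `r`.
  have hK : IsOpen (J ∩ (fun τ ↦ 2 * r - τ) ⁻¹' J) :=
    hJ.inter (hJ.preimage (by fun_prop))
  have hKc : (J ∩ (fun τ ↦ 2 * r - τ) ⁻¹' J).OrdConnected := by
    refine hJc.inter ⟨fun x hx y hy z hz ↦ hJc.out hy hx ⟨?_, ?_⟩⟩ <;> linarith [hz.1, hz.2]
  refine eqOn_of_isGeodesicAt (S := S) (t := r) (a := γ r) (γ := S.s (γ r) ∘ γ)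
    (γ' := fun τ ↦ γ (2 * r - τ)) hK hKc
    (fun τ hτ ↦ (hγ τ hτ.1).map (S.isHom_s (γ r)) (S.contMDiff_s _))
    (fun τ hτ ↦ IsGeodesicAt.comp_const_sub (hγ _ hτ.2)) ⟨hr, by simpa [hrr] using hr⟩
    (by rw [Function.comp, S.fixed]; exact hx) (by simp [S.fixed, hrr]) ?_ ⟨hu, hu'⟩
  -- Both curves pass through `γ(r)` with velocity `-γ'(r)`: one by the chain rule in time, the
  -- other by the differential `-1` of the symmetry.
  have h1 : deriv (fun τ ↦ (chartAt E (γ r) ∘ γ) (2 * r - τ)) r =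
      -deriv (chartAt E (γ r) ∘ γ) r := by
    rw [deriv_comp_const_sub, hrr]
  refine Eq.trans ?_ h1.symm
  rw [(eventuallyEq_localRep_comp (φ := S.s (γ r)) (hγ r hr).1.continuousAt hx).deriv_eq]
  have h2 : DifferentiableAt ℝ (localRep E (γ r) (γ r) (S.s (γ r))) ((chartAt E (γ r) ∘ γ) r) :=
    (contDiffAt_localRep (S.contMDiff_s _) ((chartAt E (γ r)).map_source hx) (by
      rw [(chartAt E (γ r)).left_inv hx, S.fixed]; exact hx)).differentiableAt (by simp)
  rw [fderiv_comp_deriv r h2 ((contDiffAt_chart_comp (hγ r hr).1 hx).differentiableAt (by simp))]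
  have h3 := fderiv_localRep_self (S.contMDiff_s (γ r)) (γ r) (deriv (chartAt E (γ r) ∘ γ) r)
  rw [S.fixed] at h3
  exact h3.trans (S.tangentCLM_symmetry (γ r) _)

end SymplecticSymmetricSpace

end SymplecticSymmetric

/-! ### Geodesic completeness -/

namespace SymplecticSymmetric

open Filter

namespace SymplecticSymmetricSpace

variable {E : Type*} [NormedAddCommGroup E] [NormedSpace ℝ E] [CompleteSpace E]
  {M : Type*} [TopologicalSpace M] [T2Space M] [ChartedSpace E M] [IsManifold 𝓘(ℝ, E) ∞ M]
  {S : SymplecticSymmetricSpace E M} {γ : ℝ → M}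

/-- Reflecting at `γ(0)` and then at `γ(c/2)` moves `γ(u)` to `γ(u + c)`. This product is an
automorphism, so its powers carry a short piece of `γ` along the whole line and preserve the
geodesic equation. -/
theorem exists_forall_isGeodesicAt_of_Ioo {ε : ℝ} (hε : 0 < ε)
    (hγ : ∀ t ∈ Set.Ioo (-ε) ε, S.IsGeodesicAt γ t) :
    ∃ γ' : ℝ → M, (∀ t, S.IsGeodesicAt γ' t) ∧ Set.EqOn γ γ' (Set.Ioo (-ε) ε) := by
  -- With this step the remainder of any time modulo `c` lies in `[0, c)`, well inside the interval,
  -- and consecutive translated pieces overlap.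
  set c := ε / 2 with hc
  have hc0 : 0 < c := by positivity
  set T : Diffeo E M := S.symmetry (γ (c / 2)) * S.symmetry (γ 0) with hT
  have hTm : T ∈ S.aut := mul_mem (S.symmetry_mem_aut _) (S.symmetry_mem_aut _)
  have hT1 : ∀ u ∈ Set.Ioo (-ε) ε, u + c ∈ Set.Ioo (-ε) ε → T (γ u) = γ (u + c) := by
    intro u hu hu'
    have h1 : S.s (γ 0) (γ u) = γ (-u) := by
      have := s_geodesic isOpen_Ioo Set.ordConnected_Ioo hγ (r := 0) (u := u)
        ⟨by linarith, hε⟩ hu ⟨by linarith [hu.2], by linarith [hu.1]⟩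
      rwa [mul_zero, zero_sub] at this
    have h2 : S.s (γ (c / 2)) (γ (-u)) = γ (u + c) := by
      have := s_geodesic isOpen_Ioo Set.ordConnected_Ioo hγ (r := c / 2) (u := -u)
        ⟨by linarith, by linarith⟩ ⟨by linarith [hu.2], by linarith [hu.1]⟩
        ⟨by linarith [hu'.1], by linarith [hu'.2]⟩
      rw [this]; congr 1; ring
    change S.s (γ (c / 2)) (S.s (γ 0) (γ u)) = _
    rw [h1, h2]
  have hTk : ∀ (k : ℕ) (u : ℝ), u ∈ Set.Ioo (-ε) ε → u + k * c ∈ Set.Ioo (-ε) ε →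
      (T ^ k) (γ u) = γ (u + k * c) := by
    intro k
    induction k with
    | zero => intro u _ _; simp; rfl
    | succ k ih =>
      intro u hu hu'
      push_cast at hu' ⊢
      have hk : (0 : ℝ) ≤ k * c := by positivity
      have h1 : u + k * c ∈ Set.Ioo (-ε) ε :=
        ⟨by linarith [hu.1], by linarith [hu'.2]⟩
      have e : u + (k + 1) * c = u + k * c + c := by ring
      rw [e] at hu' ⊢
      rw [pow_succ', mul_apply, ih u hu h1, hT1 _ h1 hu']
  -- Independence of the number of steps used to reach `t`, which gives consistency on the overlaps.
  have hle : ∀ (n m : ℤ) (t : ℝ), n ≤ m → t - n * c ∈ Set.Ioo (-ε) ε →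
      t - m * c ∈ Set.Ioo (-ε) ε → (T ^ n) (γ (t - n * c)) = (T ^ m) (γ (t - m * c)) := by
    intro n m t hnm hn hm
    obtain ⟨k, rfl⟩ := Int.le.dest hnm
    have e : t - n * c = t - ((n + k : ℤ) : ℝ) * c + k * c := by push_cast; ring
    rw [e] at hn ⊢
    rw [← hTk k _ hm hn, zpow_add, zpow_natCast, mul_apply]
  have hwd : ∀ (n m : ℤ) (t : ℝ), t - n * c ∈ Set.Ioo (-ε) ε →
      t - m * c ∈ Set.Ioo (-ε) ε → (T ^ n) (γ (t - n * c)) = (T ^ m) (γ (t - m * c)) := by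
    intro n m t hn hm
    rcases le_total n m with h | h
    · exact hle n m t h hn hm
    · exact (hle m n t h hm hn).symm
  have hfl : ∀ t : ℝ, t - ⌊t / c⌋ * c ∈ Set.Ioo (-ε) ε := fun t ↦ by
    have h1 := Int.floor_le (t / c)
    have h2 := Int.lt_floor_add_one (t / c)
    rw [le_div_iff₀ hc0] at h1
    rw [div_lt_iff₀ hc0] at h2
    constructor <;> nlinarith
  refine ⟨fun t ↦ (T ^ ⌊t / c⌋) (γ (t - ⌊t / c⌋ * c)), fun t ↦ ?_, fun t ht ↦ ?_⟩
  -- Although the integer part jumps, near `t` it may be frozen at its value at `t`, because all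
  -- admissible step numbers give the same point.
  · have h1 : (fun τ ↦ (T ^ ⌊τ / c⌋) (γ (τ - ⌊τ / c⌋ * c))) =ᶠ[𝓝 t]
        (T ^ ⌊t / c⌋ : Diffeo E M) ∘ fun τ ↦ γ (τ + -(⌊t / c⌋ * c)) := by
      have hcont : Continuous fun τ : ℝ ↦ τ - ⌊t / c⌋ * c := by fun_prop
      filter_upwards [(isOpen_Ioo.preimage hcont).mem_nhds (hfl t)] with τ hτ
      rw [hwd _ _ τ (hfl τ) hτ, Function.comp, sub_eq_add_neg]
    refine IsGeodesicAt.congr ?_ h1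
    exact (IsGeodesicAt.comp_add_const (hγ _ (hfl t))).map
      (isHom_aut ⟨T ^ ⌊t / c⌋, zpow_mem hTm _⟩) (T ^ ⌊t / c⌋ : Diffeo E M).contMDiff
  · have h0 : t - (0 : ℤ) * c ∈ Set.Ioo (-ε) ε := by simpa using ht
    have h1 := hwd 0 ⌊t / c⌋ t h0 (hfl t)
    simp only [Int.cast_zero, zero_mul, sub_zero, zpow_zero] at h1
    exact h1

theorem exists_forall_isGeodesicAt (S : SymplecticSymmetricSpace E M) (x : M) (v : E) :
    ∃ γ : ℝ → M, γ 0 = x ∧ deriv (chartAt E x ∘ γ) 0 = v ∧ ∀ t, S.IsGeodesicAt γ t := by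
  obtain ⟨γ, h0, hv, ε, hε, hγ⟩ := S.exists_isGeodesicAt x v
  obtain ⟨γ', hγ', he⟩ := exists_forall_isGeodesicAt_of_Ioo hε hγ
  have hm : (0 : ℝ) ∈ Set.Ioo (-ε) ε := ⟨by linarith, hε⟩
  refine ⟨γ', by rw [← he hm, h0], ?_, hγ'⟩
  have h1 : γ =ᶠ[𝓝 0] γ' := he.eventuallyEq_of_mem (isOpen_Ioo.mem_nhds hm)
  rw [← (h1.fun_comp (chartAt E x)).deriv_eq, ← hv]

theorem isComplete_connection [Nonempty M] (S : SymplecticSymmetricSpace E M) :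
    IsComplete S.connection := by
  refine ⟨fun x v ↦ ?_, fun J γ hJ hJc hγ ↦ ?_⟩
  · obtain ⟨γ, rfl, hv, hγ⟩ := S.exists_forall_isGeodesicAt x v
    refine ⟨γ, (isGeodesicOn_iff isOpen_univ).2 fun t _ ↦ hγ t, ?_⟩
    have h1 : (show E from velocity γ 0) = v :=
      (toCoord_self (E := E) (γ 0) _).symm.trans ((toCoord_velocity
        ((hγ 0).1.mdifferentiableAt (by simp)) (mem_chart_source E _)).trans hv)
    exact congrArg (TotalSpace.mk (γ 0)) h1
  · rw [isGeodesicOn_iff hJ] at hγ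
    rcases J.eq_empty_or_nonempty with rfl | ⟨t, ht⟩
    -- On the empty set of times any complete geodesic is an extension.
    · obtain ⟨γ', -, -, hγ'⟩ := S.exists_forall_isGeodesicAt (Classical.arbitrary M) 0
      exact ⟨γ', (isGeodesicOn_iff isOpen_univ).2 fun t _ ↦ hγ' t, Set.eqOn_empty _ _⟩
    · obtain ⟨γ', h0, hv, hγ'⟩ := S.exists_forall_isGeodesicAt (γ t)
        (deriv (chartAt E (γ t) ∘ γ) t)
      have h1 : ∀ τ, S.IsGeodesicAt (fun τ ↦ γ' (τ + -t)) τ := fun τ ↦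
        IsGeodesicAt.comp_add_const (hγ' _)
      refine ⟨_, (isGeodesicOn_iff isOpen_univ).2 fun τ _ ↦ h1 τ,
        eqOn_of_isGeodesicAt hJ hJc hγ (fun τ _ ↦ h1 τ) ht (mem_chart_source E _)
          (by simp [h0]) ?_⟩
      have h2 := deriv_comp_add_const (chartAt E (γ t) ∘ γ') (-t) t
      rw [add_neg_cancel, hv] at h2
      exact h2.symm

end SymplecticSymmetricSpace

end SymplecticSymmetric

/-! ### Affine transformations are determined by a 1-jet -/

namespace SymplecticSymmetric

open Filter

section TotalDifferential

variable {E G : Type*} [NormedAddCommGroup E] [NormedSpace ℝ E] [NormedAddCommGroup G]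
  [NormedSpace ℝ G]

/-- Local uniqueness for total differential equations `DH(z) = V(z, H(z))`. -/
theorem eventuallyEq_of_hasFDerivAt {V : E × G → E →L[ℝ] G} {H₁ H₂ : E → G} {p : E}
    (hV : ContDiffAt ℝ 1 V (p, H₁ p)) (h₁ : ∀ᶠ z in 𝓝 p, HasFDerivAt H₁ (V (z, H₁ z)) z)
    (h₂ : ∀ᶠ z in 𝓝 p, HasFDerivAt H₂ (V (z, H₂ z)) z) (h : H₁ p = H₂ p) : H₁ =ᶠ[𝓝 p] H₂ := by
  obtain ⟨K, s, hs, hK⟩ := hV.exists_lipschitzOnWith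
  have c1 : ∀ᶠ z in 𝓝 p, (z, H₁ z) ∈ s :=
    (continuousAt_id.prodMk h₁.self_of_nhds.continuousAt).eventually hs
  have c2 : ∀ᶠ z in 𝓝 p, (z, H₂ z) ∈ s :=
    (continuousAt_id.prodMk h₂.self_of_nhds.continuousAt).eventually
      (show s ∈ 𝓝 (id p, H₂ p) by rw [← h]; exact hs)
  obtain ⟨r, hr, hb⟩ := Metric.eventually_nhds_iff_ball.1 (((h₁.and h₂).and c1).and c2)
  filter_upwards [Metric.ball_mem_nhds p hr] with z hz
  -- On the segment from `p` to `z` the difference of the solutions satisfies `‖D'‖ ≤ K ‖z - p‖ ‖D‖`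
  -- and vanishes at the start, hence everywhere by Grönwall.
  set D : ℝ → G := fun t ↦ H₁ (p + t • (z - p)) - H₂ (p + t • (z - p))
  have hmem : ∀ t ∈ Set.Icc (0 : ℝ) 1, p + t • (z - p) ∈ Metric.ball p r := fun t ht ↦
    (convex_ball p r).add_smul_sub_mem (Metric.mem_ball_self hr) hz ht
  have hD : ∀ t ∈ Set.Icc (0 : ℝ) 1, HasDerivAt D (V (p + t • (z - p), H₁ (p + t • (z - p))) (z - p)
      - V (p + t • (z - p), H₂ (p + t • (z - p))) (z - p)) t := fun t ht ↦ by
    have hl : HasDerivAt (fun t : ℝ ↦ p + t • (z - p)) (z - p) t := by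
      simpa using ((hasDerivAt_id t).smul_const (z - p)).const_add p
    obtain ⟨⟨⟨d1, d2⟩, -⟩, -⟩ := hb _ (hmem t ht)
    exact (d1.comp_hasDerivAt t hl).sub (d2.comp_hasDerivAt t hl)
  have h0 := eq_zero_of_abs_deriv_le_mul_abs_self_of_eq_zero_right (f := D) (a := 0) (b := 1)
    (K := K * ‖z - p‖) (fun t ht ↦ (hD t ht).continuousAt.continuousWithinAt)
    (fun t ht ↦ (hD t (Set.Ico_subset_Icc_self ht)).hasDerivWithinAt) (by simp [D, h])
    (fun t ht ↦ by
      obtain ⟨⟨-, m1⟩, m2⟩ := hb _ (hmem t (Set.Ico_subset_Icc_self ht))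
      rw [← sub_apply]
      refine (ContinuousLinearMap.le_opNorm _ _).trans ?_
      have h1 := hK.dist_le_mul _ m1 _ m2
      rw [dist_eq_norm, dist_eq_norm, Prod.mk_sub_mk, sub_self, Prod.norm_mk, norm_zero,
        max_eq_right (norm_nonneg _)] at h1
      calc _ ≤ K * ‖D t‖ * ‖z - p‖ := by gcongr
        _ = _ := by ring)
    1 ⟨zero_le_one, le_rfl⟩
  simpa [D, sub_eq_zero] using h0

end TotalDifferential

namespace SymplecticSymmetricSpace

variable {E : Type*} [NormedAddCommGroup E] [NormedSpace ℝ E] [FiniteDimensional ℝ E]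
  [CompleteSpace E]
  {M : Type*} [TopologicalSpace M] [T2Space M] [ChartedSpace E M] [IsManifold 𝓘(ℝ, E) ∞ M]
  (S : SymplecticSymmetricSpace E M) {a b : M}

/-- The transformation law of the Christoffel symbols under affine transformations. -/
theorem fderiv_fderiv_localRep_of_isAffineTransformation {φ : Diffeo E M}
    (hφ : IsAffineTransformation S.connection φ)
    {p : E} (hp : p ∈ (chartAt E a).target)
    (hφp : φ ((chartAt E a).symm p) ∈ (chartAt E b).source) (v w : E) :
    fderiv ℝ (fderiv ℝ (localRep E a b φ)) p v w =
      fderiv ℝ (localRep E a b φ) p (S.christoffel a p v w) -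
        S.christoffel b (localRep E a b φ p) (fderiv ℝ (localRep E a b φ) p v)
          (fderiv ℝ (localRep E a b φ) p w) := by
  set F := localRep E a b φ with hF
  obtain ⟨y, hy⟩ : ∃ y, y = (chartAt E a).symm p := ⟨_, rfl⟩
  have hya : y ∈ (chartAt E a).source := hy ▸ (chartAt E a).map_target hp
  have hyp : chartAt E a y = p := by rw [hy, (chartAt E a).right_inv hp]
  have hφy : φ y ∈ (chartAt E b).source := hy ▸ hφp
  have hFp : F p = chartAt E b (φ y) := by rw [hF, localRep, hy]
  have hFs : ContDiffAt ℝ ∞ F p := contDiffAt_localRep φ.contMDiff hp hφp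
  -- For a field with constant components near `p` the covariant derivative is just the Christoffel
  -- term, so the affine condition on it reveals the second derivative of `φ`.
  obtain ⟨Z, hZ, hZe⟩ := exists_isSmoothField_eventuallyEq_constField hya w
  have hZc : coordField a Z =ᶠ[𝓝 p] fun _ ↦ w := by
    have h1 := (chartAt E a).continuousAt_symm hp
    rw [hy] at hZe
    filter_upwards [h1.eventually hZe, (chartAt E a).open_target.mem_nhds hp] with q hq hqt
    rw [← coordField_constField w hqt]
    exact congrArg (toCoord E a _) hq
  have hDF : ∀ u : E, toCoord E b (φ y) (tangentCLM E φ y u) = fderiv ℝ F p (toCoord E a y u) :=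
    fun u ↦ by
      rw [← hyp]
      exact (fderiv_localRep_toCoord φ.contMDiff hya hφy u).symm
  have h1 := congrArg (toCoord E b (φ y)) (hφ.tangentCLM_covAt hZ y (ofCoord E a y v))
  rw [hDF] at h1
  have h2 := S.toCoord_connection hya (hZ.mdifferentiableAt y) (ofCoord E a y v)
  have h3 := S.toCoord_connection (a := b) hφy ((hZ.pushforward φ).mdifferentiableAt (φ y))
    (tangentCLM E φ y (ofCoord E a y v))
  have h4 := (congrArg (fderiv ℝ F p) h2).symm.trans (h1.trans h3)
  rw [hDF, toCoord_ofCoord hya, hyp, ← hFp, covCoord_apply, covCoord_apply, hZc.fderiv_eq,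
    hZc.eq_of_nhds] at h4
  have h5 : (fun q ↦ coordField b (pushforward φ Z) (F q)) =ᶠ[𝓝 p] fun q ↦ fderiv ℝ F q w := by
    filter_upwards [hZc, (isOpen_localRep_dom φ.continuous a b).mem_nhds ⟨hp, hφp⟩] with q hq hq'
    rw [coordField_pushforward φ Z hq'.1 hq'.2, hq]
  have h6 : DifferentiableAt ℝ (coordField b (pushforward φ Z)) (F p) := by
    rw [hFp]
    exact (mdifferentiableAt_iff_coordField hφy).1 ((hZ.pushforward φ).mdifferentiableAt (φ y))
  have h7 : HasFDerivAt (fun q ↦ coordField b (pushforward φ Z) (F q)) _ p :=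
    HasFDerivAt.comp (g := coordField b (pushforward φ Z)) p h6.hasFDerivAt
      (hFs.differentiableAt (by simp)).hasFDerivAt
  have h8 := ((hFs.fderiv_right (m := ∞) (by simp)).differentiableAt
    (by simp)).hasFDerivAt.clm_apply (hasFDerivAt_const w p)
  have h9 := DFunLike.congr_fun (h7.unique (h8.congr_of_eventuallyEq h5)) v
  simp only [ContinuousLinearMap.comp_apply, add_apply, ContinuousLinearMap.flip_apply,
    zero_apply, map_zero, zero_add] at h9
  have h10 : coordField b (pushforward φ Z) (F p) = fderiv ℝ F p w := h5.eq_of_nhds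
  rw [h9, h10] at h4
  rw [eq_sub_iff_add_eq, ← h4]
  simp

/-- The right-hand side of the total differential equation satisfied by the 1-jet of an affine
transformation. -/
noncomputable def jetField (a b : M) (q : E × E × (E →L[ℝ] E)) : E →L[ℝ] E × (E →L[ℝ] E) :=
  q.2.2.prod ((ContinuousLinearMap.compL ℝ E E E q.2.2).comp (S.christoffel a q.1) -
    (S.christoffel b q.2.1).bilinearComp q.2.2 q.2.2)

omit [CompleteSpace E] [T2Space M] in
theorem contDiffAt_jetField {q : E × E × (E →L[ℝ] E)} (h1 : q.1 ∈ (chartAt E a).target)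
    (h2 : q.2.1 ∈ (chartAt E b).target) : ContDiffAt ℝ ∞ (S.jetField a b) q := by
  have hL : ContDiffAt ℝ ∞ (fun q : E × E × (E →L[ℝ] E) ↦ q.2.2) q :=
    contDiffAt_snd.snd
  have hf : ContDiffAt ℝ ∞ (fun q : E × E × (E →L[ℝ] E) ↦ q.2.1) q :=
    contDiffAt_snd.fst
  have ha : ContDiffAt ℝ ∞ (fun q : E × E × (E →L[ℝ] E) ↦ S.christoffel a q.1) q :=
    ContDiffAt.comp (g := S.christoffel a) q ((S.contDiffOn_christoffel a).contDiffAt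
      ((chartAt E a).open_target.mem_nhds h1)) contDiffAt_fst
  have hb : ContDiffAt ℝ ∞ (fun q : E × E × (E →L[ℝ] E) ↦ S.christoffel b q.2.1) q :=
    ContDiffAt.comp (g := S.christoffel b) q ((S.contDiffOn_christoffel b).contDiffAt
      ((chartAt E b).open_target.mem_nhds h2)) hf
  refine contDiffAt_clm_of_apply (F := E) (G := E × (E →L[ℝ] E)) fun v ↦ ?_
  have hv : ContDiffAt ℝ ∞ (fun q : E × E × (E →L[ℝ] E) ↦ q.2.2 v) q :=
    hL.clm_apply contDiffAt_const
  refine hv.prodMk (contDiffAt_clm_of_apply (F := E) (G := E) fun w ↦ ?_)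
  exact (hL.clm_apply ((ha.clm_apply contDiffAt_const).clm_apply contDiffAt_const)).sub
    ((hb.clm_apply hv).clm_apply (hL.clm_apply contDiffAt_const))

theorem hasFDerivAt_jet {φ : Diffeo E M} (hφ : IsAffineTransformation S.connection φ)
    {p : E} (hp : p ∈ (chartAt E a).target)
    (hφp : φ ((chartAt E a).symm p) ∈ (chartAt E b).source) :
    HasFDerivAt (fun z ↦ (localRep E a b φ z, fderiv ℝ (localRep E a b φ) z))
      (S.jetField a b (p, localRep E a b φ p, fderiv ℝ (localRep E a b φ) p)) p := by
  have hFs : ContDiffAt ℝ ∞ (localRep E a b φ) p := contDiffAt_localRep φ.contMDiff hp hφp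
  have h1 := ((hFs.fderiv_right (m := ∞) (by simp)).differentiableAt (by simp)).hasFDerivAt
  have h2 : fderiv ℝ (fderiv ℝ (localRep E a b φ)) p =
      (ContinuousLinearMap.compL ℝ E E E (fderiv ℝ (localRep E a b φ) p)).comp (S.christoffel a p) -
        (S.christoffel b (localRep E a b φ p)).bilinearComp (fderiv ℝ (localRep E a b φ) p)
          (fderiv ℝ (localRep E a b φ) p) := by
    ext v w
    exact S.fderiv_fderiv_localRep_of_isAffineTransformation hφ hp hφp v w
  rw [h2] at h1
  exact (hFs.differentiableAt (by simp)).hasFDerivAt.prodMk h1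

/-- The transformation law expresses the second derivative through the 1-jet, so the 1-jet solves a
total differential equation with smooth right-hand side, and local uniqueness applies. -/
theorem eventuallyEq_of_mem_aff {φ ψ : Diffeo E M} (hφ : φ ∈ aff S.connection)
    (hψ : ψ ∈ aff S.connection) {y : M} (h : φ y = ψ y)
    (hd : fderiv ℝ (localRep E y (φ y) φ) (chartAt E y y) =
      fderiv ℝ (localRep E y (φ y) ψ) (chartAt E y y)) : ∀ᶠ z in 𝓝 y, φ z = ψ z := by
  have hy := mem_chart_source E y
  have hb := mem_chart_source E (φ y)
  have hyt := (chartAt E y).map_source hy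
  have e : (chartAt E y).symm (chartAt E y y) = y := (chartAt E y).left_inv hy
  have d1 := (isOpen_localRep_dom φ.continuous y (φ y)).mem_nhds
    (x := chartAt E y y) ⟨hyt, by simp [e]⟩
  have d2 := (isOpen_localRep_dom ψ.continuous y (φ y)).mem_nhds
    (x := chartAt E y y) ⟨hyt, by simp [e, ← h]⟩
  have h1 := eventuallyEq_of_hasFDerivAt (V := S.jetField y (φ y)) (p := chartAt E y y)
    (H₁ := fun z ↦ (localRep E y (φ y) φ z, fderiv ℝ (localRep E y (φ y) φ) z))
    (H₂ := fun z ↦ (localRep E y (φ y) ψ z, fderiv ℝ (localRep E y (φ y) ψ) z))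
    ((S.contDiffAt_jetField hyt (by
      rw [localRep_chart hy]; exact (chartAt E (φ y)).map_source hb)).of_le (by simp))
    (by filter_upwards [d1] with z hz using S.hasFDerivAt_jet hφ hz.1 hz.2)
    (by filter_upwards [d2] with z hz using S.hasFDerivAt_jet hψ hz.1 hz.2)
    (by rw [hd, localRep_chart hy, localRep_chart hy, h])
  have hc := (chartAt E y).continuousAt hy
  filter_upwards [(chartAt E y).open_source.mem_nhds hy, hc.eventually h1, hc.eventually d1,
    hc.eventually d2] with z hz h2 h3 h4
  have h5 := congrArg Prod.fst h2
  simp only [localRep_chart hz] at h5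
  have h6 := h3.2
  have h7 := h4.2
  simp only [Set.mem_preimage, (chartAt E y).left_inv hz] at h6 h7
  exact (chartAt E (φ y)).injOn h6 h7 h5

/-- An affine transformation of a connected symplectic symmetric space is determined by its
1-jet at a point. -/
theorem eq_of_mem_aff [ConnectedSpace M] {φ ψ : Diffeo E M} (hφ : φ ∈ aff S.connection)
    (hψ : ψ ∈ aff S.connection) {y : M} (h : φ y = ψ y)
    (hd : tangentCLM E φ y = tangentCLM E ψ y) : φ = ψ := by
  -- Openness is immediate for coincidence of germs. At a limit point the values and the derivatives
  -- agree by continuity, and local uniqueness restores coincidence of germs.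
  have hopen : IsOpen {z : M | ∀ᶠ u in 𝓝 z, φ u = ψ u} := isOpen_iff_mem_nhds.2 fun z hz ↦
    eventually_eventually_nhds.2 hz
  have key : Set.univ ⊆ {z : M | ∀ᶠ u in 𝓝 z, φ u = ψ u} := by
    refine isPreconnected_univ.subset_of_closure_inter_subset hopen ⟨y, trivial,
      S.eventuallyEq_of_mem_aff hφ hψ h ?_⟩ ?_
    · ext v
      have h1 := fderiv_localRep_self φ.contMDiff y v
      have h2 := fderiv_localRep_self ψ.contMDiff y v
      rw [← h] at h2
      rw [h1, h2, hd]
    · rintro z ⟨hz, -⟩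
      have hz' : ∃ᶠ u in 𝓝 z, ∀ᶠ u' in 𝓝 u, φ u' = ψ u' := mem_closure_iff_frequently.1 hz
      have e1 : φ z = ψ z := tendsto_nhds_unique_of_frequently_eq φ.continuous.continuousAt
        ψ.continuous.continuousAt (hz'.mono fun u hu ↦ hu.self_of_nhds)
      refine S.eventuallyEq_of_mem_aff hφ hψ e1 ?_
      have hzs := mem_chart_source E z
      have hb := mem_chart_source E (φ z)
      have hzt := (chartAt E z).map_source hzs
      have e : (chartAt E z).symm (chartAt E z z) = z := (chartAt E z).left_inv hzs
      have c1 : ContinuousAt (fun u ↦ fderiv ℝ (localRep E z (φ z) φ) (chartAt E z u)) z :=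
        ((contDiffAt_localRep φ.contMDiff hzt (by rw [e]; exact hb)).fderiv_right (m := ∞)
          (by simp)).continuousAt.comp ((chartAt E z).continuousAt hzs)
      have c2 : ContinuousAt (fun u ↦ fderiv ℝ (localRep E z (φ z) ψ) (chartAt E z u)) z :=
        ((contDiffAt_localRep ψ.contMDiff hzt (by rw [e, ← e1]; exact hb)).fderiv_right (m := ∞)
          (by simp)).continuousAt.comp ((chartAt E z).continuousAt hzs)
      refine tendsto_nhds_unique_of_frequently_eq c1 c2 ((hz'.and_eventually
        ((chartAt E z).open_source.mem_nhds hzs)).mono fun u hu ↦ ?_)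
      have hu2 : u ∈ (chartAt E z).source := hu.2
      have h1 : ∀ᶠ p in 𝓝 (chartAt E z u), φ ((chartAt E z).symm p) = ψ ((chartAt E z).symm p) := by
        have h2 := (chartAt E z).continuousAt_symm ((chartAt E z).map_source hu2)
        rw [ContinuousAt, (chartAt E z).left_inv hu2] at h2
        exact h2.eventually hu.1
      refine Filter.EventuallyEq.fderiv_eq ?_
      filter_upwards [h1] with p hp
      rw [localRep, localRep, hp]
  exact Diffeomorph.ext fun z ↦ by
    have h1 : ∀ᶠ u in 𝓝 z, φ u = ψ u := key (Set.mem_univ z)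
    exact h1.self_of_nhds

omit [FiniteDimensional ℝ E] [CompleteSpace E] [T2Space M] [IsManifold 𝓘(ℝ, E) ∞ M] in
theorem tangentCLM_mul (φ ψ : Diffeo E M) (x : M) (v : E) :
    tangentCLM E (φ * ψ : Diffeo E M) x v = tangentCLM E φ (ψ x) (tangentCLM E ψ x v) :=
  diff_mul φ ψ x v

/-- For affine `φ`, both `φ s_x` and `s_{φ(x)} φ` are affine, send `x` to `φ(x)` and have
differential `-dφ` there, so rigidity makes them equal. The other inclusion is invariance of the
connection under homomorphisms. -/
theorem aut_eq_aff_inf_symp [ConnectedSpace M] : S.aut = aff S.connection ⊓ symp S.Ω := by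
  refine le_antisymm (le_inf S.aut_le_aff fun φ hφ ↦ hφ.1) fun φ hφ ↦ ⟨hφ.2, fun x ↦ ?_⟩
  refine S.eq_of_mem_aff (y := x) (mul_mem hφ.1 (S.symmetry_mem_aff x))
    (mul_mem (S.symmetry_mem_aff (φ x)) hφ.1) ?_ ?_
  · rw [mul_apply, mul_apply, S.symmetry_self, S.symmetry_self]
  · ext v
    rw [tangentCLM_mul, tangentCLM_mul, S.tangentCLM_symmetry, S.tangentCLM_symmetry,
      S.symmetry_self, map_neg]

end SymplecticSymmetricSpace

end SymplecticSymmetric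

/-! ### Assembly of the theorem -/

theorem mainTheorem7
    {E : Type*} [NormedAddCommGroup E] [NormedSpace ℝ E] [FiniteDimensional ℝ E] [CompleteSpace E]
    {M : Type*} [TopologicalSpace M] [T2Space M] [SecondCountableTopology M] [ConnectedSpace M]
    [ChartedSpace E M] [IsManifold 𝓘(ℝ, E) ∞ M]
    (S : SymplecticSymmetricSpace E M) :
    ∃ cov : AffineConnection E M,
      S.IsAdmissible cov ∧
      (∀ cov' : AffineConnection E M, S.IsAdmissible cov' →
        ∀ (Y : VField E M) (x : M),
          MDifferentiableAt 𝓘(ℝ, E) 𝓘(ℝ, E).tangent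
            (fun y ↦ (⟨y, Y y⟩ : TangentBundle 𝓘(ℝ, E) M)) x →
          cov' Y x = cov Y x) ∧
      (∀ X Y Z : VField E M, IsSmoothField X → IsSmoothField Y → IsSmoothField Z → ∀ x : M,
        S.Ω.form x (cov Y x (X x)) (Z x) =
          (1 / 2) * dirDeriv
            (fun y ↦ S.Ω.form y (Y y + pushforward (S.symmetry x) Y y) (Z y)) x (X x)) ∧
      cov.torsion = 0 ∧
      IsComplete cov ∧
      S.aut = aff cov ⊓ symp S.Ω ∧
      IsLieTransformationGroup S.aut :=
  ⟨S.connection, S.isAdmissible_connection, fun _ h _ _ hY ↦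
      S.covAt_eq_of_symmetry_mem_aff S.symmetry_mem_aff h.affine hY,
    fun _ _ _ _ hY hZ x ↦ S.bilin_connection hY hZ x, S.torsion_connection,
    S.isComplete_connection, S.aut_eq_aff_inf_symp, S.isLieTransformationGroup_aut⟩
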